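/- **Language.** Fix pairwise disjoint infinite sets of class names $C$, method names $m$, field names $f$ and variables $x$ (with a special variable $\mathit{this}$); variables are ordered like $\mathbb N$. Expressions and processes are $$E ::= f \mid x \mid \mathtt{new}\ C(E_1,\dots,E_n),\qquad P ::= \mathtt 0 \mid (f\leftarrow E).P \mid \mathtt{let}\ x=E\ \mathtt{in}\ P \mid x!m(E_1,\dots,E_n).P \mid [E=E']P;P' \mid P+P',$$ with processes taken up to renaming of $\mathtt{let}$-bound variables. A program consists of a main process, a tuple of fields $\mathrm{fields}(C)$ for each class $C$, and finitely many method definitions $C.m(x_1,\dots,x_n)=P_{C,m}$, at most one for each pair $(C,m)$, such that every $\mathtt{new}\ C(E_1,\dots,E_n)$ has as many arguments as $C$ has fields and $P_{C,m}$ mentions only fields of $C$. It is a program of $\mathtt{Actor^{ro}_{ba}}$ if $\mathtt{new}$ occurs only in the main process (bounded actors) and field updates $(f\leftarrow E)$ occur nowhere (read-only fields). **Semantics.** At run time there are also actor names, infinitely many in each class and ordered like $\mathbb N$ there, and a root name $\aleph$ of a class not in the program; values are variables and actor names. A configuration is a finite set of terms $A\triangleright(P,\varphi,q)$, at most one for each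 actor name $A$, where $P$ is a process, $\varphi$ a finite map from fields to values, and $q$ a finite queue of messages $m(U_1,\dots,U_k)$ with values $U_i$. Values evaluate to themselves, $f$ to $\varphi(f)$, and $\mathtt{new}\ C(\tilde E)$ to the first unused actor name $B$ of class $C$, adding $B\triangleright(\mathtt 0,[\mathrm{fields}(C)\mapsto\tilde U],\varepsilon)$ to the configuration, where $\tilde U$ are the values of $\tilde E$. One step of the transition relation lets one actor $A\triangleright(P,\varphi,q)$ do one of the following: perform an update; replace $\mathtt{let}\ x=E\ \mathtt{in}\ P$ by $P\{U/x\}$, $U$ the value of $E$; execute $B!m(\tilde E).P$, appending $m(\tilde U)$ to the queue of actor $B$ (possibly $B=A$) and continuing as $P$; continue $[E=E']P;P'$ as $P$ if $E,E'$ have equal values and as $P'$ if they have different values; continue $P+P'$ as $P$ or as $P'$; or, if its process is $\mathtt 0$, its queue is $m(U_1,\dots,U_n)\cdot q'$, and $C.m(x_1,\dots,x_n)=P_{C,m}$ with $C$ the class of $A$, remove the first message and start $P_{C,m}$ with $A$ for $\mathit{this}$, $U_i$ for $x_i$, and the least unused variables, in distinct fashion, for the remaining free variables of $P_{C,m}$.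 An actor to which no clause applies does not move. The initial configuration of a program with main process $P$ is $\aleph\triangleright(P,\varnothing,\varepsilon)$. A computation is a sequence of successive steps. **Theorem.** The termination problem is decidable for programs of $\mathtt{Actor^{ro}_{ba}}$: there is one algorithm that, given any program of $\mathtt{Actor^{ro}_{ba}}$, decides whether the program has no infinite computation from its initial configuration. Moreover there is one algorithm that, given any program of $\mathtt{Actor^{ro}_{ba}}$ and any configuration $S$ reachable from its initial configuration, decides whether there is no infinite computation from $S$. -/

import Mathlib

/-! The actor language: names, expressions, processes. -/

abbrev ClassName := ℕ
abbrev MethodName := ℕ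
abbrev FieldName := ℕ
abbrev Variable := ℕ

/-- Actor names: the name `root` of the root actor, and the names `of C i` (`i = 0, 1, 2, …`),
which form the infinite, totally ordered partition of the class `C`. -/
inductive ActorName where
  | root : ActorName
  | of (C : ClassName) (i : ℕ) : ActorName
  deriving DecidableEq

/-- Values: variables and actor names. -/
inductive Val where
  | var (x : Variable) : Val
  | actor (A : ActorName) : Val
  deriving DecidableEq

/-- References: a value, or an occurrence of a variable bound by an enclosing `let`, written as a
de Bruijn index (`bvar 0` refers to the innermost enclosing `let`).  So processes that differ only
in the names of their bound variables are literally equal. -/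
inductive Ref where
  | val (v : Val) : Ref
  | bvar (i : ℕ) : Ref

/-- (Run-time) expressions: a field, a variable or actor name, or `new C(E₁, …, Eₙ)`. -/
inductive Expr where
  | field (f : FieldName) : Expr
  | ref (r : Ref) : Expr
  | new (C : ClassName) (args : List Expr) : Expr

/-- (Run-time) processes. -/
inductive Proc where
  /-- the terminated process -/
  | zero : Proc
  /-- field update `(f ← E).P` -/
  | upd (f : FieldName) (E : Expr) (P : Proc) : Proc
  /-- `let x = E in P`; the bound variable is `bvar 0` in `P` -/
  | letIn (E : Expr) (P : Proc) : Proc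
  /-- invocation `r!m(E₁, …, Eₙ).P` -/
  | call (r : Ref) (m : MethodName) (args : List Expr) (P : Proc) : Proc
  /-- name matching `[E = E'] P ; Q` -/
  | cond (E E' : Expr) (P Q : Proc) : Proc
  /-- nondeterministic choice `P + Q` -/
  | plus (P Q : Proc) : Proc

/-- The special variable `this`. -/
def thisVar : Variable := 0

/-- A definition `C.m(x₁, …, xₙ) = P`. -/
structure MethodDef where
  cls : ClassName
  name : MethodName
  params : List Variable
  body : Proc

/-- A program: a main process, the table of the field tuples of its classes, and a finite list of
method definitions. -/
structure Program where
  main : Proc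
  fieldTable : List (ClassName × List FieldName)
  defs : List MethodDef

/-- The map from actor classes to tuples of fields (classes not in the table have no fields). -/
def Program.fields (p : Program) (C : ClassName) : List FieldName :=
  (p.fieldTable.lookup C).getD []

/-! Free variables. -/

def Val.fv : Val → Finset Variable
  | .var x => {x}
  | .actor _ => ∅

def Ref.fv : Ref → Finset Variable
  | .val v => v.fv
  | .bvar _ => ∅

mutual
def Expr.fv : Expr → Finset Variable
  | .field _ => ∅
  | .ref r => r.fv
  | .new _ args => Expr.fvList args
def Expr.fvList : List Expr → Finset Variable
  | [] => ∅
  | E :: Es => E.fv ∪ Expr.fvList Es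
end

def Proc.fv : Proc → Finset Variable
  | .zero => ∅
  | .upd _ E P => E.fv ∪ P.fv
  | .letIn E P => E.fv ∪ P.fv
  | .call r _ args P => r.fv ∪ Expr.fvList args ∪ P.fv
  | .cond E E' P Q => E.fv ∪ E'.fv ∪ P.fv ∪ Q.fv
  | .plus P Q => P.fv ∪ Q.fv

/-! Simultaneous substitution of values for free variables. -/

def Ref.subst (σ : Variable → Val) : Ref → Ref
  | .val (.var x) => .val (σ x)
  | .val (.actor A) => .val (.actor A)
  | .bvar i => .bvar i

mutual
def Expr.subst (σ : Variable → Val) : Expr → Expr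
  | .field f => .field f
  | .ref r => .ref (r.subst σ)
  | .new C args => .new C (Expr.substList σ args)
def Expr.substList (σ : Variable → Val) : List Expr → List Expr
  | [] => []
  | E :: Es => E.subst σ :: Expr.substList σ Es
end

def Proc.subst (σ : Variable → Val) : Proc → Proc
  | .zero => .zero
  | .upd f E P => .upd f (E.subst σ) (P.subst σ)
  | .letIn E P => .letIn (E.subst σ) (P.subst σ)
  | .call r m args P => .call (r.subst σ) m (Expr.substList σ args) (P.subst σ)
  | .cond E E' P Q => .cond (E.subst σ) (E'.subst σ) (P.subst σ) (Q.subst σ)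
  | .plus P Q => .plus (P.subst σ) (Q.subst σ)

/-! Replacing the bound variable with index `k` by a value (used with `k = 0` on the body of a
`let`). -/

def Ref.inst (U : Val) (k : ℕ) : Ref → Ref
  | .val v => .val v
  | .bvar i => if i = k then .val U else .bvar i

mutual
def Expr.inst (U : Val) (k : ℕ) : Expr → Expr
  | .field f => .field f
  | .ref r => .ref (r.inst U k)
  | .new C args => .new C (Expr.instList U k args)
def Expr.instList (U : Val) (k : ℕ) : List Expr → List Expr
  | [] => []
  | E :: Es => E.inst U k :: Expr.instList U k Es
end

def Proc.inst (U : Val) : ℕ → Proc → Proc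
  | _, .zero => .zero
  | k, .upd f E P => .upd f (E.inst U k) (P.inst U k)
  | k, .letIn E P => .letIn (E.inst U k) (P.inst U (k + 1))
  | k, .call r m args P => .call (r.inst U k) m (Expr.instList U k args) (P.inst U k)
  | k, .cond E E' P Q => .cond (E.inst U k) (E'.inst U k) (P.inst U k) (Q.inst U k)
  | k, .plus P Q => .plus (P.inst U k) (Q.inst U k)

/-! Programs: static conditions.  `k` counts the enclosing `let`s, `F` says which field names may
occur.  The conditions say that the term is source syntax (no actor names, no dangling index), that
`new C(E₁, …, Eₙ)` has as many arguments as `C` has fields, and that all field names satisfy `F`. -/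

def Ref.Source (k : ℕ) : Ref → Prop
  | .val (.var _) => True
  | .val (.actor _) => False
  | .bvar i => i < k

mutual
def Expr.Correct (p : Program) (F : FieldName → Prop) (k : ℕ) : Expr → Prop
  | .field f => F f
  | .ref r => r.Source k
  | .new C args => args.length = (p.fields C).length ∧ Expr.CorrectList p F k args
def Expr.CorrectList (p : Program) (F : FieldName → Prop) (k : ℕ) : List Expr → Prop
  | [] => True
  | E :: Es => E.Correct p F k ∧ Expr.CorrectList p F k Es
end

def Proc.Correct (p : Program) (F : FieldName → Prop) : ℕ → Proc → Prop
  | _, .zero => True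
  | k, .upd f E P => F f ∧ E.Correct p F k ∧ P.Correct p F k
  | k, .letIn E P => E.Correct p F k ∧ P.Correct p F (k + 1)
  | k, .call r _ args P => r.Source k ∧ Expr.CorrectList p F k args ∧ P.Correct p F k
  | k, .cond E E' P Q =>
      E.Correct p F k ∧ E'.Correct p F k ∧ P.Correct p F k ∧ Q.Correct p F k
  | k, .plus P Q => P.Correct p F k ∧ Q.Correct p F k

/-- Every pair `C`, `m` has at most one definition. -/
def Program.Unambiguous (p : Program) : Prop :=
  (p.defs.map fun d => (d.cls, d.name)).Nodup

/-- Creations have the right number of arguments, and a method of class `C` only mentions fields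
of `C` (also: the program is source syntax). -/
def Program.Correct (p : Program) : Prop :=
  p.main.Correct p (fun _ => True) 0 ∧
    ∀ d ∈ p.defs, d.body.Correct p (fun f => f ∈ p.fields d.cls) 0

/-! The fragments. -/

/-- The expression contains no `new`. -/
def Expr.NoNew : Expr → Prop
  | .field _ => True
  | .ref _ => True
  | .new _ _ => False

/-- The process contains no `new` expression. -/
def Proc.NoNew : Proc → Prop
  | .zero => True
  | .upd _ E P => E.NoNew ∧ P.NoNew
  | .letIn E P => E.NoNew ∧ P.NoNew
  | .call _ _ args P => (∀ E ∈ args, E.NoNew) ∧ P.NoNew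
  | .cond E E' P Q => E.NoNew ∧ E'.NoNew ∧ P.NoNew ∧ Q.NoNew
  | .plus P Q => P.NoNew ∧ Q.NoNew

/-- The process contains no field update. -/
def Proc.NoUpdate : Proc → Prop
  | .zero => True
  | .upd _ _ _ => False
  | .letIn _ P => P.NoUpdate
  | .call _ _ _ P => P.NoUpdate
  | .cond _ _ P Q => P.NoUpdate ∧ Q.NoUpdate
  | .plus P Q => P.NoUpdate ∧ Q.NoUpdate

/-- Bounded actors: `new` occurs only in the main process. -/
def Program.BoundedActors (p : Program) : Prop :=
  ∀ d ∈ p.defs, d.body.NoNew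

/-- Read-only fields: there is no field update. -/
def Program.ReadOnly (p : Program) : Prop :=
  p.main.NoUpdate ∧ ∀ d ∈ p.defs, d.body.NoUpdate

/-- The programs with bounded actors and read-only fields. -/
structure Program.IsRoBa (p : Program) : Prop where
  unambiguous : p.Unambiguous
  correct : p.Correct
  boundedActors : p.BoundedActors
  readOnly : p.ReadOnly

/-! Configurations. -/

/-- Association lists, read with `List.lookup`, represent finite maps; `put l a b` is `l[a ↦ b]`. -/
def put {α β : Type} [DecidableEq α] : List (α × β) → α → β → List (α × β)
  | [], a, b => [(a, b)]
  | e :: l, a, b => if e.1 = a then (a, b) :: l else e :: put l a b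

/-- A queued term `m(U₁, …, Uₙ)`. -/
structure Message where
  name : MethodName
  args : List Val

/-- The state of an actor: a finite map from fields to values. -/
abbrev State := List (FieldName × Val)

/-- The part `(P, φ, q)` of a term `A ▷ (P, φ, q)`. -/
structure Local where
  proc : Proc
  state : State
  queue : List Message

/-- A configuration: a finite set of terms `A ▷ (P, φ, q)`, at most one for each actor name `A`,
represented as a finite map from actor names. -/
abbrev Config := List (ActorName × Local)

/-- The variable `x` occurs in the configuration. -/
def Config.Uses (S : Config) (x : Variable) : Prop :=
  ∃ t ∈ S, x ∈ t.2.proc.fv ∨ (∃ e ∈ t.2.state, e.2 = .var x) ∨ ∃ M ∈ t.2.queue, .var x ∈ M.args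

/-- The least `n` unused variables (`this` is not available as a fresh variable). -/
noncomputable def Config.freshVars (S : Config) (n : ℕ) : List Variable :=
  (List.range n).map (Nat.nth fun x => x ≠ thisVar ∧ ¬ S.Uses x)

/-- The first unused actor name of class `C`. -/
noncomputable def Config.freshActor (S : Config) (C : ClassName) : ActorName :=
  .of C (sInf {i | S.lookup (.of C i) = none})

/-! Evaluation of expressions.  The configuration is threaded through the evaluation: the result of
`E.eval p φ S` is the value of `E` in the state `φ` together with `S` extended by the actors that
the evaluation creates.  It is `none` if `E` has no value. -/

mutual
noncomputable def Expr.eval (p : Program) (φ : State) (S : Config) : Expr → Option (Val × Config)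
  | .field f => (φ.lookup f).map fun U => (U, S)
  | .ref (.val U) => some (U, S)
  | .ref (.bvar _) => none
  | .new C args =>
    match Expr.evalList p φ S args with
    | none => none
    | some (Us, S') =>
      if Us.length = (p.fields C).length then
        some (.actor (S'.freshActor C),
          put S' (S'.freshActor C) ⟨.zero, (p.fields C).zip Us, []⟩)
      else none
noncomputable def Expr.evalList (p : Program) (φ : State) (S : Config) :
    List Expr → Option (List Val × Config)
  | [] => some ([], S)
  | E :: Es =>
    match Expr.eval p φ S E with
    | none => none
    | some (U, S') =>
      match Expr.evalList p φ S' Es with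
      | none => none
      | some (Us, S'') => some (U :: Us, S'')
end

/-- The substitution used when the actor `A` starts to execute a message `m(U₁, …, Uₙ)` by the
definition `d`: `this` becomes `A`, the formal parameters become the `Uᵢ`, and the other free
variables of the body become distinct fresh variables. -/
noncomputable def MethodDef.binding (d : MethodDef) (S : Config) (A : ActorName) (Us : List Val) :
    Variable → Val := fun x =>
  let ys := (d.body.fv \ (insert thisVar d.params.toFinset)).sort
  if x = thisVar then .actor A
  else
    match (d.params.zip Us).lookup x with
    | some U => U
    | none => .var (((ys.zip (S.freshVars ys.length)).lookup x).getD x)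

/-- The transition relation. -/
inductive Step (p : Program) : Config → Config → Prop
  | upd {S S' : Config} {A : ActorName} {f : FieldName} {E : Expr} {P : Proc} {φ : State}
      {q : List Message} {U : Val} :
      S.lookup A = some ⟨.upd f E P, φ, q⟩ → E.eval p φ S = some (U, S') →
      (φ.lookup f).isSome →
      Step p S (put S' A ⟨P, put φ f U, q⟩)
  | letIn {S S' : Config} {A : ActorName} {E : Expr} {P : Proc} {φ : State}
      {q : List Message} {U : Val} :
      S.lookup A = some ⟨.letIn E P, φ, q⟩ → E.eval p φ S = some (U, S') →
      Step p S (put S' A ⟨P.inst U 0, φ, q⟩)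
  | invkSelf {S S' : Config} {A : ActorName} {m : MethodName} {Es : List Expr} {P : Proc}
      {φ : State} {q : List Message} {Us : List Val} :
      S.lookup A = some ⟨.call (.val (.actor A)) m Es P, φ, q⟩ →
      Expr.evalList p φ S Es = some (Us, S') →
      Step p S (put S' A ⟨P, φ, q ++ [⟨m, Us⟩]⟩)
  | invk {S S' : Config} {A A' : ActorName} {m : MethodName} {Es : List Expr} {P P' : Proc}
      {φ φ' : State} {q q' : List Message} {Us : List Val} :
      A ≠ A' → S.lookup A = some ⟨.call (.val (.actor A')) m Es P, φ, q⟩ →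
      S.lookup A' = some ⟨P', φ', q'⟩ →
      Expr.evalList p φ S Es = some (Us, S') →
      Step p S (put (put S' A ⟨P, φ, q⟩) A' ⟨P', φ', q' ++ [⟨m, Us⟩]⟩)
  | inst {S : Config} {C : ClassName} {i : ℕ} {d : MethodDef} {φ : State} {q : List Message}
      {Us : List Val} :
      d ∈ p.defs → d.cls = C → Us.length = d.params.length →
      S.lookup (.of C i) = some ⟨.zero, φ, ⟨d.name, Us⟩ :: q⟩ →
      Step p S (put S (.of C i) ⟨d.body.subst (d.binding S (.of C i) Us), φ, q⟩)
  | isEq {S S' : Config} {A : ActorName} {E E' : Expr} {P Q : Proc} {φ : State}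
      {q : List Message} {U : Val} :
      S.lookup A = some ⟨.cond E E' P Q, φ, q⟩ →
      Expr.evalList p φ S [E, E'] = some ([U, U], S') →
      Step p S (put S' A ⟨P, φ, q⟩)
  | isNe {S S' : Config} {A : ActorName} {E E' : Expr} {P Q : Proc} {φ : State}
      {q : List Message} {U V : Val} :
      S.lookup A = some ⟨.cond E E' P Q, φ, q⟩ →
      Expr.evalList p φ S [E, E'] = some ([U, V], S') → U ≠ V →
      Step p S (put S' A ⟨Q, φ, q⟩)
  | plusL {S : Config} {A : ActorName} {P Q : Proc} {φ : State} {q : List Message} :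
      S.lookup A = some ⟨.plus P Q, φ, q⟩ → Step p S (put S A ⟨P, φ, q⟩)
  | plusR {S : Config} {A : ActorName} {P Q : Proc} {φ : State} {q : List Message} :
      S.lookup A = some ⟨.plus P Q, φ, q⟩ → Step p S (put S A ⟨Q, φ, q⟩)

/-- The initial configuration `ℵ ▷ (P, ∅, ε)`. -/
def Program.initial (p : Program) : Config := [(.root, ⟨p.main, [], []⟩)]

/-- The configuration `S` has no infinite computation. -/
def Program.TerminatesFrom (p : Program) (S : Config) : Prop :=
  ¬ ∃ s : ℕ → Config, s 0 = S ∧ ∀ n, Step p (s n) (s (n + 1))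

/-- The program has no infinite computation. -/
def Program.Terminates (p : Program) : Prop := p.TerminatesFrom p.initial

/-- The states of the transition system of the program. -/
def Program.Reachable (p : Program) (S : Config) : Prop :=
  Relation.ReflTransGen (Step p) p.initial S

/-! Gödel numbering of syntax and configurations, the inputs of algorithms. -/

def ActorName.code : ActorName → ℕ
  | .root => 0
  | .of C i => Nat.pair C i + 1

def Val.code : Val → ℕ
  | .var x => Nat.pair 0 x
  | .actor A => Nat.pair 1 A.code

def Ref.code : Ref → ℕ
  | .val v => Nat.pair 0 v.code
  | .bvar i => Nat.pair 1 i

mutual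
def Expr.code : Expr → ℕ
  | .field f => Nat.pair 0 f + 1
  | .ref r => Nat.pair 1 r.code + 1
  | .new C args => Nat.pair 2 (Nat.pair C (Expr.codeList args)) + 1
def Expr.codeList : List Expr → ℕ
  | [] => 0
  | E :: Es => Nat.pair E.code (Expr.codeList Es) + 1
end

def Proc.code : Proc → ℕ
  | .zero => 0
  | .upd f E P => Nat.pair 0 (Nat.pair f (Nat.pair E.code P.code)) + 1
  | .letIn E P => Nat.pair 1 (Nat.pair E.code P.code) + 1
  | .call r m args P =>
      Nat.pair 2 (Nat.pair r.code (Nat.pair m (Nat.pair (Expr.codeList args) P.code))) + 1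
  | .cond E E' P Q =>
      Nat.pair 3 (Nat.pair E.code (Nat.pair E'.code (Nat.pair P.code Q.code))) + 1
  | .plus P Q => Nat.pair 4 (Nat.pair P.code Q.code) + 1

abbrev ProgramCode := ℕ × List (ℕ × List ℕ) × List (ℕ × ℕ × List ℕ × ℕ)

def Program.code (p : Program) : ProgramCode :=
  (p.main.code, p.fieldTable, p.defs.map fun d => (d.cls, d.name, d.params, d.body.code))

abbrev ConfigCode := List (ℕ × ℕ × List (ℕ × ℕ) × List (ℕ × List ℕ))

def Config.code (S : Config) : ConfigCode :=
  S.map fun t => (t.1.code, t.2.proc.code, t.2.state.map fun e => (e.1, e.2.code),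
    t.2.queue.map fun M => (M.name, M.args.map Val.code))

/-! The numbering is injective. -/

theorem ActorName.code_injective : Function.Injective ActorName.code := by
  intro A B h
  cases A <;> cases B <;> simp_all [ActorName.code]

theorem Val.code_injective : Function.Injective Val.code := by
  intro U V h
  cases U <;> cases V <;> simp_all [Val.code, ActorName.code_injective.eq_iff]

theorem Ref.code_injective : Function.Injective Ref.code := by
  intro U V h
  cases U <;> cases V <;> simp_all [Ref.code, Val.code_injective.eq_iff]

mutual
theorem Expr.code_inj : ∀ E E' : Expr, E.code = E'.code → E = E'
  | .field _, E', h => by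
    cases E' <;> simp_all [Expr.code]
  | .ref _, E', h => by
    cases E' <;> simp_all [Expr.code, Ref.code_injective.eq_iff]
  | .new _ args, .new _ args', h => by
    simp only [Expr.code, Nat.add_right_cancel_iff, Nat.pair_eq_pair, true_and] at h
    rw [h.1, Expr.codeList_inj args args' h.2]
  | .new _ _, .field _, h => by simp [Expr.code] at h
  | .new _ _, .ref _, h => by simp [Expr.code] at h
theorem Expr.codeList_inj : ∀ l l' : List Expr, Expr.codeList l = Expr.codeList l' → l = l'
  | [], l', h => by cases l' <;> simp_all [Expr.codeList]
  | _ :: _, [], h => by simp [Expr.codeList] at h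
  | E :: l, E' :: l', h => by
    simp only [Expr.codeList, Nat.add_right_cancel_iff, Nat.pair_eq_pair] at h
    rw [Expr.code_inj E E' h.1, Expr.codeList_inj l l' h.2]
end

theorem Proc.code_injective : Function.Injective Proc.code := by
  intro P
  induction P with
  | zero => intro Q h; cases Q <;> simp_all [Proc.code]
  | upd f E P ih =>
    intro Q h
    cases Q <;> simp [Proc.code] at h
    rw [h.1, Expr.code_inj _ _ h.2.1, ih h.2.2]
  | letIn E P ih =>
    intro Q h
    cases Q <;> simp [Proc.code] at h
    rw [Expr.code_inj _ _ h.1, ih h.2]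
  | call r m args P ih =>
    intro Q h
    cases Q <;> simp [Proc.code] at h
    rw [Ref.code_injective h.1, h.2.1, Expr.codeList_inj _ _ h.2.2.1, ih h.2.2.2]
  | cond E E' P Q ih ih' =>
    intro R h
    cases R <;> simp [Proc.code] at h
    rw [Expr.code_inj _ _ h.1, Expr.code_inj _ _ h.2.1, ih h.2.2.1, ih' h.2.2.2]
  | plus P Q ih ih' =>
    intro R h
    cases R <;> simp [Proc.code] at h
    rw [ih h.1, ih' h.2]

theorem Program.code_injective : Function.Injective Program.code := by
  rintro ⟨P, F, D⟩ ⟨P', F', D'⟩ h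
  simp only [Program.code, Prod.mk.injEq] at h
  obtain ⟨h1, h2, h3⟩ := h
  have hD : Function.Injective
      fun d : MethodDef => (d.cls, d.name, d.params, d.body.code) := by
    rintro ⟨a, b, c, d⟩ ⟨a', b', c', d'⟩ h
    simp only [Prod.mk.injEq] at h
    rw [h.1, h.2.1, h.2.2.1, Proc.code_injective h.2.2.2]
  rw [Proc.code_injective h1, h2, List.map_injective_iff.2 hD h3]

theorem Config.code_injective : Function.Injective Config.code := by
  refine List.map_injective_iff.2 ?_
  rintro ⟨A, P, φ, q⟩ ⟨A', P', φ', q'⟩ h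
  simp only [Prod.mk.injEq] at h
  have hφ : Function.Injective fun e : FieldName × Val => (e.1, e.2.code) := by
    rintro ⟨a, b⟩ ⟨a', b'⟩ h
    simp only [Prod.mk.injEq] at h
    rw [h.1, Val.code_injective h.2]
  have hq : Function.Injective fun M : Message => (M.name, M.args.map Val.code) := by
    rintro ⟨a, b⟩ ⟨a', b'⟩ h
    simp only [Prod.mk.injEq] at h
    rw [h.1, List.map_injective_iff.2 Val.code_injective h.2]
  rw [ActorName.code_injective h.1, Proc.code_injective h.2.1,
    List.map_injective_iff.2 hφ h.2.2.1, List.map_injective_iff.2 hq h.2.2.2]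

-- Termination and divergence are both semi-decidable, and searching for the two kinds of evidence
-- in parallel gives the algorithm. Evidence for termination comes from König's lemma: the system
-- branches finitely, so all computations end iff for some `n` none has `n` steps
-- (`not_diverges_iff`). The substance is finite evidence for divergence, in spite of unbounded
-- queues and an unbounded supply of fresh variables.
--
-- Fresh variables are tamed first. Fields are never updated, so a process started by a message
-- compares only the arguments of that message, its own fresh variables, its actor's fields and
-- actor names. Only the equality pattern of the arguments, relative to the values already present
-- at the start, matters. Hence a machine that renumbers arguments and draws fresh variables from a
-- bounded pool is bisimilar to the actor system (`CfgRel.step`, `CfgRel.move`), although it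
-- identifies variables of different messages.
--
-- Only the finitely many processes of the start configuration can execute `new`, and each of their
-- steps lowers a measure. In an infinite computation they therefore stop moving; from then on the
-- actors and their fields are fixed, and all values stay below a fixed bound (`PureStep.bound`). So
-- only finitely many letters (actor, message) are ever consumed (`finite_letters`), and what the
-- execution of a letter can emit depends on the letter alone, not on the queues.
--
-- A certificate consists of persistent actors, harmless letters and perpetual letters, with choices
-- that bring the executions to an end. Executing a harmless or perpetual letter sends only harmless
-- letters to persistent actors; executing a perpetual one also emits a perpetual letter; and some
-- perpetual letter is waiting. Such a certificate keeps the system running: the owner of a waiting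
-- perpetual letter finishes its process and executes the front of its queue, and a perpetual letter
-- is waiting again (`diverges_of_check`).
--
-- Conversely, an infinite computation has a tail in which every moving actor consumes infinitely
-- many messages. Being FIFO, such actors consume everything they receive, so the consumed letters
-- are harmless. A letter consumed infinitely often must be emitted infinitely often, hence during
-- executions of some letter that is itself consumed infinitely often. Following such predecessors
-- in a finite set closes a cycle, the perpetual letters (`exists_check_of_fair`). Thus divergence
-- means that some finite run leads to a certified configuration (`diverges_iff_exists_checkRun`).

-- Closure properties of primitive recursive functions, as rules for `fun_prop`.

section PrimrecClosure

attribute [fun_prop] Primrec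
attribute [fun_prop] Primrec.id Primrec.const Primrec.comp

namespace Primrec

variable {α β γ σ : Type} [Primcodable α] [Primcodable β] [Primcodable γ] [Primcodable σ]

theorem mk_comp {f : α → β} {g : α → γ} (hf : Primrec f) (hg : Primrec g) :
    Primrec fun a => (f a, g a) := hf.pair hg

theorem fst_comp {f : α → β × γ} (hf : Primrec f) : Primrec fun a => (f a).1 := fst.comp hf

theorem snd_comp {f : α → β × γ} (hf : Primrec f) : Primrec fun a => (f a).2 := snd.comp hf

theorem natPair_comp {f g : α → ℕ} (hf : Primrec f) (hg : Primrec g) :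
    Primrec fun a => Nat.pair (f a) (g a) := Primrec₂.natPair.comp hf hg

theorem unpair_comp {f : α → ℕ} (hf : Primrec f) : Primrec fun a => (f a).unpair :=
  unpair.comp hf

theorem add_comp {f g : α → ℕ} (hf : Primrec f) (hg : Primrec g) :
    Primrec fun a => f a + g a := nat_add.comp hf hg

theorem sub_comp {f g : α → ℕ} (hf : Primrec f) (hg : Primrec g) :
    Primrec fun a => f a - g a := nat_sub.comp hf hg

theorem mul_comp {f g : α → ℕ} (hf : Primrec f) (hg : Primrec g) :
    Primrec fun a => f a * g a := nat_mul.comp hf hg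

theorem cond_comp {c : α → Bool} {f g : α → σ} (hc : Primrec c) (hf : Primrec f)
    (hg : Primrec g) : Primrec fun a => bif c a then f a else g a := hc.cond hf hg

theorem and_comp {f g : α → Bool} (hf : Primrec f) (hg : Primrec g) :
    Primrec fun a => f a && g a := Primrec.and.comp hf hg

theorem or_comp {f g : α → Bool} (hf : Primrec f) (hg : Primrec g) :
    Primrec fun a => f a || g a := Primrec.or.comp hf hg

theorem not_comp {f : α → Bool} (hf : Primrec f) :
    Primrec fun a => !f a := Primrec.not.comp hf

theorem decide_eq_comp [DecidableEq β] {f g : α → β} (hf : Primrec f) (hg : Primrec g) :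
    Primrec fun a => decide (f a = g a) := by
  have h := (Primrec.eq (α := β)).decide.comp hf hg
  convert h

theorem decide_le_comp {f g : α → ℕ} (hf : Primrec f) (hg : Primrec g) :
    Primrec fun a => decide (f a ≤ g a) := nat_le.decide.comp hf hg

theorem some_comp {f : α → β} (hf : Primrec f) : Primrec fun a => some (f a) :=
  option_some.comp hf

theorem isSome_comp {f : α → Option β} (hf : Primrec f) : Primrec fun a => (f a).isSome :=
  option_isSome.comp hf

theorem getD_comp {f : α → Option β} {g : α → β} (hf : Primrec f) (hg : Primrec g) :
    Primrec fun a => (f a).getD (g a) := option_getD.comp hf hg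

theorem bind_comp {f : α → Option β} {g : α → β → Option σ} (hf : Primrec f)
    (hg : Primrec fun q : α × β => g q.1 q.2) : Primrec fun a => (f a).bind (g a) :=
  option_bind hf hg

theorem optionMap_comp {f : α → Option β} {g : α → β → σ} (hf : Primrec f)
    (hg : Primrec fun q : α × β => g q.1 q.2) : Primrec fun a => (f a).map (g a) :=
  option_map hf hg

theorem cons_comp {f : α → β} {g : α → List β} (hf : Primrec f) (hg : Primrec g) :
    Primrec fun a => f a :: g a := list_cons.comp hf hg

theorem append_comp {f g : α → List β} (hf : Primrec f) (hg : Primrec g) :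
    Primrec fun a => f a ++ g a := list_append.comp hf hg

theorem head?_comp {f : α → List β} (hf : Primrec f) : Primrec fun a => (f a).head? :=
  list_head?.comp hf

theorem tail_comp {f : α → List β} (hf : Primrec f) : Primrec fun a => (f a).tail :=
  list_tail.comp hf

theorem length_comp {f : α → List β} (hf : Primrec f) : Primrec fun a => (f a).length :=
  list_length.comp hf

theorem range_comp {f : α → ℕ} (hf : Primrec f) : Primrec fun a => List.range (f a) :=
  list_range.comp hf

theorem getElem?_comp {f : α → List β} {g : α → ℕ} (hf : Primrec f) (hg : Primrec g) :
    Primrec fun a => (f a)[g a]? := list_getElem?.comp hf hg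

theorem lookup_comp [DecidableEq β] {f : α → β} {g : α → List (β × γ)} (hf : Primrec f)
    (hg : Primrec g) : Primrec fun a => (g a).lookup (f a) := listLookup.comp hf hg

theorem idxOf_comp [DecidableEq β] {f : α → β} {g : α → List β} (hf : Primrec f)
    (hg : Primrec g) : Primrec fun a => (g a).idxOf (f a) := list_idxOf.comp hf hg

theorem map_comp {f : α → List β} {g : α → β → σ} (hf : Primrec f)
    (hg : Primrec fun q : α × β => g q.1 q.2) : Primrec fun a => (f a).map (g a) :=
  list_map hf hg

theorem flatMap_comp {f : α → List β} {g : α → β → List σ} (hf : Primrec f)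
    (hg : Primrec fun q : α × β => g q.1 q.2) : Primrec fun a => (f a).flatMap (g a) :=
  list_flatMap hf hg

theorem filterMap_comp {f : α → List β} {g : α → β → Option σ} (hf : Primrec f)
    (hg : Primrec fun q : α × β => g q.1 q.2) : Primrec fun a => (f a).filterMap (g a) :=
  listFilterMap hf hg

theorem findIdx_comp {f : α → List β} {g : α → β → Bool} (hf : Primrec f)
    (hg : Primrec fun q : α × β => g q.1 q.2) : Primrec fun a => (f a).findIdx (g a) :=
  list_findIdx hf hg

theorem foldl_comp {f : α → List β} {g : α → σ} {h : α → σ → β → σ} (hf : Primrec f)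
    (hg : Primrec g) (hh : Primrec fun q : α × σ × β => h q.1 q.2.1 q.2.2) :
    Primrec fun a => (f a).foldl (h a) (g a) :=
  list_foldl (h := fun a q => h a q.1 q.2) hf hg hh

theorem iterate_comp {f : α → ℕ} {g : α → β} {h : α → β → β} (hf : Primrec f) (hg : Primrec g)
    (hh : Primrec fun q : α × β => h q.1 q.2) : Primrec fun a => (h a)^[f a] (g a) :=
  nat_iterate hf hg hh

theorem all_comp {f : α → List β} {g : α → β → Bool} (hf : Primrec f)
    (hg : Primrec fun q : α × β => g q.1 q.2) : Primrec fun a => (f a).all (g a) := by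
  refine (foldl_comp (h := fun a (s : Bool) b => s && g a b) hf (const true) ?_).of_eq fun a => ?_
  · exact and_comp (fst.comp snd) (hg.comp (fst.pair (snd.comp snd)))
  · generalize f a = l
    have H : ∀ s : Bool, l.foldl (fun (s : Bool) b => s && g a b) s = (s && l.all (g a)) := by
      induction l with
      | nil => simp
      | cons b l ih => intro s; simp [ih, Bool.and_assoc]
    simpa using H true

theorem any_comp {f : α → List β} {g : α → β → Bool} (hf : Primrec f)
    (hg : Primrec fun q : α × β => g q.1 q.2) : Primrec fun a => (f a).any (g a) := by
  refine (not_comp (all_comp hf (g := fun a b => !g a b) (not_comp hg))).of_eq fun a => ?_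
  rw [List.any_eq_not_all_not]

theorem zip_comp {f : α → List β} {g : α → List γ} (hf : Primrec f) (hg : Primrec g) :
    Primrec fun a => (f a).zip (g a) := by
  refine (filterMap_comp (f := fun a => List.range (f a).length)
    (g := fun a i => ((f a)[i]?).bind fun b => ((g a)[i]?).map fun c => (b, c))
    (range_comp (length_comp hf)) ?_).of_eq fun a => ?_
  · exact bind_comp (getElem?_comp (hf.comp fst) snd)
      (optionMap_comp (getElem?_comp (hg.comp (fst.comp fst)) (snd.comp fst))
        (mk_comp (snd.comp fst) snd))
  · generalize f a = l
    generalize g a = l'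
    induction l generalizing l' with
    | nil => simp
    | cons b l ih =>
      cases l' with
      | nil => simp
      | cons c l' =>
        simp [List.range_succ_eq_map, List.filterMap_map, ih]

theorem put_comp [DecidableEq β] {f : α → List (β × γ)} {g : α → β} {h : α → γ}
    (hf : Primrec f) (hg : Primrec g) (hh : Primrec h) :
    Primrec fun a => put (f a) (g a) (h a) := by
  refine (list_rec (h := fun a (q : (β × γ) × List (β × γ) × List (β × γ)) =>
    bif decide (q.1.1 = g a) then (g a, h a) :: q.2.1 else q.1 :: q.2.2)
    hf (cons_comp (mk_comp hg hh) (const [])) ?_).of_eq fun a => ?_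
  · exact cond_comp (decide_eq_comp (fst.comp (fst.comp snd)) (hg.comp fst))
      (cons_comp (mk_comp (hg.comp fst) (hh.comp fst)) (fst.comp (snd.comp snd)))
      (cons_comp (fst.comp snd) (snd.comp (snd.comp snd)))
  · generalize f a = l
    induction l with
    | nil => rfl
    | cons e l ih =>
      simp only [put, ih]
      by_cases h : e.1 = g a <;> simp [h]

end Primrec

attribute [fun_prop] Primrec.mk_comp Primrec.fst_comp Primrec.snd_comp Primrec.natPair_comp
  Primrec.unpair_comp Primrec.add_comp Primrec.sub_comp Primrec.mul_comp Primrec.cond_comp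
  Primrec.and_comp Primrec.or_comp Primrec.not_comp Primrec.decide_eq_comp Primrec.decide_le_comp
  Primrec.some_comp Primrec.isSome_comp Primrec.getD_comp Primrec.bind_comp
  Primrec.optionMap_comp Primrec.cons_comp Primrec.append_comp Primrec.head?_comp
  Primrec.tail_comp Primrec.length_comp Primrec.range_comp Primrec.getElem?_comp
  Primrec.lookup_comp Primrec.idxOf_comp Primrec.map_comp Primrec.flatMap_comp
  Primrec.filterMap_comp Primrec.findIdx_comp Primrec.foldl_comp Primrec.iterate_comp
  Primrec.all_comp Primrec.any_comp Primrec.zip_comp Primrec.put_comp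

end PrimrecClosure

/-! A machine on codes.  Instead of substituting, it keeps environments; instead of globally unused
variables, it picks variables from a bounded pool. -/

namespace Machine

def eqb {α : Type} [DecidableEq α] (a b : α) : Bool := decide (a = b)

/-- A queued term `(m, [U₁, …, Uₙ])`, by the codes of the `Uᵢ`. -/
abbrev Msg := ℕ × List ℕ

/-- A closure `(P, c, σ, ρ)`: the code of a process, with the environment `ρ` for its dangling
indices and the environment `σ` for its free variables; a variable `x` outside of `σ` stands for
the variable `c + x`.  The offset `c` is zero for the processes of the start configuration. -/
abbrev Clo := ℕ × ℕ × List (ℕ × ℕ) × List ℕ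

/-- The closure, the fields and the queue of an actor. -/
abbrev Ent := Clo × List (ℕ × ℕ) × List Msg

/-- Configurations of the machine. -/
abbrev Cfg := List (ℕ × Ent)

/-- The tables of a program. -/
abbrev Fields := List (ℕ × List ℕ)
abbrev Defs := List (ℕ × ℕ × List ℕ × ℕ)

/-- The field table, the method definitions, and a bound: variables below it are rigid. -/
abbrev Prog := Fields × Defs × ℕ

def cloVar (k : Clo) (x : ℕ) : ℕ := (k.2.2.1.lookup x).getD (Nat.pair 0 (k.2.1 + x))

def valOf (k : Clo) (v : ℕ) : ℕ := bif eqb v.unpair.1 0 then cloVar k v.unpair.2 else v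

def refVal (k : Clo) (r : ℕ) : Option ℕ :=
  bif eqb r.unpair.1 0 then some (valOf k r.unpair.2) else k.2.2.2[r.unpair.2]?

/-- States of the evaluator: tasks, stack of argument lists, configuration. -/
abbrev EvalState := List (ℕ × ℕ) × List (List ℕ) × Cfg

def pushVal (v : ℕ) (s : List (List ℕ)) : List (List ℕ) := (s.head?.getD [] ++ [v]) :: s.tail

/-- A configuration with `n` entries cannot occupy `n + 1` names of one class, so the bounded search
succeeds. -/
def freshIdx (S : Cfg) (C : ℕ) : ℕ :=
  (List.range (S.length + 1)).findIdx fun i => !(S.lookup (Nat.pair C i + 1)).isSome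

def fieldsOf (F : Fields) (C : ℕ) : List ℕ := (F.lookup C).getD []

def emptyClo : Clo := (0, 0, [], [])

def build (F : Fields) (C : ℕ) (st : EvalState) : Option EvalState :=
  bif eqb (st.2.1.head?.getD []).length (fieldsOf F C).length then
    some (st.1, pushVal (Nat.pair 1 (Nat.pair C (freshIdx st.2.2 C) + 1)) st.2.1.tail,
      put st.2.2 (Nat.pair C (freshIdx st.2.2 C) + 1)
        (emptyClo, (fieldsOf F C).zip (st.2.1.head?.getD []), []))
  else none

/-- The test `k.2.1 = 0` lets only processes of the start configuration execute `new`; this builds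
boundedness of the actors into the machine. Starting a creation opens a new frame for its arguments
and leaves a task that closes it. -/
def evalExprStep (φ : List (ℕ × ℕ)) (k : Clo) (t : ℕ) (st : EvalState) : Option EvalState :=
  bif eqb t.unpair.1 0 then
    (φ.lookup t.unpair.2).map fun v => (st.1, pushVal v st.2.1, st.2.2)
  else bif eqb t.unpair.1 1 then
    (refVal k t.unpair.2).map fun v => (st.1, pushVal v st.2.1, st.2.2)
  else bif eqb k.2.1 0 then
    some ((1, t.unpair.2.unpair.2) :: (2, t.unpair.2.unpair.1) :: st.1, [] :: st.2.1, st.2.2)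
  else none

/-- Tags: `0` evaluates an expression, `1` a list of expressions, `2` creates an actor from the top
frame. Without tasks the evaluator idles, so surplus steps do no harm. -/
def evalStep (F : Fields) (φ : List (ℕ × ℕ)) (k : Clo) (st : EvalState) : Option EvalState :=
  bif eqb st.1.length 0 then some st
  else st.1.head?.bind fun task =>
    bif eqb task.1 2 then bif eqb k.2.1 0 then build F task.2 (st.1.tail, st.2) else none
    else bif eqb task.1 1 then
      bif eqb task.2 0 then some (st.1.tail, st.2)
      else some ((0, (task.2 - 1).unpair.1) :: (1, (task.2 - 1).unpair.2) :: st.1.tail, st.2)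
    else
      bif eqb task.2 0 then none
      else evalExprStep φ k (task.2 - 1) (st.1.tail, st.2)

def evalSteps (F : Fields) (φ : List (ℕ × ℕ)) (k : Clo) (n : ℕ) (st : EvalState) :
    Option EvalState :=
  (fun o => o.bind (evalStep F φ k))^[n] (some st)

/-- Evaluation of an expression (`tag = 0`) or of a list of expressions (`tag = 1`). -/
def eval (F : Fields) (φ : List (ℕ × ℕ)) (k : Clo) (S : Cfg) (tag e : ℕ) :
    Option (List ℕ × Cfg) :=
  -- Enough fuel: an expression with code `e` takes at most `2 * e - 1` steps, a list at most `2 * e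
  -- + 1`.
  (evalSteps F φ k (2 * e + 1) ([(tag, e)], [[]], S)).bind fun st =>
    bif eqb st.1.length 0 then some (st.2.1.head?.getD [], st.2.2) else none

/-- The outcome of a step of a process: closure, configuration, emitted messages. -/
abbrev Outcome := Clo × Cfg × List (ℕ × Msg)

def letStep (F : Fields) (φ : List (ℕ × ℕ)) (k : Clo) (S : Cfg) (b : ℕ) : Option Outcome :=
  (eval F φ k S 0 b.unpair.1).map fun r =>
    ((b.unpair.2, k.2.1, k.2.2.1, r.1.head?.getD 0 :: k.2.2.2), r.2, [])

def callStep (F : Fields) (φ : List (ℕ × ℕ)) (k : Clo) (S : Cfg) (b : ℕ) : Option Outcome :=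
  (refVal k b.unpair.1).bind fun v =>
    bif eqb v.unpair.1 1 then
      (eval F φ k S 1 b.unpair.2.unpair.2.unpair.1).map fun r =>
        ((b.unpair.2.unpair.2.unpair.2, k.2), r.2,
          [(v.unpair.2, b.unpair.2.unpair.1, r.1)])
    else none

def condStep (F : Fields) (φ : List (ℕ × ℕ)) (k : Clo) (S : Cfg) (b : ℕ) : Option Outcome :=
  (eval F φ k S 1 (Nat.pair b.unpair.1 (Nat.pair b.unpair.2.unpair.1 0 + 1) + 1)).map fun r =>
    ((bif eqb r.1[0]? r.1[1]? then b.unpair.2.unpair.2.unpair.1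
      else b.unpair.2.unpair.2.unpair.2, k.2), r.2, [])

/-- Messages are returned, not delivered, and `S` is touched only by creations. The same function
can therefore drive the global steps and, with an empty configuration, the local runs of
certificates. -/
def core (F : Fields) (φ : List (ℕ × ℕ)) (S : Cfg) (k : Clo) (c : ℕ) : Option Outcome :=
  bif eqb k.1 0 then none
  else bif eqb (k.1 - 1).unpair.1 1 then letStep F φ k S (k.1 - 1).unpair.2
  else bif eqb (k.1 - 1).unpair.1 2 then callStep F φ k S (k.1 - 1).unpair.2
  else bif eqb (k.1 - 1).unpair.1 3 then condStep F φ k S (k.1 - 1).unpair.2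
  else bif eqb (k.1 - 1).unpair.1 4 then
    some ((bif eqb c 0 then (k.1 - 1).unpair.2.unpair.1
      else (k.1 - 1).unpair.2.unpair.2, k.2), S, [])
  else none

/-- Renumbering of the variables that are not rigid. -/
def canon (N : ℕ) (Us : List ℕ) : List ℕ :=
  -- The index of the first occurrence preserves equality between arguments, and it is bounded by
  -- the arity.
  Us.map fun u => bif eqb u.unpair.1 0 && decide (N ≤ u.unpair.2) then
    Nat.pair 0 (N + Us.idxOf u) else u

/-- The closure that the actor `A` starts for a message. -/
def start (p : Prog) (A : ℕ) (m : Msg) (c : ℕ) : Option Clo :=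
  p.2.1[c]?.bind fun d =>
    bif !eqb A 0 && (eqb d.1 (A - 1).unpair.1 && (eqb d.2.1 m.1 &&
        eqb d.2.2.1.length m.2.length)) then
      -- Disjoint ranges: rigid variables lie below `N`, renumbered arguments in the next
      -- `m.2.length` places, fresh variables above. The `+ 1` makes the offset nonzero even for `N
      -- = 0`, which marks the closure as started by a message.
      some (d.2.2.2, p.2.2 + m.2.length + 1,
        (0, Nat.pair 1 A) :: d.2.2.1.zip (canon (p.2.2) m.2), [])
    else none

def send (S : Cfg) (e : ℕ × Msg) : Cfg :=
  ((S.lookup e.1).map fun t => put S e.1 (t.1, t.2.1, t.2.2 ++ [e.2])).getD S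

def popStep (p : Prog) (S : Cfg) (A : ℕ) (t : Ent) (c : ℕ) : Option Cfg :=
  t.2.2.head?.bind fun m => (start p A m c).map fun k => put S A (k, t.2.1, t.2.2.tail)

def procStep (p : Prog) (S : Cfg) (A : ℕ) (t : Ent) (c : ℕ) : Option Cfg :=
  (core p.1 t.2.1 S t.1 c).bind fun r =>
    -- As in the transition relation, the receiver must exist before the arguments are evaluated.
    bif r.2.2.all fun e => (S.lookup e.1).isSome then
      some (r.2.2.foldl send (put r.2.1 A (r.1, t.2)))
    else none

/-- One step of the actor `A`; the number `c` resolves the nondeterminism. -/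
def step (p : Prog) (S : Cfg) (A c : ℕ) : Option Cfg :=
  (S.lookup A).bind fun t =>
    bif eqb t.1.1 0 then popStep p S A t c else procStep p S A t c

def succs (p : Prog) (S : Cfg) : List Cfg :=
  S.flatMap fun t => (List.range (p.2.1.length + 2)).filterMap (step p S t.1)

def level (p : Prog) (S : Cfg) (n : ℕ) : List Cfg :=
  (fun l : List Cfg => l.flatMap (succs p))^[n] [S]

/-- Steps of a single actor, given the list of the names of the other actors. -/
def localStep (F : Fields) (dom : List ℕ) (φ : List (ℕ × ℕ)) (k : Clo) (c : ℕ) :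
    Option (Clo × List (ℕ × Msg)) :=
  (core F φ [] k c).bind fun r =>
    bif r.2.2.all fun e => dom.any fun a => eqb a e.1 then some (r.1, r.2.2) else none

def localRun (F : Fields) (dom : List ℕ) (φ : List (ℕ × ℕ)) (k : Clo) (cs : List ℕ) :
    Option (Clo × List (ℕ × Msg)) :=
  cs.foldl (fun o c => o.bind fun s =>
    (localStep F dom φ s.1 c).map fun r => (r.1, s.2 ++ r.2)) (some (k, []))

/-- The messages which a process emits until it terminates. -/
def complete (F : Fields) (dom : List ℕ) (φ : List (ℕ × ℕ)) (k : Clo) (cs : List ℕ) :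
    Option (List (ℕ × Msg)) :=
  bif eqb k.1 0 then some []
  -- A process of the start configuration might create actors, which a local run cannot track; a
  -- certificate may use such a process only once it has ended.
  else bif eqb k.2.1 0 then none
  else (localRun F dom φ k cs).bind fun r => bif eqb r.1.1 0 then some r.2 else none

def run (p : Prog) (S : Cfg) (cs : List (ℕ × ℕ)) : Option Cfg :=
  cs.foldl (fun o c => o.bind fun T => step p T c.1 c.2) (some S)

/-! Certificates for infinite computations. -/

/-- A letter `(A, m)` together with the choices that describe how `A` executes `m`. -/
abbrev Handling := (ℕ × Msg) × ℕ × List ℕ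

/-- Persistent actors with choices that terminate their processes; handlings of harmless messages;
handlings of perpetual messages. -/
abbrev Cert := List (ℕ × List ℕ) × List Handling × List Handling

def isKey {α : Type} (l : List (ℕ × α)) (a : ℕ) : Bool := l.any fun e => eqb e.1 a

def isLetter (l : List Handling) (m : ℕ × Msg) : Bool := l.any fun e => eqb e.1 m

/-- Messages to other actors are unrestricted, since the computation built from the certificate
never moves those actors. -/
def harmless (C : Cert) (ms : List (ℕ × Msg)) : Bool :=
  ms.all fun e => !isKey C.1 e.1 || isLetter C.2.1 e

def handle (p : Prog) (S : Cfg) (h : Handling) : Option (List (ℕ × Msg)) :=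
  (S.lookup h.1.1).bind fun t => (start p h.1.1 h.1.2 h.2.1).bind fun k =>
    complete p.1 (S.map fun e => e.1) t.2.1 k h.2.2

def checkActor (p : Prog) (S : Cfg) (C : Cert) (a : ℕ × List ℕ) : Bool :=
  ((S.lookup a.1).bind fun t =>
    (complete p.1 (S.map fun e => e.1) t.2.1 t.1 a.2).map fun ms =>
      harmless C ms && t.2.2.all fun m => isLetter C.2.1 (a.1, m)).getD false

def checkHarmless (p : Prog) (S : Cfg) (C : Cert) (h : Handling) : Bool :=
  ((handle p S h).map fun ms => harmless C ms).getD false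

def checkPerpetual (p : Prog) (S : Cfg) (C : Cert) (h : Handling) : Bool :=
  isKey C.1 h.1.1 && ((handle p S h).map fun ms =>
    harmless C ms && ms.any fun e => isLetter C.2.2 e).getD false

def checkStart (S : Cfg) (C : Cert) : Bool :=
  C.2.2.any fun h => ((S.lookup h.1.1).map fun t => t.2.2.any fun m => eqb m h.1.2).getD false

def check (p : Prog) (S : Cfg) (C : Cert) : Bool :=
  C.1.all (checkActor p S C) && (C.2.1.all (checkHarmless p S C) &&
    (C.2.2.all (checkPerpetual p S C) && checkStart S C))

/-- A certificate becomes valid only after the start processes have come to rest, hence the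
preliminary run. -/
def checkRun (p : Prog) (S : Cfg) (w : List (ℕ × ℕ) × Cert) : Bool :=
  ((run p S w.1).map fun T => check p T w.2).getD false

-- The machine and the certificate checker are primitive recursive.

section Primrec

set_option maxHeartbeats 1000000

variable {α : Type} [Primcodable α]

@[fun_prop]
theorem eqb_primrec {β : Type} [Primcodable β] [DecidableEq β] {f g : α → β} (hf : Primrec f)
    (hg : Primrec g) : Primrec fun a => eqb (f a) (g a) := Primrec.decide_eq_comp hf hg

@[fun_prop]
theorem valOf_primrec {f : α → Clo} {g : α → ℕ} (hf : Primrec f) (hg : Primrec g) :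
    Primrec fun a => valOf (f a) (g a) := by
  have : Primrec fun q : Clo × ℕ => valOf q.1 q.2 := by unfold valOf cloVar; fun_prop
  exact (this.comp (hf.pair hg) :)

@[fun_prop]
theorem refVal_primrec {f : α → Clo} {g : α → ℕ} (hf : Primrec f) (hg : Primrec g) :
    Primrec fun a => refVal (f a) (g a) := by
  have : Primrec fun q : Clo × ℕ => refVal q.1 q.2 := by unfold refVal; fun_prop
  exact (this.comp (hf.pair hg) :)

@[fun_prop]
theorem pushVal_primrec {f : α → ℕ} {g : α → List (List ℕ)} (hf : Primrec f) (hg : Primrec g) :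
    Primrec fun a => pushVal (f a) (g a) := by
  have : Primrec fun q : ℕ × List (List ℕ) => pushVal q.1 q.2 := by unfold pushVal; fun_prop
  exact (this.comp (hf.pair hg) :)

@[fun_prop]
theorem freshIdx_primrec {f : α → Cfg} {g : α → ℕ} (hf : Primrec f) (hg : Primrec g) :
    Primrec fun a => freshIdx (f a) (g a) := by
  have : Primrec fun q : Cfg × ℕ => freshIdx q.1 q.2 := by unfold freshIdx; fun_prop
  exact (this.comp (hf.pair hg) :)

@[fun_prop]
theorem build_primrec {f : α → Fields} {g : α → ℕ} {h : α → EvalState} (hf : Primrec f)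
    (hg : Primrec g) (hh : Primrec h) : Primrec fun a => build (f a) (g a) (h a) := by
  have : Primrec fun q : Fields × ℕ × EvalState => build q.1 q.2.1 q.2.2 := by
    unfold build fieldsOf; fun_prop
  exact (this.comp (hf.pair (hg.pair hh)) :)

@[fun_prop]
theorem evalExprStep_primrec {f : α → List (ℕ × ℕ)} {g : α → Clo} {h : α → ℕ}
    {i : α → EvalState} (hf : Primrec f) (hg : Primrec g) (hh : Primrec h) (hi : Primrec i) :
    Primrec fun a => evalExprStep (f a) (g a) (h a) (i a) := by
  have : Primrec fun q : List (ℕ × ℕ) × Clo × ℕ × EvalState =>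
      evalExprStep q.1 q.2.1 q.2.2.1 q.2.2.2 := by
    unfold evalExprStep; fun_prop
  exact (this.comp (hf.pair (hg.pair (hh.pair hi))) :)

@[fun_prop]
theorem evalStep_primrec {f : α → Fields} {g : α → List (ℕ × ℕ)} {h : α → Clo}
    {i : α → EvalState} (hf : Primrec f) (hg : Primrec g) (hh : Primrec h) (hi : Primrec i) :
    Primrec fun a => evalStep (f a) (g a) (h a) (i a) := by
  have : Primrec fun q : Fields × List (ℕ × ℕ) × Clo × EvalState =>
      evalStep q.1 q.2.1 q.2.2.1 q.2.2.2 := by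
    unfold evalStep; fun_prop
  exact (this.comp (hf.pair (hg.pair (hh.pair hi))) :)

@[fun_prop]
theorem eval_primrec {f : α → Fields} {g : α → List (ℕ × ℕ)} {h : α → Clo} {i : α → Cfg}
    {j l : α → ℕ} (hf : Primrec f) (hg : Primrec g) (hh : Primrec h) (hi : Primrec i)
    (hj : Primrec j) (hl : Primrec l) :
    Primrec fun a => eval (f a) (g a) (h a) (i a) (j a) (l a) := by
  have : Primrec fun q : Fields × List (ℕ × ℕ) × Clo × Cfg × ℕ × ℕ =>
      eval q.1 q.2.1 q.2.2.1 q.2.2.2.1 q.2.2.2.2.1 q.2.2.2.2.2 := by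
    unfold eval evalSteps; fun_prop
  exact (this.comp (hf.pair (hg.pair (hh.pair (hi.pair (hj.pair hl))))) :)

@[fun_prop]
theorem core_primrec {f : α → Fields} {g : α → List (ℕ × ℕ)} {h : α → Cfg} {i : α → Clo}
    {j : α → ℕ} (hf : Primrec f) (hg : Primrec g) (hh : Primrec h) (hi : Primrec i)
    (hj : Primrec j) : Primrec fun a => core (f a) (g a) (h a) (i a) (j a) := by
  have h1 : Primrec fun q : Fields × List (ℕ × ℕ) × Clo × Cfg × ℕ =>
      letStep q.1 q.2.1 q.2.2.1 q.2.2.2.1 q.2.2.2.2 := by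
    unfold letStep; fun_prop
  have h2 : Primrec fun q : Fields × List (ℕ × ℕ) × Clo × Cfg × ℕ =>
      callStep q.1 q.2.1 q.2.2.1 q.2.2.2.1 q.2.2.2.2 := by
    unfold callStep; fun_prop
  have h3 : Primrec fun q : Fields × List (ℕ × ℕ) × Clo × Cfg × ℕ =>
      condStep q.1 q.2.1 q.2.2.1 q.2.2.2.1 q.2.2.2.2 := by
    unfold condStep; fun_prop
  have e : Primrec fun q : Fields × List (ℕ × ℕ) × Cfg × Clo × ℕ =>
      (q.1, q.2.1, q.2.2.2.1, q.2.2.1, (q.2.2.2.1.1 - 1).unpair.2) := by fun_prop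
  have h1' := h1.comp e
  have h2' := h2.comp e
  have h3' := h3.comp e
  have : Primrec fun q : Fields × List (ℕ × ℕ) × Cfg × Clo × ℕ =>
      core q.1 q.2.1 q.2.2.1 q.2.2.2.1 q.2.2.2.2 := by
    unfold core
    refine Primrec.cond_comp (by fun_prop) (by fun_prop) (Primrec.cond_comp (by fun_prop) h1'
      (Primrec.cond_comp (by fun_prop) h2' (Primrec.cond_comp (by fun_prop) h3' (by fun_prop))))
  exact (this.comp (hf.pair (hg.pair (hh.pair (hi.pair hj)))) :)

@[fun_prop]
theorem canon_primrec {f : α → ℕ} {g : α → List ℕ} (hf : Primrec f) (hg : Primrec g) :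
    Primrec fun a => canon (f a) (g a) := by
  have : Primrec fun q : ℕ × List ℕ => canon q.1 q.2 := by unfold canon; fun_prop
  exact (this.comp (hf.pair hg) :)

@[fun_prop]
theorem start_primrec {f : α → Prog} {g : α → ℕ} {h : α → Msg} {i : α → ℕ} (hf : Primrec f)
    (hg : Primrec g) (hh : Primrec h) (hi : Primrec i) :
    Primrec fun a => start (f a) (g a) (h a) (i a) := by
  have : Primrec fun q : Prog × ℕ × Msg × ℕ => start q.1 q.2.1 q.2.2.1 q.2.2.2 := by
    unfold start; fun_prop
  exact (this.comp (hf.pair (hg.pair (hh.pair hi))) :)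

@[fun_prop]
theorem send_primrec {f : α → Cfg} {g : α → ℕ × Msg} (hf : Primrec f) (hg : Primrec g) :
    Primrec fun a => send (f a) (g a) := by
  have : Primrec fun q : Cfg × (ℕ × Msg) => send q.1 q.2 := by unfold send; fun_prop
  exact (this.comp (hf.pair hg) :)

@[fun_prop]
theorem step_primrec {f : α → Prog} {g : α → Cfg} {h i : α → ℕ} (hf : Primrec f)
    (hg : Primrec g) (hh : Primrec h) (hi : Primrec i) :
    Primrec fun a => step (f a) (g a) (h a) (i a) := by
  have : Primrec fun q : Prog × Cfg × ℕ × ℕ => step q.1 q.2.1 q.2.2.1 q.2.2.2 := by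
    unfold step popStep procStep; fun_prop
  exact (this.comp (hf.pair (hg.pair (hh.pair hi))) :)

@[fun_prop]
theorem succs_primrec {f : α → Prog} {g : α → Cfg} (hf : Primrec f) (hg : Primrec g) :
    Primrec fun a => succs (f a) (g a) := by
  have : Primrec fun q : Prog × Cfg => succs q.1 q.2 := by unfold succs; fun_prop
  exact (this.comp (hf.pair hg) :)

@[fun_prop]
theorem level_primrec {f : α → Prog} {g : α → Cfg} {h : α → ℕ} (hf : Primrec f)
    (hg : Primrec g) (hh : Primrec h) : Primrec fun a => level (f a) (g a) (h a) := by
  have : Primrec fun q : Prog × Cfg × ℕ => level q.1 q.2.1 q.2.2 := by unfold level; fun_prop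
  exact (this.comp (hf.pair (hg.pair hh)) :)

@[fun_prop]
theorem localStep_primrec {f : α → Fields} {g : α → List ℕ} {h : α → List (ℕ × ℕ)} {i : α → Clo}
    {j : α → ℕ} (hf : Primrec f) (hg : Primrec g) (hh : Primrec h) (hi : Primrec i)
    (hj : Primrec j) : Primrec fun a => localStep (f a) (g a) (h a) (i a) (j a) := by
  have : Primrec fun q : Fields × List ℕ × List (ℕ × ℕ) × Clo × ℕ =>
      localStep q.1 q.2.1 q.2.2.1 q.2.2.2.1 q.2.2.2.2 := by
    unfold localStep; fun_prop
  exact (this.comp (hf.pair (hg.pair (hh.pair (hi.pair hj)))) :)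

@[fun_prop]
theorem localRun_primrec {f : α → Fields} {g : α → List ℕ} {h : α → List (ℕ × ℕ)} {i : α → Clo}
    {j : α → List ℕ} (hf : Primrec f) (hg : Primrec g) (hh : Primrec h) (hi : Primrec i)
    (hj : Primrec j) : Primrec fun a => localRun (f a) (g a) (h a) (i a) (j a) := by
  have : Primrec fun q : Fields × List ℕ × List (ℕ × ℕ) × Clo × List ℕ =>
      localRun q.1 q.2.1 q.2.2.1 q.2.2.2.1 q.2.2.2.2 := by
    unfold localRun; fun_prop
  exact (this.comp (hf.pair (hg.pair (hh.pair (hi.pair hj)))) :)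

@[fun_prop]
theorem complete_primrec {f : α → Fields} {g : α → List ℕ} {h : α → List (ℕ × ℕ)} {i : α → Clo}
    {j : α → List ℕ} (hf : Primrec f) (hg : Primrec g) (hh : Primrec h) (hi : Primrec i)
    (hj : Primrec j) : Primrec fun a => complete (f a) (g a) (h a) (i a) (j a) := by
  have : Primrec fun q : Fields × List ℕ × List (ℕ × ℕ) × Clo × List ℕ =>
      complete q.1 q.2.1 q.2.2.1 q.2.2.2.1 q.2.2.2.2 := by
    unfold complete; fun_prop
  exact (this.comp (hf.pair (hg.pair (hh.pair (hi.pair hj)))) :)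

@[fun_prop]
theorem isKey_primrec {β : Type} [Primcodable β] {f : α → List (ℕ × β)} {g : α → ℕ}
    (hf : Primrec f) (hg : Primrec g) : Primrec fun a => isKey (f a) (g a) := by
  have : Primrec fun q : List (ℕ × β) × ℕ => isKey q.1 q.2 := by unfold isKey; fun_prop
  exact (this.comp (hf.pair hg) :)

@[fun_prop]
theorem isLetter_primrec {f : α → List Handling} {g : α → ℕ × Msg}
    (hf : Primrec f) (hg : Primrec g) : Primrec fun a => isLetter (f a) (g a) := by
  have : Primrec fun q : List Handling × (ℕ × Msg) => isLetter q.1 q.2 := by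
    unfold isLetter; fun_prop
  exact (this.comp (hf.pair hg) :)

@[fun_prop]
theorem harmless_primrec {f : α → Cert} {g : α → List (ℕ × Msg)} (hf : Primrec f)
    (hg : Primrec g) : Primrec fun a => harmless (f a) (g a) := by
  have : Primrec fun q : Cert × List (ℕ × Msg) => harmless q.1 q.2 := by
    unfold harmless; fun_prop
  exact (this.comp (hf.pair hg) :)

@[fun_prop]
theorem handle_primrec {f : α → Prog} {g : α → Cfg} {h : α → Handling} (hf : Primrec f)
    (hg : Primrec g) (hh : Primrec h) : Primrec fun a => handle (f a) (g a) (h a) := by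
  have : Primrec fun q : Prog × Cfg × Handling => handle q.1 q.2.1 q.2.2 := by
    unfold handle; fun_prop
  exact (this.comp (hf.pair (hg.pair hh)) :)

theorem checkRun_primrec : Primrec fun q : Prog × Cfg × List (ℕ × ℕ) × Cert =>
    checkRun q.1 q.2.1 q.2.2 := by
  have h1 : Primrec fun q : (Prog × Cfg × Cert) × ℕ × List ℕ =>
      checkActor q.1.1 q.1.2.1 q.1.2.2 q.2 := by
    unfold checkActor; fun_prop
  have h2 : Primrec fun q : (Prog × Cfg × Cert) × Handling =>
      checkHarmless q.1.1 q.1.2.1 q.1.2.2 q.2 := by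
    unfold checkHarmless; fun_prop
  have h3 : Primrec fun q : (Prog × Cfg × Cert) × Handling =>
      checkPerpetual q.1.1 q.1.2.1 q.1.2.2 q.2 := by
    unfold checkPerpetual; fun_prop
  have h4 : Primrec fun q : Prog × Cfg × Cert => checkStart q.2.1 q.2.2 := by
    unfold checkStart; fun_prop
  have h5 : Primrec fun q : Prog × Cfg × Cert => check q.1 q.2.1 q.2.2 := by
    unfold check
    exact Primrec.and_comp (Primrec.all_comp (by fun_prop) h1)
      (Primrec.and_comp (Primrec.all_comp (by fun_prop) h2)
        (Primrec.and_comp (Primrec.all_comp (by fun_prop) h3) h4))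
  have h6 : Primrec fun q : (Prog × Cfg × List (ℕ × ℕ) × Cert) × Cfg =>
      check q.1.1 q.2 q.1.2.2.2 := (h5.comp
        (by fun_prop : Primrec fun q : (Prog × Cfg × List (ℕ × ℕ) × Cert) × Cfg =>
          (q.1.1, q.2, q.1.2.2.2)) :)
  unfold checkRun run
  exact Primrec.getD_comp (Primrec.optionMap_comp (by fun_prop) h6) (by fun_prop)

end Primrec
end Machine

/-! Association lists. -/

theorem lookup_put {α β : Type} [DecidableEq α] (l : List (α × β)) (a c : α) (b : β) :
    (put l a b).lookup c = if c = a then some b else l.lookup c := by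
  induction l with
  | nil =>
    by_cases h : c = a
    · simp [put, h]
    · have h' : (c == a) = false := by simpa using h
      simp [put, List.lookup, h, h']
  | cons e l ih =>
    obtain ⟨x, y⟩ := e
    by_cases hx : x = a
    · subst hx
      by_cases h : c = x
      · simp [put, h]
      · have h' : (c == x) = false := by simpa using h
        simp [put, List.lookup, h, h']
    · by_cases h : c = x
      · subst h
        simp [put, hx, List.lookup]
      · have h' : (c == x) = false := by simpa using h
        simp [put, hx, List.lookup, h', ih]

theorem isSome_lookup_iff {α β : Type} [DecidableEq α] (l : List (α × β)) (a : α) :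
    (l.lookup a).isSome ↔ a ∈ l.map fun e => e.1 := by
  induction l with
  | nil => simp
  | cons e l ih =>
    obtain ⟨x, y⟩ := e
    by_cases h : a = x
    · simp [List.lookup, h]
    · have h' : (a == x) = false := by simpa using h
      simp [List.lookup, h', ih, h]

theorem keys_put {α β : Type} [DecidableEq α] (l : List (α × β)) (a : α) (b : β)
    (h : (l.lookup a).isSome) : ((put l a b).map fun e => e.1) = l.map fun e => e.1 := by
  induction l with
  | nil => simp at h
  | cons e l ih =>
    obtain ⟨x, y⟩ := e
    by_cases hx : x = a
    · simp [put, hx]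
    · have h' : (a == x) = false := by simpa using fun h : a = x => hx h.symm
      simp only [List.lookup, h'] at h
      simp [put, hx, ih h]

namespace Machine

theorem eqb_iff {α : Type} [DecidableEq α] (a b : α) : eqb a b = true ↔ a = b := by
  simp [eqb]

theorem cond_eqb {α σ : Type} [DecidableEq α] (a b : α) (x y : σ) :
    (bif eqb a b then x else y) = if a = b then x else y := by
  by_cases h : a = b <;> simp [eqb, h]

/-! Fresh names. -/

/-- Pigeonhole: if all candidates were in use, `S.length + 1` distinct names would embed into the
keys of `S`. -/
theorem freshIdx_spec (S : Cfg) (C : ℕ) :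
    S.lookup (Nat.pair C (freshIdx S C) + 1) = none ∧
      ∀ i < freshIdx S C, S.lookup (Nat.pair C i + 1) ≠ none := by
  have hlt : freshIdx S C < (List.range (S.length + 1)).length := by
    unfold freshIdx
    rw [List.findIdx_lt_length]
    by_contra! hcon
    have hsub : (List.range (S.length + 1)).map (fun i => Nat.pair C i + 1) ⊆
        S.map fun e => e.1 := by
      intro a ha
      obtain ⟨i, hi, rfl⟩ := List.mem_map.1 ha
      rw [← isSome_lookup_iff]
      simpa using hcon i hi
    have hnd : ((List.range (S.length + 1)).map (fun i => Nat.pair C i + 1)).Nodup :=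
      List.nodup_range.map fun i j h => by simpa using h
    have := (hnd.subperm hsub).length_le
    simp at this
  constructor
  · have := List.findIdx_getElem (xs := List.range (S.length + 1))
      (p := fun i => !(S.lookup (Nat.pair C i + 1)).isSome) (w := hlt)
    simpa [freshIdx] using this
  · intro i hi
    have := List.not_of_lt_findIdx (xs := List.range (S.length + 1))
      (p := fun i => !(S.lookup (Nat.pair C i + 1)).isSome) hi
    simp only [List.getElem_range] at this
    intro h0
    simp [h0] at this

/-! Sending. -/

theorem lookup_send (S : Cfg) (e : ℕ × Msg) (a : ℕ) :
    (send S e).lookup a = if a = e.1 then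
      (S.lookup a).map fun t => (t.1, t.2.1, t.2.2 ++ [e.2]) else S.lookup a := by
  unfold send
  by_cases h : a = e.1
  · subst h
    cases h' : S.lookup e.1 <;> simp [h', lookup_put]
  · cases h' : S.lookup e.1 <;> simp [lookup_put, h]

theorem lookup_sendAll (ms : List (ℕ × Msg)) (S : Cfg) (a : ℕ) :
    (ms.foldl send S).lookup a = (S.lookup a).map fun t =>
      (t.1, t.2.1, t.2.2 ++ (ms.filter fun e => e.1 = a).map fun e => e.2) := by
  induction ms generalizing S with
  | nil => cases h : S.lookup a <;> simp [h]
  | cons e ms ih =>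
    rw [List.foldl_cons, ih, lookup_send]
    by_cases h : a = e.1
    · subst h
      cases S.lookup e.1 <;> simp
    · have h' : ¬ e.1 = a := fun h' => h h'.symm
      simp [h, h']

theorem keys_send (S : Cfg) (e : ℕ × Msg) :
    ((send S e).map fun e => e.1) = S.map fun e => e.1 := by
  unfold send
  cases h : S.lookup e.1 with
  | none => simp
  | some t => simp [keys_put, h]

theorem keys_sendAll (ms : List (ℕ × Msg)) (S : Cfg) :
    ((ms.foldl send S).map fun e => e.1) = S.map fun e => e.1 := by
  induction ms generalizing S with
  | nil => rfl
  | cons e ms ih => rw [List.foldl_cons, ih, keys_send]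

/-! The weight of the processes of the start configuration. -/

def weight (k : Clo) : ℕ := if k.2.1 = 0 then k.1 else 0

def measure (S : Cfg) : ℕ := (S.map fun e => weight e.2.1).sum

/-- An additive form, which avoids truncated subtraction of the weight of the overwritten entry. -/
theorem measure_put (S : Cfg) (a : ℕ) (t : Ent) :
    measure (put S a t) + ((S.lookup a).map fun u => weight u.1).getD 0 =
      measure S + weight t.1 := by
  unfold measure
  induction S with
  | nil => simp [put]
  | cons e S ih =>
    obtain ⟨x, y⟩ := e
    by_cases hx : x = a
    · subst hx
      simp [put, List.lookup]
      omega
    · have h' : (a == x) = false := by simpa using fun h : a = x => hx h.symm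
      simp only [put, hx, if_false, List.map_cons, List.sum_cons, List.lookup, h']
      omega

theorem measure_send (S : Cfg) (e : ℕ × Msg) : measure (send S e) = measure S := by
  unfold send
  cases h : S.lookup e.1 with
  | none => simp
  | some t =>
    have := measure_put S e.1 (t.1, t.2.1, t.2.2 ++ [e.2])
    simp only [h, Option.map_some, Option.getD_some] at this ⊢
    omega

theorem measure_sendAll (ms : List (ℕ × Msg)) (S : Cfg) :
    measure (ms.foldl send S) = measure S := by
  induction ms generalizing S with
  | nil => rfl
  | cons e ms ih => rw [List.foldl_cons, ih, measure_send]

/-! Evaluation extends the configuration. -/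

/-- Created actors get fresh names and start with the terminated process, so evaluation overwrites
nothing and adds no weight. -/
structure Extends (S S' : Cfg) : Prop where
  lookup : ∀ a t, S.lookup a = some t → S'.lookup a = some t
  measure_le : measure S' ≤ measure S

theorem Extends.refl (S : Cfg) : Extends S S := ⟨fun _ _ h => h, le_rfl⟩

theorem Extends.trans {S T U : Cfg} (h : Extends S T) (h' : Extends T U) : Extends S U :=
  ⟨fun a t ha => h'.lookup a t (h.lookup a t ha), h'.measure_le.trans h.measure_le⟩

theorem build_extends {F : Fields} {C : ℕ} {st st' : EvalState} (h : build F C st = some st') :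
    Extends st.2.2 st'.2.2 := by
  unfold build at h
  rw [cond_eqb] at h
  split at h
  · cases h
    have hf := (freshIdx_spec st.2.2 C).1
    constructor
    · intro a t ha
      dsimp only
      rw [lookup_put, if_neg]
      · exact ha
      · rintro rfl
        simp [hf] at ha
    · have := measure_put st.2.2 (Nat.pair C (freshIdx st.2.2 C) + 1)
        (emptyClo, (fieldsOf F C).zip (st.2.1.head?.getD []), [])
      simp only [hf, Option.map_none, Option.getD_none, weight, emptyClo, if_true] at this ⊢
      omega
  · cases h

theorem evalStep_extends {F : Fields} {φ : List (ℕ × ℕ)} {k : Clo} {st st' : EvalState}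
    (h : evalStep F φ k st = some st') : Extends st.2.2 st'.2.2 := by
  obtain ⟨todo, fr, S⟩ := st
  unfold evalStep at h
  simp only [cond_eqb] at h
  split at h
  · cases h; exact Extends.refl _
  cases todo with
  | nil => simp at h
  | cons task todo =>
    simp only [List.head?_cons, Option.bind_some, List.tail_cons] at h
    split_ifs at h
    · exact (build_extends h :)
    · cases h; exact Extends.refl _
    · cases h; exact Extends.refl _
    · unfold evalExprStep at h
      simp only [cond_eqb] at h
      split_ifs at h
      · obtain ⟨v, _, rfl⟩ := Option.map_eq_some_iff.1 h
        exact Extends.refl _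
      · obtain ⟨v, _, rfl⟩ := Option.map_eq_some_iff.1 h
        exact Extends.refl _
      · cases h; exact Extends.refl _

theorem evalSteps_succ (F : Fields) (φ : List (ℕ × ℕ)) (k : Clo) (n : ℕ) (st : EvalState) :
    evalSteps F φ k (n + 1) st = (evalStep F φ k st).bind (evalSteps F φ k n) := by
  have hn : ∀ n, (fun o : Option EvalState => o.bind (evalStep F φ k))^[n] none = none := by
    intro n
    induction n with
    | zero => rfl
    | succ n ih => rw [Function.iterate_succ_apply]; exact ih
  unfold evalSteps
  rw [Function.iterate_succ_apply]
  cases h : evalStep F φ k st <;> simp [h, hn]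

theorem evalSteps_extends {F : Fields} {φ : List (ℕ × ℕ)} {k : Clo} (n : ℕ)
    {st st' : EvalState} (h : evalSteps F φ k n st = some st') : Extends st.2.2 st'.2.2 := by
  induction n generalizing st with
  | zero => cases h; exact Extends.refl _
  | succ n ih =>
    rw [evalSteps_succ] at h
    obtain ⟨st1, h1, h2⟩ := Option.bind_eq_some_iff.1 h
    exact (evalStep_extends h1).trans (ih h2)

theorem eval_extends {F : Fields} {φ : List (ℕ × ℕ)} {k : Clo} {S : Cfg} {tag e : ℕ}
    {r : List ℕ × Cfg} (h : eval F φ k S tag e = some r) : Extends S r.2 := by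
  unfold eval at h
  obtain ⟨st, h1, h2⟩ := Option.bind_eq_some_iff.1 h
  rw [cond_eqb] at h2
  split at h2
  · cases h2
    exact evalSteps_extends _ h1
  · cases h2

/-! Processes that were started by a message evaluate without creating actors. -/

def EvalState.setCfg (S : Cfg) (st : EvalState) : EvalState := (st.1, st.2.1, S)

/-- The configuration is used only by creations, and a nonzero offset makes these fail. -/
theorem evalStep_pure {F : Fields} {φ : List (ℕ × ℕ)} {k : Clo} (hk : k.2.1 ≠ 0)
    (st : EvalState) (S : Cfg) :
    evalStep F φ k (st.setCfg S) = (evalStep F φ k st).map (EvalState.setCfg S) := by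
  obtain ⟨todo, fr, T⟩ := st
  cases todo with
  | nil => simp [evalStep, cond_eqb, EvalState.setCfg]
  | cons task todo =>
    simp only [evalStep, cond_eqb, EvalState.setCfg, evalExprStep, List.head?_cons,
      Option.bind_some, List.tail_cons, hk, if_false]
    split_ifs <;> simp_all [EvalState.setCfg, Function.comp_def]

theorem evalSteps_pure {F : Fields} {φ : List (ℕ × ℕ)} {k : Clo} (hk : k.2.1 ≠ 0) (n : ℕ)
    (st : EvalState) (S : Cfg) :
    evalSteps F φ k n (st.setCfg S) = (evalSteps F φ k n st).map (EvalState.setCfg S) := by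
  induction n generalizing st with
  | zero => rfl
  | succ n ih =>
    rw [evalSteps_succ, evalSteps_succ, evalStep_pure hk]
    cases evalStep F φ k st <;> simp [ih]

theorem eval_pure {F : Fields} {φ : List (ℕ × ℕ)} {k : Clo} (hk : k.2.1 ≠ 0) (S : Cfg)
    (tag e : ℕ) :
    eval F φ k S tag e = (eval F φ k [] tag e).map fun r => (r.1, S) := by
  unfold eval
  have := evalSteps_pure (F := F) (φ := φ) hk (2 * e + 1) ([(tag, e)], [[]], []) S
  simp only [EvalState.setCfg] at this
  rw [this]
  cases evalSteps F φ k (2 * e + 1) ([(tag, e)], [[]], []) with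
  | none => rfl
  | some st =>
    simp only [Option.map_some, Option.bind_some, EvalState.setCfg, cond_eqb]
    split_ifs <;> simp

/-- This justifies running message-started processes on the empty configuration in `localStep`. -/
theorem core_pure {F : Fields} {φ : List (ℕ × ℕ)} {k : Clo} (hk : k.2.1 ≠ 0) (S : Cfg) (c : ℕ) :
    core F φ S k c = (core F φ [] k c).map fun r => (r.1, S, r.2.2) := by
  unfold core letStep callStep condStep
  simp only [cond_eqb, eval_pure hk S]
  split_ifs
  · rfl
  · simp [Function.comp_def]
  · cases refVal k (k.1 - 1).unpair.2.unpair.1 with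
    | none => rfl
    | some v => by_cases hv : v.unpair.1 = 1 <;> simp [hv, Function.comp_def]
  all_goals simp [Function.comp_def]

/-- A continuation is a proper component of the code, and unpairing does not increase numbers. The
strict decrease bounds every single process execution and makes the weight of start processes drop.
-/
theorem core_spec {F : Fields} {φ : List (ℕ × ℕ)} {S : Cfg} {k : Clo} {c : ℕ} {r : Outcome}
    (h : core F φ S k c = some r) :
    r.1.1 < k.1 ∧ r.1.2.1 = k.2.1 ∧ r.1.2.2.1 = k.2.2.1 ∧ Extends S r.2.1 := by
  unfold core at h
  simp only [cond_eqb] at h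
  have h2 : ∀ n : ℕ, n.unpair.2 ≤ n := Nat.unpair_right_le
  have h1 : ∀ n : ℕ, n.unpair.1 ≤ n := Nat.unpair_left_le
  split_ifs at h with h0
  · obtain ⟨q, hq, rfl⟩ := Option.map_eq_some_iff.1 h
    refine ⟨?_, rfl, rfl, eval_extends hq⟩
    have := h2 (k.1 - 1)
    have := h2 (k.1 - 1).unpair.2
    dsimp only
    omega
  · obtain ⟨v, _, h⟩ := Option.bind_eq_some_iff.1 h
    rw [cond_eqb] at h
    split_ifs at h
    obtain ⟨q, hq, rfl⟩ := Option.map_eq_some_iff.1 h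
    refine ⟨?_, rfl, rfl, eval_extends hq⟩
    have := h2 (k.1 - 1)
    have := h2 (k.1 - 1).unpair.2
    have := h2 (k.1 - 1).unpair.2.unpair.2
    have := h2 (k.1 - 1).unpair.2.unpair.2.unpair.2
    dsimp only
    omega
  · obtain ⟨q, hq, rfl⟩ := Option.map_eq_some_iff.1 h
    refine ⟨?_, rfl, rfl, eval_extends hq⟩
    have := h2 (k.1 - 1)
    have := h2 (k.1 - 1).unpair.2
    have := h2 (k.1 - 1).unpair.2.unpair.2
    have := h2 (k.1 - 1).unpair.2.unpair.2.unpair.2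
    have := h1 (k.1 - 1).unpair.2.unpair.2.unpair.2
    dsimp only
    rw [cond_eqb]
    split_ifs <;> omega
  all_goals
    cases h
    refine ⟨?_, rfl, rfl, Extends.refl _⟩
    have := h2 (k.1 - 1)
    have := h2 (k.1 - 1).unpair.2
    have := h1 (k.1 - 1).unpair.2
    dsimp only
    omega

end Machine

/-! Infinite sequences. -/

def Diverges {α : Type} (R : α → α → Prop) (x : α) : Prop :=
  ∃ s : ℕ → α, s 0 = x ∧ ∀ n, R (s n) (s (n + 1))

theorem Diverges.of_invariant {α : Type} {R : α → α → Prop} (I : α → Prop)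
    (hI : ∀ x, I x → ∃ y, R x y ∧ I y) {x : α} (hx : I x) : Diverges R x := by
  choose f hf using fun x : {x // I x} => hI x.1 x.2
  let g : {x // I x} → {x // I x} := fun x => ⟨f x, (hf x).2⟩
  refine ⟨fun n => (g^[n] ⟨x, hx⟩).1, rfl, fun n => ?_⟩
  dsimp only
  rw [Function.iterate_succ_apply']
  exact (hf _).1

theorem Diverges.exists_step {α : Type} {R : α → α → Prop} {x : α} (h : Diverges R x) :
    ∃ y, R x y ∧ Diverges R y := by
  obtain ⟨s, rfl, hs⟩ := h
  exact ⟨s 1, hs 0, fun n => s (n + 1), rfl, fun n => hs (n + 1)⟩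

/-- Being on the way to a state that satisfies `I` is an invariant under single steps. -/
theorem Diverges.of_transGen {α : Type} {R : α → α → Prop} (I : α → Prop)
    (hI : ∀ x, I x → ∃ y, Relation.TransGen R x y ∧ I y) {x : α} (hx : I x) : Diverges R x := by
  refine Diverges.of_invariant (fun x => ∃ y, Relation.ReflTransGen R x y ∧ I y) ?_
    ⟨x, .refl, hx⟩
  rintro x ⟨y, hxy, hy⟩
  obtain ⟨z, hyz, hz⟩ := hI y hy
  obtain ⟨w, hw, hwz⟩ := Relation.TransGen.head'_iff.1 (Relation.TransGen.trans_right hxy hyz)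
  exact ⟨w, hw, z, hwz, hz⟩

theorem Diverges.simulation {α β : Type} {R : α → α → Prop} {Q : β → β → Prop}
    (rel : α → β → Prop) (h : ∀ a b a', rel a b → R a a' → ∃ b', Q b b' ∧ rel a' b')
    {a : α} {b : β} (hab : rel a b) (ha : Diverges R a) : Diverges Q b := by
  refine Diverges.of_invariant (fun b => ∃ a, rel a b ∧ Diverges R a) ?_ ⟨a, hab, ha⟩
  rintro b ⟨a, hab, ha⟩
  obtain ⟨a', haa', ha'⟩ := ha.exists_step
  obtain ⟨b', hbb', hab'⟩ := h a b a' hab haa'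
  exact ⟨b', hbb', a', hab', ha'⟩

theorem Diverges.of_reach {α : Type} {R : α → α → Prop} {x y : α}
    (h : Relation.ReflTransGen R x y) (hy : Diverges R y) : Diverges R x := by
  induction h using Relation.ReflTransGen.head_induction_on with
  | refl => exact hy
  | head hab _ ih =>
    refine Diverges.of_invariant (fun z => z = _ ∨ Diverges R z) ?_ (Or.inl rfl)
    rintro z (rfl | hz)
    · exact ⟨_, hab, Or.inr ih⟩
    · obtain ⟨w, h1, h2⟩ := hz.exists_step
      exact ⟨w, h1, Or.inr h2⟩

-- The machine's transition relation: finite branching, König's lemma, pure steps.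

namespace Machine

theorem step_pop {p : Prog} {S : Cfg} {A c : ℕ} {k k' : Clo} {φ : List (ℕ × ℕ)} {m : Msg}
    {q : List Msg} (h : S.lookup A = some (k, φ, m :: q)) (hk : k.1 = 0)
    (hs : start p A m c = some k') : step p S A c = some (put S A (k', φ, q)) := by
  simp [step, h, cond_eqb, hk, popStep, hs]

theorem step_proc {p : Prog} {S : Cfg} {A c : ℕ} {k : Clo} {φ : List (ℕ × ℕ)} {r : Outcome}
    {q : List Msg} (h : S.lookup A = some (k, φ, q)) (hk : k.1 ≠ 0)
    (hc : core p.1 φ S k c = some r) (hr : ∀ e ∈ r.2.2, (S.lookup e.1).isSome) :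
    step p S A c = some (r.2.2.foldl send (put r.2.1 A (r.1, φ, q))) := by
  have : (r.2.2.all fun e => (S.lookup e.1).isSome) = true := by simpa using hr
  simp only [step, h, Option.bind_some, cond_eqb, hk, if_false, procStep, hc, this, cond_true]

theorem step_cases {p : Prog} {S S' : Cfg} {A c : ℕ} (h : step p S A c = some S') :
    ∃ k φ q, S.lookup A = some (k, φ, q) ∧
      ((k.1 = 0 ∧ ∃ m q' k', q = m :: q' ∧ start p A m c = some k' ∧
          S' = put S A (k', φ, q')) ∨
        (k.1 ≠ 0 ∧ ∃ r, core p.1 φ S k c = some r ∧ (∀ e ∈ r.2.2, (S.lookup e.1).isSome) ∧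
          S' = r.2.2.foldl send (put r.2.1 A (r.1, φ, q)))) := by
  unfold step at h
  obtain ⟨⟨k, φ, q⟩, ht, h⟩ := Option.bind_eq_some_iff.1 h
  refine ⟨k, φ, q, ht, ?_⟩
  rw [cond_eqb] at h
  split_ifs at h with hk
  · left
    unfold popStep at h
    obtain ⟨m, hm, h⟩ := Option.bind_eq_some_iff.1 h
    obtain ⟨k', hk', rfl⟩ := Option.map_eq_some_iff.1 h
    cases q with
    | nil => simp at hm
    | cons m' q =>
      simp only [List.head?_cons, Option.some.injEq] at hm
      subst hm
      exact ⟨hk, _, _, _, rfl, hk', rfl⟩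
  · right
    unfold procStep at h
    obtain ⟨r, hr, h⟩ := Option.bind_eq_some_iff.1 h
    refine ⟨hk, r, hr, ?_⟩
    rw [Bool.cond_eq_ite] at h
    split_ifs at h with hc
    cases h
    exact ⟨by simpa using hc, rfl⟩

/-- The transition relation of the machine. -/
def Move (p : Prog) (S S' : Cfg) : Prop := ∃ A c, step p S A c = some S'

theorem core_choice (F : Fields) (φ : List (ℕ × ℕ)) (S : Cfg) (k : Clo) (c : ℕ) :
    core F φ S k (min c 1) = core F φ S k c := by
  have : (min c 1 = 0) = (c = 0) := by
    apply propext; omega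
  simp only [core, cond_eqb, this]

theorem mem_succs {p : Prog} {S S' : Cfg} : S' ∈ succs p S ↔ Move p S S' := by
  unfold succs Move
  simp only [List.mem_flatMap, List.mem_filterMap, List.mem_range]
  constructor
  · rintro ⟨t, _, c, _, h⟩
    exact ⟨_, c, h⟩
  · rintro ⟨A, c, h⟩
    obtain ⟨k, φ, q, ht, H⟩ := step_cases h
    have hA : A ∈ S.map fun e => e.1 := by
      rw [← isSome_lookup_iff, ht]; rfl
    obtain ⟨t, htS, rfl⟩ := List.mem_map.1 hA
    refine ⟨t, htS, ?_⟩
    rcases H with ⟨hk, m, q', k', rfl, hs, rfl⟩ | ⟨hk, r, hc, hr, rfl⟩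
    · refine ⟨c, ?_, h⟩
      obtain ⟨d, hd, _⟩ := Option.bind_eq_some_iff.1 hs
      have := (List.getElem?_eq_some_iff.1 hd).1
      omega
    -- A process distinguishes only zero and nonzero choices, so finitely many values of `c` cover
    -- all steps.
    · exact ⟨min c 1, by omega, step_proc ht hk ((core_choice ..).trans hc) hr⟩

theorem level_succ (p : Prog) (S : Cfg) (n : ℕ) :
    level p S (n + 1) = (succs p S).flatMap fun T => level p T n := by
  have H : ∀ n (l : List Cfg), (fun l : List Cfg => l.flatMap (succs p))^[n] l =
      l.flatMap fun T => level p T n := by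
    intro n
    induction n with
    | zero => intro l; simp [level]
    | succ n ih =>
      intro l
      rw [Function.iterate_succ_apply, ih]
      simp only [level, Function.iterate_succ_apply, List.flatMap_assoc, List.flatMap_singleton]
      congr 1
      funext T
      exact (ih _).symm
  rw [level, Function.iterate_succ_apply, H]
  simp

theorem level_mono {p : Prog} {S : Cfg} {n : ℕ} (h : level p S n = []) {k : ℕ} (hk : n ≤ k) :
    level p S k = [] := by
  obtain ⟨j, rfl⟩ := Nat.exists_eq_add_of_le' hk
  unfold level at h ⊢
  rw [Function.iterate_add_apply, h]
  clear h hk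
  induction j with
  | zero => rfl
  | succ j ih => rw [Function.iterate_succ_apply]; exact ih

/-- König's lemma for the machine. -/
theorem not_diverges_iff (p : Prog) (S : Cfg) :
    ¬ Diverges (Move p) S ↔ ∃ n, level p S n = [] := by
  constructor
  · intro h
    by_contra! hcon
    refine h (Diverges.of_invariant (fun T => ∀ n, level p T n ≠ []) ?_ hcon)
    intro T hT
    by_contra! hno
    have h1 : ∀ U ∈ succs p T, ∃ n, level p U n = [] := by
      intro U hU
      simpa using hno U (mem_succs.1 hU)
    choose! f hf using h1
    -- There are finitely many successors, so the sum of their bounds bounds each of them.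
    refine hT (((succs p T).map f).sum + 1) ?_
    rw [level_succ, List.flatMap_eq_nil_iff]
    intro U hU
    exact level_mono (hf U hU) (List.single_le_sum (by simp) _ (List.mem_map_of_mem hU))
  · rintro ⟨n, hn⟩ hd
    induction n generalizing S with
    | zero => simp [level] at hn
    | succ n ih =>
      obtain ⟨T, hT, hd⟩ := hd.exists_step
      rw [level_succ, List.flatMap_eq_nil_iff] at hn
      exact ih T (hn T (mem_succs.2 hT)) hd

theorem run_reach {p : Prog} {S T : Cfg} {cs : List (ℕ × ℕ)} (h : run p S cs = some T) :
    Relation.ReflTransGen (Move p) S T := by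
  induction cs using List.reverseRecOn generalizing T with
  | nil => cases h; exact .refl
  | append_singleton cs c ih =>
    unfold run at h ih
    rw [List.foldl_append] at h
    obtain ⟨U, hU, h⟩ := Option.bind_eq_some_iff.1 h
    exact (ih hU).tail ⟨_, _, h⟩

theorem exists_run {p : Prog} {S T : Cfg} (h : Relation.ReflTransGen (Move p) S T) :
    ∃ cs, run p S cs = some T := by
  induction h with
  | refl => exact ⟨[], rfl⟩
  | tail _ hm ih =>
    obtain ⟨cs, hcs⟩ := ih
    obtain ⟨A, c, hm⟩ := hm
    refine ⟨cs ++ [(A, c)], ?_⟩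
    unfold run at hcs ⊢
    rw [List.foldl_append, hcs]
    exact hm

/-! Steps of processes that were started by messages. -/

/-- The actor `A` either takes the message `l` from its queue, or performs a step of its process,
which emits `ms`. -/
inductive PureStep (p : Prog) (S : Cfg) (A : ℕ) : Option Msg → List (ℕ × Msg) → Cfg → Prop
  | pop {k k' : Clo} {φ : List (ℕ × ℕ)} {m : Msg} {q : List Msg} {c : ℕ} :
      S.lookup A = some (k, φ, m :: q) → k.1 = 0 → start p A m c = some k' →
      PureStep p S A (some m) [] (put S A (k', φ, q))
  | act {k k' : Clo} {φ : List (ℕ × ℕ)} {q : List Msg} {c : ℕ} {ms : List (ℕ × Msg)} :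
      S.lookup A = some (k, φ, q) → k.1 ≠ 0 → k.2.1 ≠ 0 →
      localStep p.1 (S.map fun e => e.1) φ k c = some (k', ms) →
      PureStep p S A none ms (ms.foldl send (put S A (k', φ, q)))

theorem localStep_eq_some {F : Fields} {dom : List ℕ} {φ : List (ℕ × ℕ)} {k : Clo} {c : ℕ}
    {s : Clo × List (ℕ × Msg)} : localStep F dom φ k c = some s ↔
      ∃ r, core F φ [] k c = some r ∧ (∀ e ∈ r.2.2, e.1 ∈ dom) ∧ s = (r.1, r.2.2) := by
  unfold localStep
  rw [Option.bind_eq_some_iff]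
  refine exists_congr fun r => and_congr_right fun _ => ?_
  rw [Bool.cond_eq_ite]
  have : ((r.2.2.all fun e => dom.any fun a => eqb a e.1) = true) ↔ ∀ e ∈ r.2.2, e.1 ∈ dom := by
    simp [eqb]
  split_ifs with h <;> rw [this] at h
  · exact ⟨fun e => ⟨h, (Option.some.inj e).symm⟩, fun e => by rw [e.2]⟩
  · exact ⟨nofun, fun e => (h e.1).elim⟩

theorem PureStep.move {p : Prog} {S S' : Cfg} {A : ℕ} {l : Option Msg} {ms : List (ℕ × Msg)}
    (h : PureStep p S A l ms S') : Move p S S' := by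
  cases h with
  | pop h hk hs => exact ⟨A, _, step_pop h hk hs⟩
  | @act _ k' φ q c _ h hk hk' hl =>
    obtain ⟨r, hr, hd, hs⟩ := localStep_eq_some.1 hl
    cases hs
    refine ⟨A, c, ?_⟩
    have := step_proc (p := p) (c := c) (r := (r.1, S, r.2.2)) h hk
      (by rw [core_pure hk', hr]; rfl) (fun e he => (isSome_lookup_iff _ _).2 (hd e he))
    exact this

theorem PureStep.pop_inv {p : Prog} {S S' : Cfg} {A : ℕ} {m : Msg} {ms : List (ℕ × Msg)}
    (h : PureStep p S A (some m) ms S') : ms = [] ∧ ∃ k k' φ q c,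
      S.lookup A = some (k, φ, m :: q) ∧ k.1 = 0 ∧ start p A m c = some k' ∧
        S' = put S A (k', φ, q) := by
  cases h with
  | pop h hk hs => exact ⟨rfl, _, _, _, _, _, h, hk, hs, rfl⟩

theorem PureStep.act_inv {p : Prog} {S S' : Cfg} {A : ℕ} {ms : List (ℕ × Msg)}
    (h : PureStep p S A none ms S') : ∃ k k' φ q c,
      S.lookup A = some (k, φ, q) ∧ k.1 ≠ 0 ∧ k.2.1 ≠ 0 ∧
        localStep p.1 (S.map fun e => e.1) φ k c = some (k', ms) ∧
          S' = ms.foldl send (put S A (k', φ, q)) := by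
  cases h with
  | act h hk hk' hl => exact ⟨_, _, _, _, _, h, hk, hk', hl, rfl⟩

theorem PureStep.exists_lookup {p : Prog} {S S' : Cfg} {A : ℕ} {l : Option Msg}
    {ms : List (ℕ × Msg)} (h : PureStep p S A l ms S') : ∃ t, S.lookup A = some t := by
  cases h with
  | pop h _ _ => exact ⟨_, h⟩
  | act h _ _ _ => exact ⟨_, h⟩

/-- A step lets a process of the start configuration proceed, or is pure. -/
theorem measure_lt_or_pureStep {p : Prog} {S S' : Cfg} (h : Move p S S') :
    measure S' < measure S ∨ measure S' = measure S ∧ ∃ A l ms, PureStep p S A l ms S' := by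
  obtain ⟨A, c, h⟩ := h
  obtain ⟨k, φ, q, ht, ⟨hk, m, q', k', rfl, hs, rfl⟩ | ⟨hk, r, hc, hr, rfl⟩⟩ := step_cases h
  · right
    refine ⟨?_, A, _, _, .pop ht hk hs⟩
    have h1 := measure_put S A (k', φ, q')
    -- The new closure has a nonzero offset, and the replaced one had code zero: neither carries
    -- weight.
    have h2 : weight k' = 0 := by
      unfold start at hs
      obtain ⟨d, _, hs⟩ := Option.bind_eq_some_iff.1 hs
      rw [Bool.cond_eq_ite] at hs
      split_ifs at hs
      cases hs
      simp [weight]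
    have h3 : weight k = 0 := by simp [weight, hk]
    simp only [ht, Option.map_some, Option.getD_some] at h1
    omega
  · obtain ⟨h1, h2, _, h3⟩ := core_spec hc
    rw [measure_sendAll]
    by_cases hk' : k.2.1 = 0
    · left
      have h4 := measure_put r.2.1 A (r.1, φ, q)
      have h5 := h3.measure_le
      simp only [h3.lookup _ _ ht, Option.map_some, Option.getD_some, weight, h2, hk',
        if_true] at h4
      omega
    · right
      rw [core_pure hk'] at hc
      obtain ⟨r', hr', rfl⟩ := Option.map_eq_some_iff.1 hc
      constructor
      · have h4 := measure_put S A (r'.1, φ, q)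
        simp only at h2
        simp only [ht, Option.map_some, Option.getD_some, weight, h2, hk', if_false] at h4
        simpa using h4
      · refine ⟨A, none, r'.2.2, .act ht hk hk' (c := c) ?_⟩
        exact localStep_eq_some.2 ⟨r', hr', fun e he => (isSome_lookup_iff _ _).1 (hr e he), rfl⟩

/-! A certificate yields an infinite computation. -/

def msgsTo (a : ℕ) (ms : List (ℕ × Msg)) : List Msg := (ms.filter fun e => e.1 = a).map fun e => e.2

theorem mem_msgsTo {a : ℕ} {ms : List (ℕ × Msg)} {m : Msg} : m ∈ msgsTo a ms ↔ (a, m) ∈ ms := by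
  simp [msgsTo]

theorem msgsTo_append (a : ℕ) (ms ms' : List (ℕ × Msg)) :
    msgsTo a (ms ++ ms') = msgsTo a ms ++ msgsTo a ms' := by
  simp [msgsTo]

def keys (S : Cfg) : List ℕ := S.map fun e => e.1

theorem localRun_snoc (F : Fields) (dom : List ℕ) (φ : List (ℕ × ℕ)) (k : Clo) (cs : List ℕ)
    (c : ℕ) : localRun F dom φ k (cs ++ [c]) = (localRun F dom φ k cs).bind fun s =>
      (localStep F dom φ s.1 c).map fun r => (r.1, s.2 ++ r.2) := by
  simp [localRun, List.foldl_append]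

theorem complete_eq_some {F : Fields} {dom : List ℕ} {φ : List (ℕ × ℕ)} {k : Clo} {cs : List ℕ}
    {ms : List (ℕ × Msg)} : complete F dom φ k cs = some ms ↔
      (k.1 = 0 ∧ ms = []) ∨ (k.1 ≠ 0 ∧ k.2.1 ≠ 0 ∧
        ∃ k', localRun F dom φ k cs = some (k', ms) ∧ k'.1 = 0) := by
  unfold complete
  simp only [cond_eqb]
  split_ifs with h1 h2
  · simp [h1, eq_comm]
  · simp [h1, h2]
  · simp [h1, h2, Option.bind_eq_some_iff]

/-- `T'` differs from `T` in that `A` has the process `k`, and the messages `ms` have been sent. -/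
def Effect (T T' : Cfg) (A : ℕ) (k : Clo) (ms : List (ℕ × Msg)) : Prop :=
  keys T' = keys T ∧ ∀ a, T'.lookup a = (T.lookup a).map fun t =>
    (if a = A then k else t.1, t.2.1, t.2.2 ++ msgsTo a ms)

/-- A local run can be replayed inside any configuration with the same names: a process never reads
queues, and its own fields do not change. The only trace left elsewhere is the messages appended to
queues. -/
theorem exists_of_localRun {p : Prog} {T : Cfg} {A : ℕ} {k k' : Clo} {φ : List (ℕ × ℕ)}
    {q : List Msg} {cs : List ℕ} {ms : List (ℕ × Msg)} (hT : T.lookup A = some (k, φ, q))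
    (hk : k.2.1 ≠ 0) (h : localRun p.1 (keys T) φ k cs = some (k', ms)) :
    k'.2.1 ≠ 0 ∧ ∃ T', Relation.ReflTransGen (Move p) T T' ∧ Effect T T' A k' ms := by
  induction cs using List.reverseRecOn generalizing k' ms with
  | nil =>
    cases h
    refine ⟨hk, T, .refl, rfl, fun a => ?_⟩
    by_cases ha : a = A
    · subst ha; simp [hT, msgsTo]
    · simp [ha, msgsTo]
  | append_singleton cs c ih =>
    rw [localRun_snoc] at h
    obtain ⟨⟨k1, ms1⟩, h1, h⟩ := Option.bind_eq_some_iff.1 h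
    obtain ⟨⟨k2, ms2⟩, h2, h3⟩ := Option.map_eq_some_iff.1 h
    cases h3
    obtain ⟨hk1, T1, hr, hd, he⟩ := ih h1
    have hT1 : T1.lookup A = some (k1, φ, q ++ msgsTo A ms1) := by rw [he, hT]; simp
    obtain ⟨r, hr', _, hs⟩ := localStep_eq_some.1 h2
    obtain ⟨hlt, hc, _, _⟩ := core_spec hr'
    have hpos : k1.1 ≠ 0 := by simp only at hlt; omega
    rw [← hd] at h2
    have hstep := PureStep.act (p := p) hT1 hpos hk1 h2
    cases hs
    refine ⟨by simpa [hc] using hk1, _, hr.tail hstep.move, ?_, fun a => ?_⟩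
    · unfold keys at hd ⊢
      rw [keys_sendAll, keys_put _ _ _ (by rw [hT1]; rfl), hd]
    · rw [lookup_sendAll, lookup_put, msgsTo_append]
      by_cases ha : a = A
      · subst ha; simp [hT, msgsTo]
      · rw [if_neg ha, he]
        cases T.lookup a <;> simp [ha, msgsTo]

theorem exists_of_complete {p : Prog} {T : Cfg} {A : ℕ} {k : Clo} {φ : List (ℕ × ℕ)}
    {q : List Msg} {cs : List ℕ} {ms : List (ℕ × Msg)} (hT : T.lookup A = some (k, φ, q))
    (h : complete p.1 (keys T) φ k cs = some ms) :
    ∃ k' T', k'.1 = 0 ∧ Relation.ReflTransGen (Move p) T T' ∧ Effect T T' A k' ms := by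
  rcases complete_eq_some.1 h with ⟨hk, rfl⟩ | ⟨_, hk, k', hr, hk'⟩
  · refine ⟨k, T, hk, .refl, rfl, fun a => ?_⟩
    by_cases ha : a = A
    · subst ha; simp [hT, msgsTo]
    · simp [ha, msgsTo]
  · obtain ⟨_, T', h1, h2⟩ := exists_of_localRun hT hk hr
    exact ⟨k', T', hk', h1, h2⟩

def letters (l : List Handling) : List (ℕ × Msg) := l.map fun h => h.1

def Harmless (C : Cert) (ms : List (ℕ × Msg)) : Prop :=
  ∀ e ∈ ms, e.1 ∈ C.1.map (fun a => a.1) → e ∈ letters C.2.1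

theorem isKey_iff {α : Type} (l : List (ℕ × α)) (a : ℕ) :
    isKey l a = true ↔ a ∈ l.map fun e => e.1 := by
  simp [isKey, eqb]

theorem isLetter_iff (l : List Handling) (m : ℕ × Msg) :
    isLetter l m = true ↔ m ∈ letters l := by
  obtain ⟨a, b⟩ := m
  simp [isLetter, eqb, letters, Prod.ext_iff]

theorem harmless_iff (C : Cert) (ms : List (ℕ × Msg)) :
    harmless C ms = true ↔ Harmless C ms := by
  unfold harmless Harmless
  rw [List.all_eq_true]
  refine forall₂_congr fun e _ => ?_
  rw [Bool.or_eq_true, Bool.not_eq_true', ← Bool.not_eq_true, isKey_iff, isLetter_iff]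
  tauto

theorem getD_false_iff {α : Type} (o : Option α) (f : α → Bool) :
    (o.map f).getD false = true ↔ ∃ x, o = some x ∧ f x = true := by
  cases o <;> simp

theorem check_iff (p : Prog) (S : Cfg) (C : Cert) : check p S C = true ↔
    (∀ a ∈ C.1, ∃ t ms, S.lookup a.1 = some t ∧
      complete p.1 (keys S) t.2.1 t.1 a.2 = some ms ∧ Harmless C ms ∧
        ∀ m ∈ t.2.2, (a.1, m) ∈ letters C.2.1) ∧
    (∀ h ∈ C.2.1, ∃ ms, handle p S h = some ms ∧ Harmless C ms) ∧
    (∀ h ∈ C.2.2, h.1.1 ∈ C.1.map (fun a => a.1) ∧ ∃ ms, handle p S h = some ms ∧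
      Harmless C ms ∧ ∃ e ∈ ms, e ∈ letters C.2.2) ∧
    ∃ h ∈ C.2.2, ∃ t, S.lookup h.1.1 = some t ∧ h.1.2 ∈ t.2.2 := by
  unfold check
  simp only [Bool.and_eq_true, List.all_eq_true]
  refine and_congr ?_ (and_congr ?_ (and_congr ?_ ?_))
  · refine forall₂_congr fun a _ => ?_
    unfold checkActor
    cases hS : S.lookup a.1 with
    | none => simp
    | some t =>
      simp only [Option.bind_some, getD_false_iff, Bool.and_eq_true, harmless_iff,
        List.all_eq_true, isLetter_iff, Option.some.injEq, keys, exists_and_left,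
        exists_eq_left']
  · refine forall₂_congr fun h _ => ?_
    unfold checkHarmless
    simp only [getD_false_iff, harmless_iff]
  · refine forall₂_congr fun h _ => ?_
    unfold checkPerpetual
    simp only [getD_false_iff, harmless_iff, Bool.and_eq_true, isKey_iff, List.any_eq_true,
      isLetter_iff]
  · unfold checkStart
    simp only [List.any_eq_true, getD_false_iff, eqb_iff, exists_eq_right]

theorem handle_eq_some {p : Prog} {S : Cfg} {h : Handling} {ms : List (ℕ × Msg)} :
    handle p S h = some ms ↔ ∃ t k, S.lookup h.1.1 = some t ∧
      start p h.1.1 h.1.2 h.2.1 = some k ∧ complete p.1 (keys S) t.2.1 k h.2.2 = some ms := by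
  simp [handle, Option.bind_eq_some_iff, keys]

/-- One round serves an actor that owns a waiting perpetual letter: its process is completed, the
front of its queue is taken, and that letter is executed to the end. The round contains at least the
taking of a message, and it restores the invariant. -/
theorem diverges_of_check {p : Prog} {S : Cfg} {C : Cert} (hC : check p S C = true) :
    Diverges (Move p) S := by
  obtain ⟨h1, h2, h3, h4⟩ := (check_iff p S C).1 hC
  -- The invariant: names and fields are those of `S`, every persistent actor can complete its
  -- process harmlessly and queues only harmless letters, and some perpetual letter is queued.
  refine Diverges.of_transGen (fun T => keys T = keys S ∧
    (∀ a, (T.lookup a).map (fun t => t.2.1) = (S.lookup a).map fun t => t.2.1) ∧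
    (∀ a ∈ C.1.map (fun a => a.1), ∃ t cs ms, T.lookup a = some t ∧
      complete p.1 (keys S) t.2.1 t.1 cs = some ms ∧ Harmless C ms ∧
        ∀ m ∈ t.2.2, (a, m) ∈ letters C.2.1) ∧
    ∃ h ∈ C.2.2, ∃ t, T.lookup h.1.1 = some t ∧ h.1.2 ∈ t.2.2) ?_
    ⟨rfl, fun _ => rfl, ?_, h4⟩
  swap
  · intro a ha
    obtain ⟨b, hb, rfl⟩ := List.mem_map.1 ha
    obtain ⟨t, ms, h⟩ := h1 b hb
    exact ⟨t, b.2, ms, h⟩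
  rintro T ⟨hkeys, hst, hact, h, hh, t, ht, hm⟩
  obtain ⟨⟨k, φ, q⟩, cs, ms, ht', hcomp, hharm, hq⟩ := hact _ (h3 h hh).1
  rw [ht] at ht'
  cases ht'
  rw [← hkeys] at hcomp
  obtain ⟨k1, T1, hk1, hr1, hd1, he1⟩ := exists_of_complete ht hcomp
  set A := h.1.1 with hA
  have hA1 : T1.lookup A = some (k1, φ, q ++ msgsTo A ms) := by rw [he1, ht]; simp
  have hAC : A ∈ C.1.map (fun a => a.1) := (h3 h hh).1
  have hq1 : ∀ m ∈ q ++ msgsTo A ms, (A, m) ∈ letters C.2.1 := by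
    intro m hm
    rcases List.mem_append.1 hm with hm | hm
    · exact hq m hm
    · exact hharm _ (mem_msgsTo.1 hm) hAC
  obtain ⟨m, q1, hmq⟩ : ∃ m q1, q ++ msgsTo A ms = m :: q1 := by
    cases hq' : q ++ msgsTo A ms with
    | nil => simp [List.append_eq_nil_iff.1 hq' |>.1] at hm
    | cons m q1 => exact ⟨m, q1, rfl⟩
  rw [hmq] at hA1 hq1
  -- If the front message is the perpetual one, its perpetual handling emits a successor. Otherwise
  -- the harmless handling is used and the perpetual letter stays behind in the queue.
  obtain ⟨g, hg, ms', hhandle, hharm', hperp⟩ : ∃ g : Handling, g.1 = (A, m) ∧ ∃ ms',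
      handle p S g = some ms' ∧ Harmless C ms' ∧
        (h.1.2 ∈ q1 ∨ ∃ e ∈ ms', e ∈ letters C.2.2) := by
    by_cases hmh : m = h.1.2
    · obtain ⟨ms', h5, h6, h7⟩ := (h3 h hh).2
      exact ⟨h, by rw [hmh], ms', h5, h6, Or.inr h7⟩
    · obtain ⟨g, hg, hgm⟩ := List.mem_map.1 (hq1 m (by simp))
      obtain ⟨ms', h5, h6⟩ := h2 g hg
      refine ⟨g, hgm, ms', h5, h6, Or.inl ?_⟩
      have : h.1.2 ∈ m :: q1 := by rw [← hmq]; exact List.mem_append_left _ hm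
      rcases List.mem_cons.1 this with h' | h'
      · exact (hmh h'.symm).elim
      · exact h'
  obtain ⟨tS, k2, htS, hstart, hcomp2⟩ := handle_eq_some.1 hhandle
  simp only [hg] at htS hstart
  have hφ : tS.2.1 = φ := by
    have := hst A
    rw [ht, htS] at this
    simpa using this.symm
  have hpop := PureStep.pop (p := p) hA1 hk1 hstart
  set T2 := put T1 A (k2, φ, q1) with hT2
  have hA2 : T2.lookup A = some (k2, φ, q1) := by rw [hT2, lookup_put, if_pos rfl]
  have hd2 : keys T2 = keys T1 := keys_put _ _ _ (by rw [hA1]; rfl)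
  rw [hφ, ← hkeys, ← hd1, ← hd2] at hcomp2
  obtain ⟨k3, T3, hk3, hr3, hd3, he3⟩ := exists_of_complete hA2 hcomp2
  have hlook : ∀ a, T3.lookup a = (T.lookup a).map fun t => (if a = A then k3 else t.1, t.2.1,
      (if a = A then q1 else t.2.2 ++ msgsTo a ms) ++ msgsTo a ms') := by
    intro a
    rw [he3, hT2, lookup_put]
    by_cases ha : a = A
    · subst ha; rw [ht]; simp
    · rw [if_neg ha, he1]
      cases T.lookup a <;> simp [ha]
  refine ⟨T3, ?_, by rw [hd3, hd2, hd1, hkeys], fun a => ?_, fun a ha => ?_, ?_⟩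
  · exact .trans_left (.tail' hr1 hpop.move) hr3
  · rw [hlook, ← hst]
    cases T.lookup a <;> simp
  · obtain ⟨t, cs', ms'', hta, hc, hh1, hh2⟩ := hact a ha
    by_cases haA : a = A
    -- The served actor has ended its process, so no choices are needed to complete it.
    · refine ⟨_, [], [], by rw [hlook, hta, Option.map_some], ?_, ?_, ?_⟩
      · rw [complete_eq_some]
        left
        simp [haA, hk3]
      · intro e he; simp at he
      · intro m hm
        simp only [haA, if_true, List.mem_append] at hm ⊢
        rcases hm with hm | hm
        · exact hq1 m (List.mem_cons_of_mem _ hm)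
        · exact hharm' _ (mem_msgsTo.1 hm) hAC
    · refine ⟨_, cs', ms'', by rw [hlook, hta, Option.map_some], ?_, hh1, ?_⟩
      · simpa [haA] using hc
      · intro m hm
        simp only [haA, if_false, List.mem_append] at hm
        rcases hm with (hm | hm) | hm
        · exact hh2 m hm
        · exact hharm _ (mem_msgsTo.1 hm) ha
        · exact hharm' _ (mem_msgsTo.1 hm) ha
  · rcases hperp with hp | ⟨e, he, hp⟩
    · refine ⟨h, hh, _, by rw [hlook, ht, Option.map_some], ?_⟩
      simp [← hA, hp]
    · obtain ⟨h', hh', rfl⟩ := List.mem_map.1 hp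
      obtain ⟨t, _, _, hta, _⟩ := hact _ (h3 h' hh').1
      refine ⟨h', hh', _, by rw [hlook, hta, Option.map_some], ?_⟩
      exact List.mem_append_right _ (mem_msgsTo.2 he)

/-! The messages of a computation without steps of start processes form a finite set. -/

theorem finite_bounded_lists (V n : ℕ) : {l : List ℕ | l.length ≤ n ∧ ∀ x ∈ l, x ≤ V}.Finite := by
  induction n with
  | zero =>
    refine (Set.finite_singleton []).subset ?_
    rintro l ⟨hl, _⟩
    simpa using hl
  | succ n ih =>
    refine ((Set.finite_singleton []).union ((Set.finite_Iic V).image2 List.cons ih)).subset ?_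
    rintro l ⟨hl, hx⟩
    cases l with
    | nil => simp
    | cons a l =>
      right
      exact ⟨a, hx a (by simp), l, ⟨by simpa using hl, fun x h => hx x (by simp [h])⟩, rfl⟩

/-- The length bound is the evaluator's fuel: a step adds at most one value, and the code of an
argument list is at most `V`. -/
def MsgBound (V : ℕ) (m : Msg) : Prop := m.1 ≤ V ∧ m.2.length ≤ 2 * V + 1 ∧ ∀ u ∈ m.2, u ≤ V

theorem finite_bounded_msgs (V : ℕ) : {x : ℕ × Msg | x.1 ≤ V ∧ MsgBound V x.2}.Finite := by
  refine ((Set.finite_Iic V).prod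
    ((Set.finite_Iic V).prod (finite_bounded_lists V (2 * V + 1)))).subset ?_
  rintro ⟨a, m, l⟩ ⟨h1, h2, h3, h4⟩
  exact ⟨h1, h2, h3, h4⟩

/-- The last clause bounds the variables outside of the environment: such an `x` stands for `k.2.1 +
x`, and `x` is at most the code in which it occurs. The clause survives the passage to continuations
because their codes are smaller. -/
def CloBound (V : ℕ) (k : Clo) : Prop :=
  k.1 ≤ V ∧ (∀ e ∈ k.2.2.1, e.2 ≤ V) ∧ (∀ v ∈ k.2.2.2, v ≤ V) ∧ Nat.pair 0 (k.2.1 + k.1) ≤ V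

def EntBound (V : ℕ) (a : ℕ) (t : Ent) : Prop :=
  a ≤ V ∧ Nat.pair 1 a ≤ V ∧ CloBound V t.1 ∧ (∀ e ∈ t.2.1, e.2 ≤ V) ∧ ∀ m ∈ t.2.2, MsgBound V m

def CfgBound (V : ℕ) (S : Cfg) : Prop := ∀ a t, S.lookup a = some t → EntBound V a t

def ProgBound (V : ℕ) (p : Prog) : Prop :=
  ∀ d ∈ p.2.1, d.2.2.2 ≤ V ∧ Nat.pair 0 (p.2.2 + d.2.2.1.length + 1 + d.2.2.2) ≤ V

theorem eventually_forall_mem {α : Type} (l : List α) {P : α → ℕ → Prop}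
    (h : ∀ a ∈ l, ∀ᶠ V in Filter.atTop, P a V) : ∀ᶠ V in Filter.atTop, ∀ a ∈ l, P a V :=
  (Filter.eventually_all_finite (List.finite_toSet l)).2 h

theorem mem_of_lookup {α β : Type} [DecidableEq α] {l : List (α × β)} {a : α} {b : β}
    (h : l.lookup a = some b) : (a, b) ∈ l := by
  obtain ⟨l₁, l₂, rfl, -⟩ := List.lookup_eq_some_iff.1 h
  simp

theorem eventually_bound (p : Prog) (S : Cfg) :
    ∀ᶠ V in Filter.atTop, ProgBound V p ∧ CfgBound V S := by
  have hge := fun n : ℕ => Filter.eventually_ge_atTop n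
  have h1 : ∀ᶠ V in Filter.atTop, ProgBound V p :=
    eventually_forall_mem p.2.1 fun d _ => (hge _).and (hge _)
  have h2 : ∀ᶠ V in Filter.atTop, ∀ e ∈ S, EntBound V e.1 e.2 := by
    refine eventually_forall_mem S fun e _ => ?_
    refine (hge _).and ((hge _).and (Filter.Eventually.and ?_ (Filter.Eventually.and ?_ ?_)))
    · exact (hge _).and ((eventually_forall_mem _ fun _ _ => hge _).and
        ((eventually_forall_mem _ fun _ _ => hge _).and (hge _)))
    · exact eventually_forall_mem _ fun _ _ => hge _
    · refine eventually_forall_mem _ fun m _ => (hge _).and (Filter.Eventually.and ?_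
        (eventually_forall_mem _ fun _ _ => hge _))
      filter_upwards [hge m.2.length] with V hV
      omega
  filter_upwards [h1, h2] with V h1 h2
  exact ⟨h1, fun a t h => h2 _ (mem_of_lookup h)⟩

theorem pair_mono_right {a b : ℕ} (h : a ≤ b) : Nat.pair 0 a ≤ Nat.pair 0 b := by
  rcases h.eq_or_lt with rfl | h
  · exact le_rfl
  · exact (Nat.pair_lt_pair_right 0 h).le

theorem refVal_le {V : ℕ} {k : Clo} (hk : CloBound V k) {r v : ℕ} (hr : r ≤ k.1)
    (h : refVal k r = some v) : v ≤ V := by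
  have h2 : ∀ n : ℕ, n.unpair.2 ≤ n := Nat.unpair_right_le
  unfold refVal at h
  rw [cond_eqb] at h
  split_ifs at h
  · cases h
    unfold valOf
    rw [cond_eqb]
    have := h2 r
    have h3 := h2 r.unpair.2
    split_ifs
    · unfold cloVar
      cases hl : k.2.2.1.lookup r.unpair.2.unpair.2 with
      | none =>
        refine le_trans (pair_mono_right ?_) hk.2.2.2
        omega
      | some w => exact hk.2.1 _ (mem_of_lookup hl)
    · exact this.trans (hr.trans hk.1)
  · exact hk.2.2.1 v (List.mem_of_getElem? h)

/-- Only the top frame needs control, since message-started processes open no further frames. -/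
def EvalBound (V P n : ℕ) (st : EvalState) : Prop :=
  (∀ t ∈ st.1, t.2 ≤ P) ∧ (∀ v ∈ st.2.1.head?.getD [], v ≤ V) ∧
    (st.2.1.head?.getD []).length ≤ n

theorem EvalBound.push {V P n v : ℕ} {todo todo' : List (ℕ × ℕ)} {fr : List (List ℕ)}
    {S S' : Cfg} (h : EvalBound V P n (todo, fr, S)) (ht : ∀ t ∈ todo', t ∈ todo) (hv : v ≤ V) :
    EvalBound V P (n + 1) (todo', pushVal v fr, S') := by
  refine ⟨fun t h' => h.1 t (ht t h'), ?_, ?_⟩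
  · intro w hw
    simp only [pushVal, List.head?_cons, Option.getD_some, List.mem_append, List.mem_singleton]
      at hw
    rcases hw with hw | rfl
    · exact h.2.1 w hw
    · exact hv
  · have := h.2.2
    simp only [pushVal, List.head?_cons, Option.getD_some, List.length_append,
      List.length_singleton]
    dsimp only at this
    omega

theorem evalStep_bound {F : Fields} {φ : List (ℕ × ℕ)} {k : Clo} {V n : ℕ} {st st' : EvalState}
    (hk : CloBound V k) (hc : k.2.1 ≠ 0) (hφ : ∀ e ∈ φ, e.2 ≤ V) (hst : EvalBound V k.1 n st)
    (h : evalStep F φ k st = some st') : EvalBound V k.1 (n + 1) st' := by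
  obtain ⟨todo, fr, S⟩ := st
  have h2 : ∀ n : ℕ, n.unpair.2 ≤ n := Nat.unpair_right_le
  have h1 : ∀ n : ℕ, n.unpair.1 ≤ n := Nat.unpair_left_le
  have hweak : ∀ {st : EvalState}, EvalBound V k.1 n st → EvalBound V k.1 (n + 1) st :=
    fun h => ⟨h.1, h.2.1, h.2.2.trans (Nat.le_succ n)⟩
  unfold evalStep at h
  simp only [cond_eqb] at h
  split at h
  · cases h; exact hweak hst
  cases todo with
  | nil => simp at h
  | cons task todo =>
    simp only [List.head?_cons, Option.bind_some, List.tail_cons] at h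
    have htask : task.2 ≤ k.1 := hst.1 task (by simp)
    split_ifs at h
    · cases h
      exact hweak ⟨fun t ht => hst.1 t (by simp [ht]), hst.2⟩
    · cases h
      refine hweak ⟨fun t ht => ?_, hst.2⟩
      have := h1 (task.2 - 1)
      have := h2 (task.2 - 1)
      simp only [List.mem_cons] at ht
      rcases ht with rfl | rfl | ht
      · dsimp only; omega
      · dsimp only; omega
      · exact hst.1 t (by simp [ht])
    · have h3 := h2 (task.2 - 1)
      unfold evalExprStep at h
      simp only [cond_eqb, hc, if_false] at h
      split_ifs at h
      · obtain ⟨v, hv, rfl⟩ := Option.map_eq_some_iff.1 h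
        exact hst.push (fun t ht => by simp [ht]) (hφ _ (mem_of_lookup hv))
      · obtain ⟨v, hv, rfl⟩ := Option.map_eq_some_iff.1 h
        exact hst.push (fun t ht => by simp [ht]) (refVal_le hk (by omega) hv)

theorem evalSteps_bound {F : Fields} {φ : List (ℕ × ℕ)} {k : Clo} {V : ℕ} (hk : CloBound V k)
    (hc : k.2.1 ≠ 0) (hφ : ∀ e ∈ φ, e.2 ≤ V) (j : ℕ) {n : ℕ} {st st' : EvalState}
    (hst : EvalBound V k.1 n st) (h : evalSteps F φ k j st = some st') :
    EvalBound V k.1 (n + j) st' := by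
  induction j generalizing n st with
  | zero => cases h; exact hst
  | succ j ih =>
    rw [evalSteps_succ] at h
    obtain ⟨st1, h1, h2⟩ := Option.bind_eq_some_iff.1 h
    have := ih (evalStep_bound hk hc hφ hst h1) h2
    rwa [Nat.add_assoc, Nat.add_comm 1] at this

theorem eval_bound {F : Fields} {φ : List (ℕ × ℕ)} {k : Clo} {V : ℕ} (hk : CloBound V k)
    (hc : k.2.1 ≠ 0) (hφ : ∀ e ∈ φ, e.2 ≤ V) {S : Cfg} {tag e : ℕ} (he : e ≤ k.1)
    {r : List ℕ × Cfg} (h : eval F φ k S tag e = some r) :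
    (∀ v ∈ r.1, v ≤ V) ∧ r.1.length ≤ 2 * e + 1 := by
  unfold eval at h
  obtain ⟨st, h1, h2⟩ := Option.bind_eq_some_iff.1 h
  rw [cond_eqb] at h2
  split_ifs at h2
  cases h2
  have := evalSteps_bound hk hc hφ _ (n := 0) ⟨by simpa using he, by simp, by simp⟩ h1
  exact ⟨this.2.1, by simpa using this.2.2⟩

theorem CloBound.mono {V P : ℕ} {k : Clo} (hk : CloBound V k) (h : P ≤ k.1) :
    CloBound V (P, k.2) :=
  ⟨h.trans hk.1, hk.2.1, hk.2.2.1, (pair_mono_right (by simpa using h)).trans hk.2.2.2⟩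

theorem core_bound {F : Fields} {φ : List (ℕ × ℕ)} {k : Clo} {V c : ℕ} {S : Cfg}
    (hk : CloBound V k) (hc : k.2.1 ≠ 0) (hφ : ∀ e ∈ φ, e.2 ≤ V) {r : Outcome}
    (h : core F φ S k c = some r) : CloBound V r.1 ∧ ∀ e ∈ r.2.2, MsgBound V e.2 := by
  have hlt := (core_spec h).1
  unfold core at h
  simp only [cond_eqb] at h
  have h2 : ∀ n : ℕ, n.unpair.2 ≤ n := Nat.unpair_right_le
  have h1 : ∀ n : ℕ, n.unpair.1 ≤ n := Nat.unpair_left_le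
  have h3 := h2 (k.1 - 1)
  have h4 := h2 (k.1 - 1).unpair.2
  split_ifs at h with h0
  · obtain ⟨q, hq, rfl⟩ := Option.map_eq_some_iff.1 h
    have := h1 (k.1 - 1).unpair.2
    have hq := eval_bound hk hc hφ (by omega) hq
    have hb := hk.mono hlt.le
    refine ⟨⟨hb.1, hb.2.1, fun v hv => ?_, hb.2.2.2⟩, by simp⟩
    rcases List.mem_cons.1 hv with rfl | hv
    · cases hq1 : q.1 with
      | nil => simp
      | cons u us => exact hq.1 _ (by simp [hq1])
    · exact hb.2.2.1 v hv
  · obtain ⟨v, _, h⟩ := Option.bind_eq_some_iff.1 h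
    rw [cond_eqb] at h
    split_ifs at h
    obtain ⟨q, hq, rfl⟩ := Option.map_eq_some_iff.1 h
    refine ⟨hk.mono hlt.le, ?_⟩
    have h5 := h2 (k.1 - 1).unpair.2.unpair.2
    have h6 := h1 (k.1 - 1).unpair.2.unpair.2
    have h7 := h1 (k.1 - 1).unpair.2.unpair.2.unpair.2
    have hq := eval_bound hk hc hφ (by omega) hq
    have hV := hk.1
    intro e he
    rw [List.mem_singleton] at he
    subst he
    exact ⟨by dsimp only; omega, by have := hq.2; dsimp only; omega, hq.1⟩
  · obtain ⟨q, hq, rfl⟩ := Option.map_eq_some_iff.1 h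
    exact ⟨hk.mono hlt.le, by simp⟩
  all_goals
    cases h
    exact ⟨hk.mono hlt.le, by simp⟩

theorem start_bound {p : Prog} {A c V : ℕ} {m : Msg} {k : Clo} (hp : ProgBound V p)
    (hA : Nat.pair 1 A ≤ V) (hm : MsgBound V m) (h : start p A m c = some k) : CloBound V k := by
  unfold start at h
  obtain ⟨d, hd, h⟩ := Option.bind_eq_some_iff.1 h
  rw [Bool.cond_eq_ite] at h
  split_ifs at h with hcond
  cases h
  simp only [Bool.and_eq_true, eqb_iff] at hcond
  have hlen := hcond.2.2.2
  have hd := hp d (List.mem_of_getElem? hd)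
  rw [hlen] at hd
  refine ⟨hd.1, fun e he => ?_, by simp, hd.2⟩
  rcases List.mem_cons.1 he with rfl | he
  · exact hA
  · have := (List.of_mem_zip he).2
    unfold canon at this
    obtain ⟨u, hu, hue⟩ := List.mem_map.1 this
    rw [← hue, Bool.cond_eq_ite]
    split_ifs
    -- Renumbering pays off here: the new number is `N` plus an index below the arity, however large
    -- the original variable was.
    · refine le_trans (pair_mono_right ?_) hd.2
      have := List.idxOf_lt_length_of_mem hu
      omega
    · exact hm.2.2 u hu

/-- The same `V` serves before and after the step. One bound for the program and the first
configuration thus holds along a whole pure computation, which makes its letters finite in number.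
-/
theorem PureStep.bound {p : Prog} {S S' : Cfg} {A V : ℕ} {l : Option Msg}
    {ms : List (ℕ × Msg)} (hp : ProgBound V p) (hS : CfgBound V S)
    (h : PureStep p S A l ms S') : CfgBound V S' := by
  cases h with
  | pop h _ hs =>
    obtain ⟨h1, h2, _, h4, h5⟩ := hS _ _ h
    intro a t ht
    rw [lookup_put] at ht
    split_ifs at ht with ha
    · cases ht
      subst ha
      exact ⟨h1, h2, start_bound hp h2 (h5 _ (by simp)) hs, h4, fun m hm => h5 m (by simp [hm])⟩
    · exact hS a t ht
  | @act k k' φ q c _ h _ hc hl =>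
    obtain ⟨r, hr, _, hs⟩ := localStep_eq_some.1 hl
    cases hs
    obtain ⟨h1, h2, h3, h4, h5⟩ := hS _ _ h
    obtain ⟨h6, h7⟩ := core_bound h3 hc h4 hr
    have hput : CfgBound V (put S A (r.1, φ, q)) := by
      intro a t ht
      rw [lookup_put] at ht
      split_ifs at ht with ha
      · cases ht
        subst ha
        exact ⟨h1, h2, h6, h4, h5⟩
      · exact hS a t ht
    intro a t ht
    rw [lookup_sendAll] at ht
    obtain ⟨u, hu, rfl⟩ := Option.map_eq_some_iff.1 ht
    obtain ⟨h1, h2, h3, h4, h5⟩ := hput a u hu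
    refine ⟨h1, h2, h3, h4, fun m hm => ?_⟩
    rcases List.mem_append.1 hm with hm | hm
    · exact h5 m hm
    · exact h7 _ (mem_msgsTo.1 hm)

theorem finite_letters {p : Prog} {s : ℕ → Cfg} {A : ℕ → ℕ} {l : ℕ → Option Msg}
    {ms : ℕ → List (ℕ × Msg)} (h : ∀ n, PureStep p (s n) (A n) (l n) (ms n) (s (n + 1))) :
    {x : ℕ × Msg | ∃ n, A n = x.1 ∧ l n = some x.2}.Finite := by
  obtain ⟨V, hp, hV⟩ := (eventually_bound p (s 0)).exists
  have hs : ∀ n, CfgBound V (s n) := by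
    intro n
    induction n with
    | zero => exact hV
    | succ n ih => exact (h n).bound hp ih
  refine (finite_bounded_msgs V).subset ?_
  rintro ⟨a, m⟩ ⟨n, hA, hl⟩
  have hn := h n
  dsimp only at hA hl
  rw [hA, hl] at hn
  obtain ⟨_, k, k', φ, q, c, h', _⟩ := hn.pop_inv
  have := hs n _ _ h'
  exact ⟨this.1, this.2.2.2.2 m (by simp)⟩

end Machine

-- Stabilisation and pigeonhole principles.

theorem eventually_constant {f : ℕ → ℕ} {n₀ : ℕ} (h : ∀ n ≥ n₀, f (n + 1) ≤ f n) :
    ∃ n₁ ≥ n₀, ∀ n ≥ n₁, f (n + 1) = f n := by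
  have hne : {n | n₀ ≤ n}.Nonempty := ⟨n₀, le_refl n₀⟩
  set m := Function.argminOn f {n | n₀ ≤ n} hne with hm
  have hm0 : n₀ ≤ m := Function.argminOn_mem f {n | n₀ ≤ n} hne
  have hmin : ∀ n, n₀ ≤ n → f m ≤ f n := fun n hn =>
    Function.argminOn_le f {n | n₀ ≤ n} (show n ∈ {n | n₀ ≤ n} from hn)
  have hle : ∀ n ≥ m, f n ≤ f m := by
    intro n hn
    induction n, hn using Nat.le_induction with
    | base => exact le_rfl
    | succ n hn ih => exact (h n (hm0.trans hn)).trans ih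
  refine ⟨m, hm0, fun n hn => le_antisymm (h n (hm0.trans hn)) ?_⟩
  exact (hle n hn).trans (hmin _ ((hm0.trans hn).trans (Nat.le_succ n)))

theorem frequently_finite_choice {α : Type} {s : Set α} (hs : s.Finite) {P : α → ℕ → Prop}
    (h : ∃ᶠ n in Filter.atTop, ∃ x ∈ s, P x n) : ∃ x ∈ s, ∃ᶠ n in Filter.atTop, P x n := by
  by_contra! hcon
  refine h ?_
  have : ∀ᶠ n in Filter.atTop, ∀ x ∈ s, ¬ P x n :=
    (Filter.eventually_all_finite hs).2 fun x hx => by simpa using hcon x hx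
  filter_upwards [this] with n hn
  rintro ⟨x, hx, hP⟩
  exact hn x hx hP

-- Queues, fields and processes along pure computations.

namespace Machine

def queueOf (S : Cfg) (a : ℕ) : List Msg := ((S.lookup a).map fun t => t.2.2).getD []

def stateOf (S : Cfg) (a : ℕ) : List (ℕ × ℕ) := ((S.lookup a).map fun t => t.2.1).getD []

def cloOf (S : Cfg) (a : ℕ) : Clo := ((S.lookup a).map fun t => t.1).getD emptyClo

theorem lookup_eq_of_mem_keys {S : Cfg} {a : ℕ} (h : a ∈ keys S) :
    S.lookup a = some (cloOf S a, stateOf S a, queueOf S a) := by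
  obtain ⟨t, ht⟩ := Option.isSome_iff_exists.1 ((isSome_lookup_iff S a).2 h)
  simp [cloOf, stateOf, queueOf, ht]

namespace PureStep

variable {p : Prog} {S S' : Cfg} {A : ℕ} {l : Option Msg} {ms : List (ℕ × Msg)} {m : Msg}

theorem mem_keys (h : PureStep p S A l ms S') : A ∈ keys S := by
  obtain ⟨t, ht⟩ := h.exists_lookup
  exact (isSome_lookup_iff S A).1 (by rw [ht]; rfl)

theorem keys_eq (h : PureStep p S A l ms S') : keys S' = keys S := by
  cases h with
  | pop h _ _ => exact keys_put _ _ _ (by rw [h]; rfl)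
  | act h _ _ _ => exact (keys_sendAll _ _).trans (keys_put _ _ _ (by rw [h]; rfl))

theorem stateOf_eq (h : PureStep p S A l ms S') (a : ℕ) : stateOf S' a = stateOf S a := by
  unfold stateOf
  cases h with
  | pop h _ _ =>
    rw [lookup_put]
    split_ifs with ha
    · subst ha; simp [h]
    · rfl
  | act h _ _ _ =>
    rw [lookup_sendAll, lookup_put]
    split_ifs with ha
    · subst ha; simp [h]
    · cases S.lookup a <;> rfl

theorem cloOf_eq (h : PureStep p S A l ms S') {a : ℕ} (ha : A ≠ a) : cloOf S' a = cloOf S a := by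
  unfold cloOf
  cases h with
  | pop h _ _ => rw [lookup_put, if_neg ha.symm]
  | act h _ _ _ =>
    rw [lookup_sendAll, lookup_put, if_neg ha.symm]
    cases S.lookup a <;> rfl

theorem queueOf_pop (h : PureStep p S A (some m) ms S') : queueOf S A = m :: queueOf S' A := by
  obtain ⟨_, k, k', φ, q, c, hS, _, _, rfl⟩ := h.pop_inv
  simp [queueOf, hS, lookup_put]

theorem queueOf_pop_ne (h : PureStep p S A (some m) ms S') {a : ℕ} (ha : A ≠ a) :
    queueOf S' a = queueOf S a := by
  obtain ⟨_, k, k', φ, q, c, hS, _, _, rfl⟩ := h.pop_inv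
  simp [queueOf, lookup_put, ha.symm]

theorem target_mem (h : PureStep p S A l ms S') {e : ℕ × Msg} (he : e ∈ ms) : e.1 ∈ keys S := by
  cases h with
  | pop => simp at he
  | act _ _ _ hl =>
    obtain ⟨r, _, hd, hs⟩ := localStep_eq_some.1 hl
    cases hs
    exact hd e he

theorem queueOf_act (h : PureStep p S A none ms S') (a : ℕ) :
    queueOf S' a = queueOf S a ++ msgsTo a ms := by
  have htar := fun e he => h.target_mem (e := e) he
  obtain ⟨k, k', φ, q, c, hS, _, _, _, rfl⟩ := h.act_inv
  by_cases hk : a ∈ keys S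
  · unfold queueOf
    rw [lookup_sendAll, lookup_put]
    split_ifs with ha
    · subst ha; simp [hS, msgsTo]
    · rw [lookup_eq_of_mem_keys hk]; simp [msgsTo]
  · have h1 : S.lookup a = none := by
      rw [← Option.not_isSome_iff_eq_none, isSome_lookup_iff]; exact hk
    have h2 : msgsTo a ms = [] := by
      rw [List.eq_nil_iff_forall_not_mem]
      intro m hm
      exact hk (htar _ (mem_msgsTo.1 hm))
    have h3 : a ≠ A := by rintro rfl; rw [h1] at hS; cases hS
    simp [queueOf, lookup_sendAll, lookup_put, h1, h2, h3]

theorem cloOf_act (h : PureStep p S A none ms S') :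
    (cloOf S A).1 ≠ 0 ∧ (cloOf S A).2.1 ≠ 0 ∧
      ∃ c, localStep p.1 (keys S) (stateOf S A) (cloOf S A) c = some (cloOf S' A, ms) := by
  obtain ⟨k, k', φ, q, c, hS, h1, h2, h3, rfl⟩ := h.act_inv
  have e1 : cloOf S A = k := by simp [cloOf, hS]
  have e2 : stateOf S A = φ := by simp [stateOf, hS]
  rw [e1, e2]
  refine ⟨h1, h2, c, ?_⟩
  rw [keys, h3]
  simp [cloOf, lookup_sendAll, lookup_put]

theorem cloOf_pop (h : PureStep p S A (some m) ms S') :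
    (cloOf S A).1 = 0 ∧ ∃ c, start p A m c = some (cloOf S' A) := by
  obtain ⟨_, k, k', φ, q, c, hS, h1, h2, rfl⟩ := h.pop_inv
  exact ⟨by simpa [cloOf, hS] using h1, c, by simpa [cloOf, lookup_put] using h2⟩

theorem eq_none_of_mem (h : PureStep p S A l ms S') {e : ℕ × Msg} (he : e ∈ ms) : l = none := by
  cases h with
  | pop => simp at he
  | act => rfl

end PureStep

/-- This prepends one observed step to a completion, for recovering a process execution backwards
from its end. -/
theorem complete_cons {F : Fields} {dom : List ℕ} {φ : List (ℕ × ℕ)} {k k' : Clo} {c : ℕ}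
    {cs : List ℕ} {ms ms' : List (ℕ × Msg)} (hk : k.1 ≠ 0) (hc : k.2.1 ≠ 0)
    (h : localStep F dom φ k c = some (k', ms)) (h' : complete F dom φ k' cs = some ms') :
    ∃ cs', complete F dom φ k cs' = some (ms ++ ms') := by
  have hrun : ∀ cs, localRun F dom φ k (c :: cs) =
      (localRun F dom φ k' cs).map fun s => (s.1, ms ++ s.2) := by
    intro cs
    induction cs using List.reverseRecOn with
    | nil =>
      have := localRun_snoc F dom φ k [] c
      rw [List.nil_append] at this
      rw [this]
      simp [localRun, h]
    | append_singleton cs d ih =>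
      rw [← List.cons_append, localRun_snoc, ih, localRun_snoc]
      cases localRun F dom φ k' cs with
      | none => rfl
      | some s => simp [Function.comp_def]
  rcases complete_eq_some.1 h' with ⟨hk', rfl⟩ | ⟨hk', hc', k'', hr, hk''⟩
  · refine ⟨[c], complete_eq_some.2 (Or.inr ⟨hk, hc, k', ?_, hk'⟩)⟩
    rw [hrun]
    simp [localRun]
  · refine ⟨c :: cs, complete_eq_some.2 (Or.inr ⟨hk, hc, k'', ?_, hk''⟩)⟩
    rw [hrun, hr]
    rfl

section Run

variable {p : Prog} {s : ℕ → Cfg} {A : ℕ → ℕ} {l : ℕ → Option Msg} {ms : ℕ → List (ℕ × Msg)}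

theorem keys_run (h : ∀ n, PureStep p (s n) (A n) (l n) (ms n) (s (n + 1))) (n : ℕ) :
    keys (s n) = keys (s 0) := by
  induction n with
  | zero => rfl
  | succ n ih => rw [(h n).keys_eq, ih]

theorem stateOf_run (h : ∀ n, PureStep p (s n) (A n) (l n) (ms n) (s (n + 1))) (n a : ℕ) :
    stateOf (s n) a = stateOf (s 0) a := by
  induction n with
  | zero => rfl
  | succ n ih => rw [(h n).stateOf_eq, ih]

/-- An actor that takes finitely many messages performs finitely many steps. -/
theorem eventually_ne_of_no_pop (h : ∀ n, PureStep p (s n) (A n) (l n) (ms n) (s (n + 1)))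
    {a n₀ : ℕ} (hno : ∀ n ≥ n₀, A n = a → l n = none) : ∀ᶠ n in Filter.atTop, A n ≠ a := by
  -- Without messages taken, the code of the actor's process drops with each of its steps and is
  -- otherwise unchanged, so it cannot move forever.
  have key : ∀ n ≥ n₀, (cloOf (s (n + 1)) a).1 ≤ (cloOf (s n) a).1 ∧
      (A n = a → (cloOf (s (n + 1)) a).1 < (cloOf (s n) a).1) := by
    intro n hn
    by_cases ha : A n = a
    · subst ha
      have hstep := h n
      rw [hno n hn rfl] at hstep
      obtain ⟨_, _, c, hc⟩ := hstep.cloOf_act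
      obtain ⟨r, hr, _, hs⟩ := localStep_eq_some.1 hc
      have := (core_spec hr).1
      rw [← (Prod.ext_iff.1 hs).1] at this
      exact ⟨this.le, fun _ => this⟩
    · rw [(h n).cloOf_eq ha]
      exact ⟨le_rfl, fun h => (ha h).elim⟩
  obtain ⟨n₁, hn₁, hc⟩ := eventually_constant (f := fun n => (cloOf (s n) a).1)
    fun n hn => (key n hn).1
  filter_upwards [Filter.eventually_ge_atTop n₁] with n hn ha
  have h1 := (key n (hn₁.trans hn)).2 ha
  have h2 := hc n hn
  exact absurd h2 h1.ne

/-- Actors that take infinitely many messages take all messages. -/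
theorem exists_pop_of_mem_queue (h : ∀ n, PureStep p (s n) (A n) (l n) (ms n) (s (n + 1)))
    {a : ℕ} (hf : ∀ n, ∃ k ≥ n, A k = a ∧ (l k).isSome) {n : ℕ} {m : Msg}
    (hm : m ∈ queueOf (s n) a) : ∃ k ≥ n, A k = a ∧ l k = some m := by
  by_contra! hcon
  -- FIFO order: sending appends behind the first occurrence of `m`, and each removal of another
  -- message brings that occurrence one place forward.
  have key : ∀ k ≥ n, m ∈ queueOf (s k) a → m ∈ queueOf (s (k + 1)) a ∧
      (queueOf (s (k + 1)) a).idxOf m ≤ (queueOf (s k) a).idxOf m ∧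
      (A k = a → (l k).isSome →
        (queueOf (s (k + 1)) a).idxOf m < (queueOf (s k) a).idxOf m) := by
    intro k hk hmk
    have hstep := h k
    cases hl : l k with
    | none =>
      rw [hl] at hstep
      rw [hstep.queueOf_act]
      exact ⟨List.mem_append_left _ hmk, by rw [List.idxOf_append_of_mem hmk], by simp⟩
    | some m' =>
      rw [hl] at hstep
      by_cases ha : A k = a
      · subst ha
        have hne : m' ≠ m := fun e => hcon k hk rfl (by rw [hl, e])
        rw [hstep.queueOf_pop] at hmk ⊢
        rw [List.idxOf_cons_ne _ hne]
        refine ⟨?_, Nat.le_succ _, fun _ _ => Nat.lt_succ_self _⟩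
        rcases List.mem_cons.1 hmk with h' | h'
        · exact (hne h'.symm).elim
        · exact h'
      · rw [hstep.queueOf_pop_ne ha]
        exact ⟨hmk, le_rfl, fun h => (ha h).elim⟩
  have hmem : ∀ k ≥ n, m ∈ queueOf (s k) a := by
    intro k hk
    induction k, hk using Nat.le_induction with
    | base => exact hm
    | succ k hk ih => exact (key k hk ih).1
  obtain ⟨n₁, hn₁, hc⟩ := eventually_constant (f := fun k => (queueOf (s k) a).idxOf m)
    fun k hk => (key k hk (hmem k hk)).2.1
  obtain ⟨k, hk, hA, hl⟩ := hf n₁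
  have := (key k (hn₁.trans hk) (hmem k (hn₁.trans hk))).2.2 hA hl
  exact absurd (hc k hk) this.ne

/-- An actor that is about to take a message has completed its process. -/
theorem exists_complete (h : ∀ n, PureStep p (s n) (A n) (l n) (ms n) (s (n + 1)))
    {k₀ a : ℕ} (ha : A k₀ = a) (hl : (l k₀).isSome) {n : ℕ} (hn : n ≤ k₀)
    (hno : ∀ i ≥ n, i < k₀ → A i = a → l i = none) :
    ∃ cs es, complete p.1 (keys (s 0)) (stateOf (s 0) a) (cloOf (s n) a) cs = some es ∧
      (∀ e ∈ es, ∃ i ≥ n, e ∈ ms i) ∧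
      ∀ i ≥ n, i < k₀ → A i = a → ∀ e ∈ ms i, e ∈ es := by
  -- Backwards from the moment at which the next message is taken, when the process has certainly
  -- ended.
  induction hn using Nat.decreasingInduction with
  | self =>
    obtain ⟨m, hm⟩ := Option.isSome_iff_exists.1 hl
    have hstep := h k₀
    rw [hm, ha] at hstep
    refine ⟨[], [], complete_eq_some.2 (Or.inl ⟨hstep.cloOf_pop.1, rfl⟩), by simp, ?_⟩
    intro i h1 h2
    omega
  | of_succ n hn ih =>
    obtain ⟨cs, es, h1, h2, h3⟩ := ih fun i hi => hno i (by omega)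
    have h2' : ∀ e ∈ es, ∃ i ≥ n, e ∈ ms i := fun e he => by
      obtain ⟨i, hi, h'⟩ := h2 e he
      exact ⟨i, by omega, h'⟩
    by_cases hA : A n = a
    · have hstep := h n
      rw [hno n le_rfl hn hA, hA] at hstep
      obtain ⟨hk, hc, c, hstep⟩ := hstep.cloOf_act
      rw [keys_run h, stateOf_run h] at hstep
      obtain ⟨cs', hcs'⟩ := complete_cons hk hc hstep h1
      refine ⟨cs', _, hcs', ?_, ?_⟩
      · intro e he
        rcases List.mem_append.1 he with he | he
        · exact ⟨n, le_rfl, he⟩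
        · exact h2' e he
      · intro i hi1 hi2 hi3 e he
        rcases hi1.eq_or_lt with rfl | hi1
        · exact List.mem_append_left _ he
        · exact List.mem_append_right _ (h3 i hi1 hi2 hi3 e he)
    · rw [(h n).cloOf_eq hA] at h1
      refine ⟨cs, es, h1, h2', ?_⟩
      intro i hi1 hi2 hi3 e he
      rcases hi1.eq_or_lt with rfl | hi1
      · exact (hA hi3).elim
      · exact h3 i hi1 hi2 hi3 e he

theorem exists_next_pop {a : ℕ} (hf : ∀ n, ∃ k ≥ n, A k = a ∧ (l k).isSome) (n : ℕ) :
    ∃ k₀ ≥ n, A k₀ = a ∧ (l k₀).isSome ∧ ∀ i ≥ n, i < k₀ → A i = a → l i = none := by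
  classical
  refine ⟨Nat.find (hf n), (Nat.find_spec (hf n)).1, (Nat.find_spec (hf n)).2.1,
    (Nat.find_spec (hf n)).2.2, fun i h1 h2 h3 => ?_⟩
  have := Nat.find_min (hf n) h2
  rw [← Option.not_isSome_iff_eq_none]
  exact fun h4 => this ⟨h1, h3, h4⟩

end Run

-- Fair pure computations: letters, predecessors and the certificate.

section FairRun

variable {p : Prog} {s : ℕ → Cfg} {A : ℕ → ℕ} {l : ℕ → Option Msg} {ms : ℕ → List (ℕ × Msg)}

/-- The messages `es` are emitted by some complete execution of the letter `y`. -/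
def Handles (p : Prog) (S : Cfg) (y : ℕ × Msg) (es : List (ℕ × Msg)) : Prop :=
  ∃ c cs k, start p y.1 y.2 c = some k ∧
    complete p.1 (keys S) (stateOf S y.1) k cs = some es

/-- The letters that are taken from a queue. -/
def Taken (A : ℕ → ℕ) (l : ℕ → Option Msg) : Set (ℕ × Msg) := {x | ∃ n, A n = x.1 ∧ l n = some x.2}

theorem mem_taken_of_mem_emitted (h : ∀ n, PureStep p (s n) (A n) (l n) (ms n) (s (n + 1)))
    (hf : ∀ i n, ∃ k ≥ n, A k = A i ∧ (l k).isSome) {e : ℕ × Msg} {i : ℕ} (he : e ∈ ms i)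
    (hL : e.1 ∈ Set.range A) : e ∈ Taken A l := by
  obtain ⟨j, hj⟩ := hL
  have hstep := h i
  rw [hstep.eq_none_of_mem he] at hstep
  have hm : e.2 ∈ queueOf (s (i + 1)) e.1 := by
    rw [hstep.queueOf_act]
    exact List.mem_append_right _ (mem_msgsTo.2 he)
  obtain ⟨k, _, hk⟩ := exists_pop_of_mem_queue h (hj ▸ hf j) hm
  exact ⟨k, hk⟩

/-- The actor takes another message later, so the execution begun at time `n` ends, and its steps
can be read off the computation. The last clause says that everything the actor sends before that
next taking belongs to this execution. -/
theorem exists_handles (h : ∀ n, PureStep p (s n) (A n) (l n) (ms n) (s (n + 1)))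
    (hf : ∀ i n, ∃ k ≥ n, A k = A i ∧ (l k).isSome) {y : ℕ × Msg} {n : ℕ} (hA : A n = y.1)
    (hl : l n = some y.2) : ∃ es, Handles p (s 0) y es ∧
      (∀ e ∈ es, e.1 ∈ Set.range A → e ∈ Taken A l) ∧
      ∀ i > n, (∀ j > n, j ≤ i → A j = y.1 → l j = none) → A i = y.1 → ∀ e ∈ ms i, e ∈ es := by
  obtain ⟨k₀, hk, hk1, hk2, hno⟩ := exists_next_pop (hA ▸ hf n) (n + 1)
  obtain ⟨cs, es, h1, h2, h3⟩ := exists_complete h hk1 hk2 hk hno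
  have hstep := h n
  rw [hl, hA] at hstep
  obtain ⟨_, c, hc⟩ := hstep.cloOf_pop
  refine ⟨es, ⟨c, cs, _, hc, h1⟩, ?_, ?_⟩
  · intro e he hL
    obtain ⟨i, _, hi⟩ := h2 e he
    exact mem_taken_of_mem_emitted h hf hi hL
  · intro i hi hno' hAi
    refine h3 i hi ?_ hAi
    by_contra! hle
    rw [hno' k₀ hk hle hk1] at hk2
    simp at hk2

/-- A letter that is taken infinitely often is emitted in the execution of such a letter. -/
theorem exists_predecessor (h : ∀ n, PureStep p (s n) (A n) (l n) (ms n) (s (n + 1)))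
    (hf : ∀ i n, ∃ k ≥ n, A k = A i ∧ (l k).isSome) {x : ℕ × Msg}
    (hx : ∃ᶠ n in Filter.atTop, A n = x.1 ∧ l n = some x.2) :
    ∃ y, (∃ᶠ n in Filter.atTop, A n = y.1 ∧ l n = some y.2) ∧ ∃ es, Handles p (s 0) y es ∧
      (∀ e ∈ es, e.1 ∈ Set.range A → e ∈ Taken A l) ∧ x ∈ es := by
  classical
  -- Otherwise the number of copies of `x` in the queue would eventually never grow, yet drop
  -- infinitely often.
  have h1 : ∃ᶠ n in Filter.atTop, x ∈ ms n := by
    intro hno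
    obtain ⟨n₀, hn₀⟩ := Filter.eventually_atTop.1 hno
    have key : ∀ n ≥ n₀, (queueOf (s (n + 1)) x.1).count x.2 ≤ (queueOf (s n) x.1).count x.2 ∧
        (A n = x.1 ∧ l n = some x.2 →
          (queueOf (s (n + 1)) x.1).count x.2 < (queueOf (s n) x.1).count x.2) := by
      intro n hn
      have hstep := h n
      cases hl : l n with
      | none =>
        rw [hl] at hstep
        have : (msgsTo x.1 (ms n)).count x.2 = 0 :=
          List.count_eq_zero_of_not_mem fun hmem => hn₀ n hn (mem_msgsTo.1 hmem)
        rw [hstep.queueOf_act, List.count_append, this]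
        exact ⟨le_rfl, by simp⟩
      | some m =>
        rw [hl] at hstep
        by_cases ha : A n = x.1
        · rw [ha] at hstep
          rw [hstep.queueOf_pop, List.count_cons]
          refine ⟨Nat.le_add_right _ _, fun h' => ?_⟩
          rw [Option.some.injEq] at h'
          simp [h'.2]
        · rw [hstep.queueOf_pop_ne ha]
          exact ⟨le_rfl, fun h' => (ha h'.1).elim⟩
    obtain ⟨n₁, hn₁, hc⟩ := eventually_constant
      (f := fun n => (queueOf (s n) x.1).count x.2) fun n hn => (key n hn).1
    obtain ⟨n, hn, hpop⟩ := Filter.frequently_atTop.1 hx n₁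
    exact absurd (hc n hn) ((key n (hn₁.trans hn)).2 hpop).ne
  -- There are finitely many actors, so a single one sends `x` infinitely often.
  obtain ⟨b, _, hb⟩ : ∃ b ∈ {b | b ∈ keys (s 0)}, ∃ᶠ n in Filter.atTop, x ∈ ms n ∧ A n = b := by
    refine frequently_finite_choice (List.finite_toSet _) (h1.mono fun n hn => ?_)
    exact ⟨A n, show A n ∈ keys (s 0) from keys_run h n ▸ (h n).mem_keys, hn, rfl⟩
  obtain ⟨i₀, _, hi₀⟩ := hb.exists
  have h2 : ∃ᶠ t in Filter.atTop, ∃ y ∈ Taken A l, (A t = y.1 ∧ l t = some y.2) ∧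
      ∃ es, Handles p (s 0) y es ∧ (∀ e ∈ es, e.1 ∈ Set.range A → e ∈ Taken A l) ∧ x ∈ es := by
    rw [Filter.frequently_atTop]
    intro K
    obtain ⟨t₀, ht₀, hA₀, hl₀⟩ := hi₀ ▸ hf i₀ K
    obtain ⟨n, hn, hxn, hAn⟩ := Filter.frequently_atTop.1 hb t₀
    -- The last message taken by `b` before it sends `x` at time `n`: its execution contains this
    -- sending. Choosing `n` after a taking beyond `K` makes `t` arbitrarily late.
    set t := Nat.findGreatest (fun t => A t = b ∧ (l t).isSome) n with ht
    have hspec : A t = b ∧ (l t).isSome :=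
      Nat.findGreatest_spec (P := fun t => A t = b ∧ (l t).isSome) hn ⟨hA₀, hl₀⟩
    have hle : t₀ ≤ t := Nat.le_findGreatest hn ⟨hA₀, hl₀⟩
    have htn : t ≤ n := Nat.findGreatest_le n
    have hlt : t < n := by
      refine lt_of_le_of_ne htn fun he => ?_
      rw [he, (h n).eq_none_of_mem hxn] at hspec
      simp at hspec
    obtain ⟨m, hm⟩ := Option.isSome_iff_exists.1 hspec.2
    obtain ⟨es, he1, he2, he3⟩ := exists_handles h hf (y := (b, m)) hspec.1 hm
    refine ⟨t, ht₀.trans hle, (b, m), ⟨t, hspec.1, hm⟩, ⟨hspec.1, hm⟩, es, he1, he2, ?_⟩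
    refine he3 n hlt (fun j hj hjn hAj => ?_) hAn x hxn
    rw [← Option.not_isSome_iff_eq_none]
    exact fun hs => Nat.findGreatest_is_greatest hj hjn ⟨hAj, hs⟩
  -- Since the letters form a finite set, one predecessor serves infinitely often.
  obtain ⟨y, _, hy⟩ := frequently_finite_choice (finite_letters h) h2
  exact ⟨y, hy.mono fun n hn => hn.1, hy.exists.choose_spec.2⟩

theorem handle_of_handles {S T : Cfg} (hk : keys T = keys S)
    (hst : ∀ a, stateOf T a = stateOf S a) {y : ℕ × Msg} {es : List (ℕ × Msg)}
    (hy : y.1 ∈ keys T) (h : Handles p S y es) :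
    ∃ c cs, handle p T (y, c, cs) = some es := by
  obtain ⟨c, cs, k, h1, h2⟩ := h
  refine ⟨c, cs, handle_eq_some.2 ⟨_, k, lookup_eq_of_mem_keys hy, h1, ?_⟩⟩
  dsimp only
  rw [hk, hst, h2]

/-- A computation in which all moving actors take infinitely many messages has a certificate. -/
theorem exists_check_of_fair (h : ∀ n, PureStep p (s n) (A n) (l n) (ms n) (s (n + 1)))
    (hf : ∀ i n, ∃ k ≥ n, A k = A i ∧ (l k).isSome) : ∃ n C, check p (s n) C = true := by
  classical
  have hGfin : (Taken A l).Finite := finite_letters h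
  have hkeyA : ∀ i, A i ∈ keys (s 0) := fun i => keys_run h i ▸ (h i).mem_keys
  -- the letters that are taken infinitely often
  let J : Set (ℕ × Msg) := {x | ∃ᶠ n in Filter.atTop, A n = x.1 ∧ l n = some x.2}
  have hJG : J ⊆ Taken A l := fun x hx => Filter.Frequently.exists hx
  have hJfin : J.Finite := hGfin.subset hJG
  obtain ⟨x₀, _, hx₀⟩ : ∃ x ∈ Taken A l, ∃ᶠ n in Filter.atTop, A n = x.1 ∧ l n = some x.2 := by
    refine frequently_finite_choice hGfin ?_
    rw [Filter.frequently_atTop]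
    intro K
    obtain ⟨k, hk, _, hl⟩ := hf 0 K
    obtain ⟨m, hm⟩ := Option.isSome_iff_exists.1 hl
    exact ⟨k, hk, (A k, m), ⟨k, rfl, hm⟩, rfl, hm⟩
  have hpred : ∀ x : J, ∃ y : J, ∃ es, Handles p (s 0) y.1 es ∧
      (∀ e ∈ es, e.1 ∈ Set.range A → e ∈ Taken A l) ∧ x.1 ∈ es := fun x => by
    obtain ⟨y, hy, hes⟩ := exists_predecessor h hf x.2
    exact ⟨⟨y, hy⟩, hes⟩
  choose f hfes using hpred
  have : Finite J := hJfin
  -- Iterated predecessors repeat in a finite set. Between the two equal iterates lies a cycle in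
  -- which each letter is emitted by the execution of the next one.
  obtain ⟨i, j, hij, hfij⟩ := Finite.exists_ne_map_eq_of_infinite fun n : ℕ => f^[n] ⟨x₀, hx₀⟩
  wlog hlt : i < j generalizing i j
  · exact this j i hij.symm hfij.symm (by omega)
  set z : ℕ → J := fun n => f^[n] ⟨x₀, hx₀⟩ with hz
  have hzsucc : ∀ n, z (n + 1) = f (z n) := fun n => Function.iterate_succ_apply' f n _
  -- the configuration in which the certificate holds
  obtain ⟨N, hN⟩ := Filter.Frequently.exists (z j).2
  have hkN : keys (s N) = keys (s 0) := keys_run h N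
  have hstN := fun a => stateOf_run h N a
  have hrange : ∀ x ∈ Taken A l, x.1 ∈ Set.range A := fun x ⟨n, hn, _⟩ => ⟨n, hn⟩
  have hkeyx : ∀ x ∈ Taken A l, x.1 ∈ keys (s N) := fun x hx => by
    obtain ⟨n, hn⟩ := hrange x hx
    rw [hkN, ← hn]
    exact hkeyA n
  have hactor : ∀ a ∈ Set.range A, ∃ cs es,
      complete p.1 (keys (s N)) (stateOf (s N) a) (cloOf (s N) a) cs = some es ∧
        ∀ e ∈ es, e.1 ∈ Set.range A → e ∈ Taken A l := by
    rintro a ⟨n, rfl⟩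
    obtain ⟨k₀, hk, hk1, hk2, hno⟩ := exists_next_pop (hf n) N
    obtain ⟨cs, es, h1, h2, _⟩ := exists_complete h hk1 hk2 hk hno
    rw [hkN, hstN]
    refine ⟨cs, es, h1, fun e he hL => ?_⟩
    obtain ⟨i, _, hi⟩ := h2 e he
    exact mem_taken_of_mem_emitted h hf hi hL
  have hletter : ∀ x ∈ Taken A l, ∃ c cs es, handle p (s N) (x, c, cs) = some es ∧
      ∀ e ∈ es, e.1 ∈ Set.range A → e ∈ Taken A l := by
    rintro x hx
    obtain ⟨n, hn1, hn2⟩ := id hx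
    obtain ⟨es, h1, h2, _⟩ := exists_handles h hf hn1 hn2
    obtain ⟨c, cs, h3⟩ := handle_of_handles hkN hstN (hkeyx x hx) h1
    exact ⟨c, cs, es, h3, h2⟩
  have hperp : ∀ n, ∃ c cs es, handle p (s N) ((z (n + 1)).1, c, cs) = some es ∧
      (∀ e ∈ es, e.1 ∈ Set.range A → e ∈ Taken A l) ∧ (z n).1 ∈ es := by
    intro n
    rw [hzsucc]
    obtain ⟨es, h1, h2, h3⟩ := hfes (z n)
    obtain ⟨c, cs, h4⟩ := handle_of_handles hkN hstN (hkeyx _ (hJG (f (z n)).2)) h1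
    exact ⟨c, cs, es, h4, h2, h3⟩
  choose! bits bitsSpec using hactor
  choose! lc lcs lSpec using hletter
  choose pc pcs pSpec using hperp
  have hAfin : (Set.range A).Finite := (List.finite_toSet (keys (s 0))).subset (by
    rintro a ⟨n, rfl⟩
    exact hkeyA n)
  -- Persistent: all actors that move. Harmless: all letters ever taken. Perpetual: the cycle,
  -- listed from `i + 1` to `j`.
  let C : Cert := (hAfin.toFinset.toList.map fun a => (a, bits a),
    hGfin.toFinset.toList.map fun x => (x, lc x, lcs x),
    (List.range (j - i)).map fun n => ((z (i + n + 1)).1, pc (i + n), pcs (i + n)))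
  have hC1 : ∀ a, a ∈ C.1.map (fun a => a.1) ↔ a ∈ Set.range A := by
    intro a
    simp [C]
  have hC2 : ∀ x, x ∈ letters C.2.1 ↔ x ∈ Taken A l := by
    intro x
    simp [C, letters]
  have hC3 : ∀ n ≥ i, n ≤ j → (z n).1 ∈ letters C.2.2 := by
    have H : ∀ n > i, n ≤ j → (z n).1 ∈ letters C.2.2 := by
      intro n h1 h2
      simp only [C, letters, List.map_map, List.mem_map, List.mem_range, Function.comp_apply]
      exact ⟨n - i - 1, by omega, by rw [show i + (n - i - 1) + 1 = n by omega]⟩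
    intro n h1 h2
    rcases h1.eq_or_lt with rfl | h1
    -- The letter emitted by `z (i + 1)` is `z i`, which is on the list because the cycle closes.
    · rw [show z i = z j from hfij]
      exact H j hlt le_rfl
    · exact H n h1 h2
  have hharm : ∀ es, (∀ e ∈ es, e.1 ∈ Set.range A → e ∈ Taken A l) → Harmless C es := by
    intro es hes e he hL
    exact (hC2 e).2 (hes e he ((hC1 _).1 hL))
  refine ⟨N, C, (check_iff _ _ _).2 ⟨?_, ?_, ?_, ?_⟩⟩
  · intro a ha
    obtain ⟨b, hb, rfl⟩ := List.mem_map.1 ha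
    have hb : b ∈ Set.range A := by simpa using hb
    obtain ⟨es, h1, h2⟩ := bitsSpec b hb
    have hbk : b ∈ keys (s N) := by
      obtain ⟨n, rfl⟩ := hb
      rw [hkN]
      exact hkeyA n
    refine ⟨_, es, lookup_eq_of_mem_keys hbk, h1, hharm es h2, fun m hm => (hC2 _).2 ?_⟩
    obtain ⟨n, rfl⟩ := hb
    obtain ⟨k, _, hk⟩ := exists_pop_of_mem_queue h (hf n) hm
    exact ⟨k, hk⟩
  · intro g hg
    obtain ⟨x, hx, rfl⟩ := List.mem_map.1 hg
    obtain ⟨es, h1, h2⟩ := lSpec x (by simpa using hx)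
    exact ⟨es, h1, hharm es h2⟩
  · intro g hg
    obtain ⟨n, hn, rfl⟩ := List.mem_map.1 hg
    rw [List.mem_range] at hn
    obtain ⟨es, h1, h2, h3⟩ := pSpec (i + n)
    refine ⟨(hC1 _).2 (hrange _ (hJG (z (i + n + 1)).2)), es, h1, hharm es h2, _, h3, ?_⟩
    exact hC3 _ (by omega) (by omega)
  · obtain ⟨g, hg, hgz⟩ := List.mem_map.1 (hC3 j (by omega) le_rfl)
    refine ⟨g, hg, _, lookup_eq_of_mem_keys (hkeyx _ ?_), ?_⟩
    · rw [hgz]; exact hJG (z j).2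
    · have hstep := h N
      rw [hN.2, hN.1] at hstep
      rw [hgz]
      dsimp only
      rw [hstep.queueOf_pop]
      exact List.mem_cons_self

end FairRun

/-- Two prefixes are cut off: one until the weight of the start processes is constant, so that all
steps are pure, and one until every actor that takes only finitely many messages has stopped. -/
theorem exists_check_of_diverges {p : Prog} {S : Cfg} (hS : Diverges (Move p) S) :
    ∃ T C, Relation.ReflTransGen (Move p) S T ∧ check p T C = true := by
  obtain ⟨s, rfl, hs⟩ := hS
  have hreach : ∀ n, Relation.ReflTransGen (Move p) (s 0) (s n) := by
    intro n
    induction n with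
    | zero => exact .refl
    | succ n ih => exact ih.tail (hs n)
  obtain ⟨n₁, _, hc⟩ := eventually_constant (f := fun n => measure (s n)) (n₀ := 0) fun n _ => by
    rcases measure_lt_or_pureStep (hs n) with h | h
    · exact h.le
    · exact h.1.le
  have hpure : ∀ n, ∃ A l ms, PureStep p (s (n₁ + n)) A l ms (s (n₁ + n + 1)) := by
    intro n
    rcases measure_lt_or_pureStep (hs (n₁ + n)) with h | h
    · exact absurd (hc (n₁ + n) (by omega)) h.ne
    · exact h.2
  choose A l ms h using hpure
  have h' : ∀ n, PureStep p (s (n₁ + n)) (A n) (l n) (ms n) (s (n₁ + (n + 1))) := h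
  -- Finitely many actors: from some time on, only those that take messages forever still move.
  have hev : ∀ᶠ n in Filter.atTop, ∀ a ∈ {a | a ∈ keys (s (n₁ + 0))}, A n = a →
      ∀ m, ∃ k ≥ m, A k = a ∧ (l k).isSome := by
    refine (Filter.eventually_all_finite (List.finite_toSet _)).2 fun a _ => ?_
    by_cases hfreq : ∀ m, ∃ k ≥ m, A k = a ∧ (l k).isSome
    · exact Filter.Eventually.of_forall fun _ _ => hfreq
    · push Not at hfreq
      obtain ⟨m, hm⟩ := hfreq
      have := eventually_ne_of_no_pop (s := fun n => s (n₁ + n)) h' (a := a) (n₀ := m)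
        fun n hn ha => by simpa using hm n hn ha
      filter_upwards [this] with n hn ha
      exact (hn ha).elim
  obtain ⟨n₂, hn₂⟩ := Filter.eventually_atTop.1 hev
  have hfair : ∀ i n, ∃ k ≥ n, A (n₂ + k) = A (n₂ + i) ∧ (l (n₂ + k)).isSome := by
    intro i n
    have hmem : A (n₂ + i) ∈ keys (s (n₁ + 0)) := by
      rw [← keys_run (s := fun n => s (n₁ + n)) h' (n₂ + i)]
      exact (h' (n₂ + i)).mem_keys
    obtain ⟨k, hk, h1, h2⟩ := hn₂ (n₂ + i) (by omega) _ hmem rfl (n₂ + n)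
    refine ⟨k - n₂, by omega, ?_⟩
    rw [show n₂ + (k - n₂) = k by omega]
    exact ⟨h1, h2⟩
  obtain ⟨n, C, hC⟩ := exists_check_of_fair (s := fun n => s (n₁ + (n₂ + n)))
    (A := fun n => A (n₂ + n)) (l := fun n => l (n₂ + n)) (ms := fun n => ms (n₂ + n))
    (fun n => h' (n₂ + n)) hfair
  exact ⟨_, C, hreach _, hC⟩

theorem diverges_iff_exists_checkRun (p : Prog) (S : Cfg) :
    Diverges (Move p) S ↔ ∃ w, checkRun p S w = true := by
  have hw : ∀ w, checkRun p S w = true ↔ ∃ T, run p S w.1 = some T ∧ check p T w.2 = true :=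
    fun w => getD_false_iff _ _
  constructor
  · intro h
    obtain ⟨T, C, h1, h2⟩ := exists_check_of_diverges h
    obtain ⟨cs, hcs⟩ := exists_run h1
    exact ⟨(cs, C), (hw _).2 ⟨T, hcs, h2⟩⟩
  · rintro ⟨w, h⟩
    obtain ⟨T, h1, h2⟩ := (hw w).1 h
    exact Diverges.of_reach (run_reach h1) (diverges_of_check h2)

end Machine

/-! Processes as closures: `P.res σ ρ k` is `P` with the free variables replaced according to `σ`
and the dangling indices, which start at `k`, according to `ρ`. -/

def Val.res (σ : Variable → Val) : Val → Val
  | .var x => σ x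
  | .actor A => .actor A

def Ref.res (σ : Variable → Val) (ρ : List Val) (k : ℕ) : Ref → Ref
  | .val v => .val (v.res σ)
  | .bvar i => if i < k then .bvar i else
    match ρ[i - k]? with
    | some v => .val v
    | none => .bvar i

mutual
def Expr.res (σ : Variable → Val) (ρ : List Val) (k : ℕ) : Expr → Expr
  | .field f => .field f
  | .ref r => .ref (r.res σ ρ k)
  | .new C args => .new C (Expr.resList σ ρ k args)
def Expr.resList (σ : Variable → Val) (ρ : List Val) (k : ℕ) : List Expr → List Expr
  | [] => []
  | E :: Es => E.res σ ρ k :: Expr.resList σ ρ k Es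
end

def Proc.res (σ : Variable → Val) (ρ : List Val) : ℕ → Proc → Proc
  | _, .zero => .zero
  | k, .upd f E P => .upd f (E.res σ ρ k) (P.res σ ρ k)
  | k, .letIn E P => .letIn (E.res σ ρ k) (P.res σ ρ (k + 1))
  | k, .call r m args P => .call (r.res σ ρ k) m (Expr.resList σ ρ k args) (P.res σ ρ k)
  | k, .cond E E' P Q =>
      .cond (E.res σ ρ k) (E'.res σ ρ k) (P.res σ ρ k) (Q.res σ ρ k)
  | k, .plus P Q => .plus (P.res σ ρ k) (Q.res σ ρ k)

theorem Ref.res_eq_subst (σ : Variable → Val) (k : ℕ) (r : Ref) : r.res σ [] k = r.subst σ := by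
  rcases r with (_ | _) | i <;> simp [Ref.res, Ref.subst, Val.res]

mutual
theorem Expr.res_eq_subst (σ : Variable → Val) (k : ℕ) : ∀ E : Expr, E.res σ [] k = E.subst σ
  | .field _ => rfl
  | .ref r => by rw [Expr.res, Expr.subst, Ref.res_eq_subst]
  | .new _ args => by rw [Expr.res, Expr.subst, Expr.resList_eq_subst]
theorem Expr.resList_eq_subst (σ : Variable → Val) (k : ℕ) :
    ∀ Es : List Expr, Expr.resList σ [] k Es = Expr.substList σ Es
  | [] => rfl
  | E :: Es => by
    rw [Expr.resList, Expr.substList, Expr.res_eq_subst, Expr.resList_eq_subst]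
end

theorem Proc.res_eq_subst (σ : Variable → Val) (k : ℕ) (P : Proc) :
    P.res σ [] k = P.subst σ := by
  induction P generalizing k <;>
    simp [Proc.res, Proc.subst, Expr.res_eq_subst, Expr.resList_eq_subst, Ref.res_eq_subst, *]

mutual
theorem Expr.subst_var : ∀ E : Expr, E.subst .var = E
  | .field _ => rfl
  | .ref r => by rcases r with (_ | _) | _ <;> rfl
  | .new _ args => by rw [Expr.subst, Expr.substList_var]
theorem Expr.substList_var : ∀ Es : List Expr, Expr.substList .var Es = Es
  | [] => rfl
  | E :: Es => by rw [Expr.substList, Expr.subst_var, Expr.substList_var]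
end

theorem Proc.subst_var (P : Proc) : P.subst .var = P := by
  have hr : ∀ r : Ref, r.subst .var = r := by rintro ((_ | _) | _) <;> rfl
  induction P <;> simp [Proc.subst, Expr.subst_var, Expr.substList_var, *]

/-- Instantiating the innermost bound variable amounts to pushing the value onto the environment,
which is how the machine executes `let` without rewriting code. -/
theorem Ref.inst_res (σ : Variable → Val) (ρ : List Val) (U : Val) (k : ℕ) (r : Ref) :
    (r.res σ ρ (k + 1)).inst U k = r.res σ (U :: ρ) k := by
  rcases r with v | i
  · rfl
  · rcases lt_trichotomy i k with h | rfl | h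
    · simp [Ref.res, Ref.inst, h, h.ne, h.trans (Nat.lt_succ_self k)]
    · simp [Ref.res, Ref.inst]
    · obtain ⟨j, rfl⟩ := Nat.exists_eq_add_of_lt h
      have e1 : k + j + 1 - (k + 1) = j := by omega
      have e2 : k + j + 1 - k = j + 1 := by omega
      have h1 : ¬ k + j + 1 < k + 1 := by omega
      have h2 : ¬ k + j + 1 < k := by omega
      simp only [Ref.res, h1, h2, if_false, e1, e2, List.getElem?_cons_succ]
      cases ρ[j]? with
      | none => simp only [Ref.inst]; rw [if_neg (by omega)]
      | some v => rfl

mutual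
theorem Expr.inst_res (σ : Variable → Val) (ρ : List Val) (U : Val) (k : ℕ) :
    ∀ E : Expr, (E.res σ ρ (k + 1)).inst U k = E.res σ (U :: ρ) k
  | .field _ => rfl
  | .ref r => by rw [Expr.res, Expr.inst, Ref.inst_res, Expr.res]
  | .new _ args => by rw [Expr.res, Expr.inst, Expr.instList_res, Expr.res]
theorem Expr.instList_res (σ : Variable → Val) (ρ : List Val) (U : Val) (k : ℕ) :
    ∀ Es : List Expr, Expr.instList U k (Expr.resList σ ρ (k + 1) Es) = Expr.resList σ (U :: ρ) k Es
  | [] => rfl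
  | E :: Es => by
    rw [Expr.resList, Expr.instList, Expr.inst_res, Expr.instList_res, Expr.resList]
end

theorem Proc.inst_res (σ : Variable → Val) (ρ : List Val) (U : Val) (k : ℕ) (P : Proc) :
    (P.res σ ρ (k + 1)).inst U k = P.res σ (U :: ρ) k := by
  induction P generalizing k <;>
    simp [Proc.res, Proc.inst, Expr.inst_res, Expr.instList_res, Ref.inst_res, *]

theorem Proc.noUpdate_res {σ : Variable → Val} {ρ : List Val} {k : ℕ} {P : Proc}
    (h : P.NoUpdate) : (P.res σ ρ k).NoUpdate := by
  induction P generalizing k <;> simp_all [Proc.res, Proc.NoUpdate]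

/-! Free variables after instantiation. -/

theorem Ref.fv_inst {U : Val} {k : ℕ} {r : Ref} : (r.inst U k).fv ⊆ r.fv ∪ U.fv := by
  rcases r with v | i
  · simp [Ref.inst]
  · simp only [Ref.inst]
    split_ifs <;> simp [Ref.fv]

mutual
theorem Expr.fv_inst (U : Val) (k : ℕ) : ∀ E : Expr, (E.inst U k).fv ⊆ E.fv ∪ U.fv
  | .field _ => by simp [Expr.inst, Expr.fv]
  | .ref r => by simpa [Expr.inst, Expr.fv] using Ref.fv_inst
  | .new _ args => by simpa [Expr.inst, Expr.fv] using Expr.fvList_inst U k args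
theorem Expr.fvList_inst (U : Val) (k : ℕ) :
    ∀ Es : List Expr, Expr.fvList (Expr.instList U k Es) ⊆ Expr.fvList Es ∪ U.fv
  | [] => by simp [Expr.instList, Expr.fvList]
  | E :: Es => by
    have h1 := Expr.fv_inst U k E
    have h2 := Expr.fvList_inst U k Es
    simp only [Expr.instList, Expr.fvList]
    intro x hx
    have h1 := @h1 x
    have h2 := @h2 x
    simp only [Finset.mem_union] at *
    tauto
end

theorem Proc.fv_inst (U : Val) (k : ℕ) (P : Proc) : (P.inst U k).fv ⊆ P.fv ∪ U.fv := by
  induction P generalizing k with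
  | zero => simp [Proc.inst, Proc.fv]
  | upd f E P ih =>
    intro x hx
    have h1 := @Expr.fv_inst U k E x
    have h2 := @ih k x
    simp only [Proc.inst, Proc.fv, Finset.mem_union] at *
    tauto
  | letIn E P ih =>
    intro x hx
    have h1 := @Expr.fv_inst U k E x
    have h2 := @ih (k + 1) x
    simp only [Proc.inst, Proc.fv, Finset.mem_union] at *
    tauto
  | call r m args P ih =>
    intro x hx
    have h1 := @Expr.fvList_inst U k args x
    have h2 := @ih k x
    have h3 := @Ref.fv_inst U k r x
    simp only [Proc.inst, Proc.fv, Finset.mem_union] at *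
    tauto
  | cond E E' P Q ihP ihQ =>
    intro x hx
    have h1 := @Expr.fv_inst U k E x
    have h2 := @Expr.fv_inst U k E' x
    have h3 := @ihP k x
    have h4 := @ihQ k x
    simp only [Proc.inst, Proc.fv, Finset.mem_union] at *
    tauto
  | plus P Q ihP ihQ =>
    intro x hx
    have h3 := @ihP k x
    have h4 := @ihQ k x
    simp only [Proc.inst, Proc.fv, Finset.mem_union] at *
    tauto

/-! Free variables are bounded by codes. -/

theorem Ref.le_code {x : Variable} {r : Ref} (h : x ∈ r.fv) : x ≤ r.code := by
  rcases r with (y | A) | i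
  · simp only [Ref.fv, Val.fv, Finset.mem_singleton] at h
    subst h
    exact (Nat.right_le_pair _ _).trans (Nat.right_le_pair _ _)
  · simp [Ref.fv, Val.fv] at h
  · simp [Ref.fv] at h

mutual
theorem Expr.le_code {x : Variable} : ∀ E : Expr, x ∈ E.fv → x ≤ E.code
  | .field _, h => by simp [Expr.fv] at h
  | .ref r, h => (Ref.le_code h).trans ((Nat.right_le_pair _ _).trans (Nat.le_succ _))
  | .new _ args, h => (Expr.le_codeList args h).trans ((Nat.right_le_pair _ _).trans
      ((Nat.right_le_pair _ _).trans (Nat.le_succ _)))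
theorem Expr.le_codeList {x : Variable} :
    ∀ Es : List Expr, x ∈ Expr.fvList Es → x ≤ Expr.codeList Es
  | [], h => by simp [Expr.fvList] at h
  | E :: Es, h => by
    rw [Expr.fvList, Finset.mem_union] at h
    rcases h with h | h
    · exact (Expr.le_code E h).trans ((Nat.left_le_pair _ _).trans (Nat.le_succ _))
    · exact (Expr.le_codeList Es h).trans ((Nat.right_le_pair _ _).trans (Nat.le_succ _))
end

theorem Proc.le_code {x : Variable} {P : Proc} (h : x ∈ P.fv) : x ≤ P.code := by
  have hl : ∀ {a b : ℕ}, x ≤ a → x ≤ Nat.pair a b := fun h => h.trans (Nat.left_le_pair _ _)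
  have hr : ∀ {a b : ℕ}, x ≤ b → x ≤ Nat.pair a b := fun h => h.trans (Nat.right_le_pair _ _)
  have hs : ∀ {a : ℕ}, x ≤ a → x ≤ a + 1 := fun h => h.trans (Nat.le_succ _)
  induction P with
  | zero => simp [Proc.fv] at h
  | upd f E P ih =>
    simp only [Proc.fv, Finset.mem_union] at h
    rcases h with h | h
    · exact hs (hr (hr (hl (Expr.le_code _ h))))
    · exact hs (hr (hr (hr (ih h))))
  | letIn E P ih =>
    simp only [Proc.fv, Finset.mem_union] at h
    rcases h with h | h
    · exact hs (hr (hl (Expr.le_code _ h)))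
    · exact hs (hr (hr (ih h)))
  | call r m args P ih =>
    simp only [Proc.fv, Finset.mem_union] at h
    rcases h with (h | h) | h
    · exact hs (hr (hl (Ref.le_code h)))
    · exact hs (hr (hr (hr (hl (Expr.le_codeList _ h)))))
    · exact hs (hr (hr (hr (hr (ih h)))))
  | cond E E' P Q ihP ihQ =>
    simp only [Proc.fv, Finset.mem_union] at h
    rcases h with ((h | h) | h) | h
    · exact hs (hr (hl (Expr.le_code _ h)))
    · exact hs (hr (hr (hl (Expr.le_code _ h))))
    · exact hs (hr (hr (hr (hl (ihP h)))))
    · exact hs (hr (hr (hr (hr (ihQ h)))))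
  | plus P Q ihP ihQ =>
    simp only [Proc.fv, Finset.mem_union] at h
    rcases h with h | h
    · exact hs (hr (hl (ihP h)))
    · exact hs (hr (hr (ihQ h)))

theorem encode_le_of_mem {α : Type} [Encodable α] {l : List α} {a : α} (h : a ∈ l) :
    Encodable.encode a ≤ Encodable.encode l := by
  induction l with
  | nil => simp at h
  | cons b l ih =>
    rw [Encodable.encode_list_cons]
    rcases List.mem_cons.1 h with rfl | h
    · exact (Nat.left_le_pair _ _).trans (Nat.le_succ _)
    · exact (ih h).trans ((Nat.right_le_pair _ _).trans (Nat.le_succ _))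

theorem encode_snd_le {α β : Type} [Encodable α] [Encodable β] (q : α × β) :
    Encodable.encode q.2 ≤ Encodable.encode q := Nat.right_le_pair _ _

/-- This gives a computable bound: with `N` one more than the code of the start configuration, every
variable of that configuration is below `N`. -/
theorem Config.Uses.le_encode {S : Config} {x : Variable} (h : S.Uses x) :
    x ≤ Encodable.encode S.code := by
  obtain ⟨t, ht, h⟩ := h
  have hvar : ∀ {U : Val}, U = .var x → x ≤ U.code := by
    rintro _ rfl
    exact Nat.right_le_pair _ _
  refine le_trans ?_ (encode_le_of_mem (List.mem_map_of_mem ht))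
  refine le_trans ?_ (encode_snd_le _)
  rcases h with h | ⟨e, he, h⟩ | ⟨M, hM, h⟩
  · exact (Proc.le_code h).trans (Nat.left_le_pair _ _)
  · refine le_trans ?_ ((Nat.left_le_pair _ _).trans (Nat.right_le_pair _ _))
    refine le_trans ?_ (encode_le_of_mem (List.mem_map_of_mem he))
    exact (hvar h).trans (Nat.right_le_pair _ _)
  · refine le_trans ?_ ((Nat.right_le_pair _ _).trans (Nat.right_le_pair _ _))
    refine le_trans ?_ (encode_le_of_mem (List.mem_map_of_mem hM))
    refine le_trans ?_ (Nat.right_le_pair _ _)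
    have := encode_le_of_mem (List.mem_map_of_mem (f := Val.code) h)
    exact (hvar rfl).trans this

/-! Simulation of expression evaluation by the machine. -/

namespace Machine

/-- `r` relates distinct values to distinct codes. -/
def OneOne (r : Val → ℕ → Prop) : Prop :=
  ∀ u v u' v', r u v → r u' v' → (u = u' ↔ v = v')

/-- Actor names, and the variables in `X`. -/
def Rigid (X : Set Variable) : Val → Prop
  | .var x => x ∈ X
  | .actor _ => True

/-- `r` renames values, but not the rigid ones. -/
structure Renaming (X : Set Variable) (r : Val → ℕ → Prop) : Prop where
  oneOne : OneOne r
  rigid : ∀ u, Rigid X u → r u u.code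

def stateCode (φ : State) : List (ℕ × ℕ) := φ.map fun e => (e.1, e.2.code)

/-- Every message has its own renaming. Nothing is stored between messages, so a process never
compares variables of two different messages, and the machine may identify those. -/
def MsgRel (X : Set Variable) (M : Message) (m : Msg) : Prop :=
  m.1 = M.name ∧ ∃ r, Renaming X r ∧ List.Forall₂ r M.args m.2

/-- The closure `k` represents `P₀` in the environments `σ` and `ρ`, up to the renaming `r`. -/
structure CloRel (X : Set Variable) (r : Val → ℕ → Prop) (σ : Variable → Val) (ρ : List Val)
    (P₀ : Proc) (k : Clo) : Prop where
  ren : Renaming X r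
  code : k.1 = P₀.code
  vars : ∀ x ∈ P₀.fv, r (σ x) (cloVar k x)
  env : List.Forall₂ r ρ k.2.2.2
  noUpdate : P₀.NoUpdate
  noNew : k.2.1 ≠ 0 → P₀.NoNew
  -- Start processes can put their values into the fields of new actors, and fields are represented
  -- literally; these values must therefore be rigid.
  fv : k.2.1 = 0 → ∀ x ∈ (P₀.res σ ρ 0).fv, x ∈ X

/-- The closure `k` represents the process `P`, up to a renaming. -/
def ProcRel (X : Set Variable) (P : Proc) (k : Clo) : Prop :=
  ∃ r σ ρ P₀, CloRel X r σ ρ P₀ k ∧ P = P₀.res σ ρ 0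

/-- Fields outlive messages and are read under many renamings, hence they hold rigid values,
represented by their own codes. -/
structure LocRel (X : Set Variable) (l : Local) (t : Ent) : Prop where
  proc : ProcRel X l.proc t.1
  state : t.2.1 = stateCode l.state
  rigid : ∀ e ∈ l.state, Rigid X e.2
  queue : List.Forall₂ (MsgRel X) l.queue t.2.2

def EntRel (X : Set Variable) (e : ActorName × Local) (f : ℕ × Ent) : Prop :=
  f.1 = e.1.code ∧ LocRel X e.2 f.2

abbrev Rel (X : Set Variable) : Config → Cfg → Prop := List.Forall₂ (EntRel X)

theorem Rigid.mono {X Y : Set Variable} (h : X ⊆ Y) {u : Val} (hu : Rigid X u) : Rigid Y u := by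
  cases u with
  | var x => exact h hu
  | actor A => trivial

theorem Renaming.anti {X Y : Set Variable} (h : X ⊆ Y) {r : Val → ℕ → Prop}
    (hr : Renaming Y r) : Renaming X r :=
  ⟨hr.oneOne, fun u hu => hr.rigid u (hu.mono h)⟩

theorem Renaming.eq_code {X : Set Variable} {r : Val → ℕ → Prop} (hr : Renaming X r) {u : Val}
    {v : ℕ} (h : r u v) (hu : Rigid X u) : v = u.code :=
  (hr.oneOne _ _ _ _ h (hr.rigid u hu)).1 rfl

theorem Rel.lookup {X : Set Variable} {S : Config} {T : Cfg} (h : Rel X S T) (A : ActorName) :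
    (S.lookup A = none ∧ T.lookup A.code = none) ∨
      ∃ l t, S.lookup A = some l ∧ T.lookup A.code = some t ∧ LocRel X l t := by
  induction h with
  | nil => exact Or.inl ⟨rfl, rfl⟩
  | @cons e f S T hef _ ih =>
    obtain ⟨B, l⟩ := e
    obtain ⟨b, t⟩ := f
    obtain ⟨rfl : b = B.code, hl⟩ := hef
    by_cases hAB : A = B
    · subst hAB
      exact Or.inr ⟨l, t, by simp, by simp, hl⟩
    · have h1 : (A == B) = false := by simpa using hAB
      have h2 : (A.code == B.code) = false := by
        simpa using fun hc => hAB (ActorName.code_injective hc)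
      simpa [List.lookup_cons, h1, h2] using ih

theorem Rel.put {X : Set Variable} {S : Config} {T : Cfg} (h : Rel X S T) (A : ActorName)
    {l : Local} {t : Ent} (hl : LocRel X l t) : Rel X (put S A l) (put T A.code t) := by
  induction h with
  | nil => exact .cons ⟨rfl, hl⟩ .nil
  | @cons e f S T hef hST ih =>
    obtain ⟨B, l'⟩ := e
    obtain ⟨b, t'⟩ := f
    obtain ⟨rfl : b = B.code, hl'⟩ := hef
    by_cases hAB : B = A
    · subst hAB
      simp only [_root_.put, if_true]
      exact .cons ⟨rfl, hl⟩ hST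
    · have h2 : B.code ≠ A.code := fun hc => hAB (ActorName.code_injective hc)
      simp only [_root_.put, if_neg hAB, if_neg h2]
      exact .cons ⟨rfl, hl'⟩ ih

theorem Rel.lookup_some {X : Set Variable} {S : Config} {T : Cfg} (h : Rel X S T) {A : ActorName}
    {l : Local} (hl : S.lookup A = some l) : ∃ t, T.lookup A.code = some t ∧ LocRel X l t := by
  rcases h.lookup A with h | ⟨l', t, h1, h2, h3⟩
  · simp [h.1] at hl
  · obtain rfl : l' = l := by simpa [h1] using hl
    exact ⟨t, h2, h3⟩

/-- Actor names are never renamed, so both sides use the same names and pick the same fresh one. -/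
theorem Rel.freshActor {X : Set Variable} {S : Config} {T : Cfg} (h : Rel X S T) (C : ClassName) :
    S.freshActor C = .of C (freshIdx T C) := by
  have key : ∀ i, S.lookup (.of C i) = none ↔ T.lookup (Nat.pair C i + 1) = none := by
    intro i
    rcases h.lookup (.of C i) with h | ⟨l, t, h1, h2, -⟩
    · exact ⟨fun _ => h.2, fun _ => h.1⟩
    · change T.lookup (Nat.pair C i + 1) = some t at h2
      simp [h1, h2]
  have hs := freshIdx_spec T C
  unfold Config.freshActor
  rw [IsLeast.csInf_eq (a := freshIdx T C)]
  refine ⟨(key _).2 hs.1, fun i hi => ?_⟩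
  by_contra! hlt
  exact hs.2 i hlt ((key i).1 hi)

theorem lookup_stateCode (φ : State) (f : ℕ) :
    (stateCode φ).lookup f = (φ.lookup f).map Val.code := by
  induction φ with
  | nil => rfl
  | cons e φ ih =>
    obtain ⟨g, v⟩ := e
    simp only [stateCode, List.map_cons, List.lookup_cons] at *
    cases f == g <;> simp [ih]

/-- The data that relate the evaluation of expressions in `S` and in the machine. -/
structure EvalRel (X : Set Variable) (r : Val → ℕ → Prop) (σ : Variable → Val) (ρ : List Val)
    (k : Clo) (φ : State) : Prop where
  ren : Renaming X r
  env : List.Forall₂ r ρ k.2.2.2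
  state : ∀ e ∈ φ, Rigid X e.2

theorem refVal_res {X : Set Variable} {r : Val → ℕ → Prop} {σ : Variable → Val} {ρ : List Val}
    {k : Clo} {φ : State} (h : EvalRel X r σ ρ k φ) (s : Ref)
    (hσ : ∀ x ∈ s.fv, r (σ x) (cloVar k x)) :
    (∃ U v, s.res σ ρ 0 = .val U ∧ refVal k s.code = some v ∧ r U v) ∨
      ∃ i, s.res σ ρ 0 = .bvar i ∧ refVal k s.code = none := by
  rcases s with (x | A) | i
  · refine Or.inl ⟨σ x, cloVar k x, rfl, ?_, hσ x (by simp [Ref.fv, Val.fv])⟩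
    simp [refVal, Ref.code, Val.code, eqb, valOf]
  · refine Or.inl ⟨.actor A, (Val.actor A).code, rfl, ?_, h.ren.rigid _ trivial⟩
    simp [refVal, Ref.code, Val.code, eqb, valOf]
  · have hlen := h.env.length_eq
    have hrv : refVal k (Ref.bvar i).code = k.2.2.2[i]? := by simp [refVal, Ref.code, eqb]
    by_cases hi : i < ρ.length
    · refine Or.inl ⟨ρ[i], k.2.2.2[i]'(hlen ▸ hi), ?_, ?_, ?_⟩
      · simp [Ref.res, hi]
      · rw [hrv, List.getElem?_eq_getElem]
      · exact List.forall₂_iff_get.1 h.env |>.2 i hi (hlen ▸ hi)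
    · refine Or.inr ⟨i, ?_, ?_⟩
      · simp [Ref.res, List.getElem?_eq_none (not_lt.1 hi)]
      · rw [hrv, List.getElem?_eq_none (by omega)]

theorem pushVal_cons (v : ℕ) (l : List ℕ) (s : List (List ℕ)) :
    pushVal v (l :: s) = (l ++ [v]) :: s := rfl

theorem Renaming.zip_eq {X : Set Variable} {r : Val → ℕ → Prop} (hr : Renaming X r)
    {fs : List FieldName} {Us : List Val} {vs : List ℕ} (h : List.Forall₂ r Us vs)
    (hU : ∀ U ∈ Us, Rigid X U) :
    fs.zip vs = stateCode (fs.zip Us) ∧ ∀ e ∈ fs.zip Us, Rigid X e.2 := by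
  refine ⟨?_, fun e he => hU _ (List.of_mem_zip he).2⟩
  induction h generalizing fs with
  | nil => simp [stateCode]
  | @cons U v Us vs hUv _ ih =>
    cases fs with
    | nil => simp [stateCode]
    | cons f fs =>
      have := @ih fs (fun U hU' => hU U (List.mem_cons_of_mem _ hU'))
      simp only [stateCode, List.zip_cons_cons, List.map_cons] at *
      rw [this, hr.eq_code hUv (hU U (by simp))]

theorem locRel_new {X : Set Variable} {φ : State} (h : ∀ e ∈ φ, Rigid X e.2) :
    LocRel X ⟨.zero, φ, []⟩ (emptyClo, stateCode φ, []) := by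
  refine ⟨⟨fun u v => v = u.code, .var, [], .zero, ⟨⟨?_, fun _ _ => rfl⟩, rfl, ?_, .nil, trivial,
    fun _ => trivial, ?_⟩, rfl⟩, rfl, h, .nil⟩
  · rintro u _ u' _ rfl rfl
    exact Val.code_injective.eq_iff.symm
  · simp [Proc.fv]
  · simp [Proc.fv, Proc.res]

section

variable {p : Program} {X : Set Variable} {r : Val → ℕ → Prop} {σ : Variable → Val}
  {ρ : List Val} {k : Clo} {φ : State}

/-- Within `b` steps, the machine turns the task `task` and the configuration `T` into the values
`vs`, which represent the values `Us`, and a configuration that represents `S'`. -/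
def Evaluates (p : Program) (X : Set Variable) (r : Val → ℕ → Prop) (k : Clo) (φ : State)
    (task : ℕ × ℕ) (T : Cfg) (b : ℕ) (Us : List Val) (S' : Config) : Prop :=
  ∃ vs T' n, n ≤ b ∧ List.Forall₂ r Us vs ∧ (k.2.1 = 0 → ∀ U ∈ Us, Rigid X U) ∧ Rel X S' T' ∧
    -- Arbitrary remaining fuel, tasks and frames make evaluations composable.
    ∀ j ts fr frs, evalSteps p.fieldTable (stateCode φ) k (n + j) (task :: ts, fr :: frs, T) =
      evalSteps p.fieldTable (stateCode φ) k j (ts, (fr ++ vs) :: frs, T')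

/-- Within `b` steps, the machine fails on the task `task` and the configuration `T`. -/
def Fails (p : Program) (k : Clo) (φ : State) (task : ℕ × ℕ) (T : Cfg) (b : ℕ) : Prop :=
  ∃ n, n ≤ b ∧ ∀ j ts fr frs, evalSteps p.fieldTable (stateCode φ) k (n + j)
    (task :: ts, fr :: frs, T) = none

theorem evalStep_expr (F : Fields) (φ : List (ℕ × ℕ)) (k : Clo) (e : ℕ) (ts : List (ℕ × ℕ))
    (s : List (List ℕ)) (T : Cfg) :
    evalStep F φ k ((0, e + 1) :: ts, s, T) = evalExprStep φ k e (ts, s, T) := by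
  simp [evalStep, eqb]

theorem evalStep_list_nil (F : Fields) (φ : List (ℕ × ℕ)) (k : Clo) (ts : List (ℕ × ℕ))
    (s : List (List ℕ)) (T : Cfg) :
    evalStep F φ k ((1, 0) :: ts, s, T) = some (ts, s, T) := by
  simp [evalStep, eqb]

theorem evalStep_list_cons (F : Fields) (φ : List (ℕ × ℕ)) (k : Clo) (a b : ℕ)
    (ts : List (ℕ × ℕ)) (s : List (List ℕ)) (T : Cfg) :
    evalStep F φ k ((1, Nat.pair a b + 1) :: ts, s, T) = some ((0, a) :: (1, b) :: ts, s, T) := by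
  simp [evalStep, eqb]

theorem evalStep_build {F : Fields} {φ : List (ℕ × ℕ)} {k : Clo} (hk : k.2.1 = 0) (C : ℕ)
    (ts : List (ℕ × ℕ)) (s : List (List ℕ)) (T : Cfg) :
    evalStep F φ k ((2, C) :: ts, s, T) = build F C (ts, s, T) := by
  simp [evalStep, eqb, hk]

/-- The budget of a creation: `2 * L + 1` steps for its arguments, one to open the frame and one to
build the actor. -/
theorem code_le_of_new (C L : ℕ) : 2 * L + 3 ≤ 2 * (Nat.pair 2 (Nat.pair C L) + 1) - 1 := by
  have h1 := Nat.add_le_pair 2 (Nat.pair C L)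
  have h2 := Nat.add_le_pair C L
  omega

-- Both evaluations succeed with related results or both fail. The dichotomy is what allows the
-- simulation to be used in either direction, and the step bounds match the fuel of `eval`.
mutual
theorem expr_sim (h : EvalRel X r σ ρ k φ) : ∀ (E : Expr),
    (∀ x ∈ E.fv, r (σ x) (cloVar k x)) → (k.2.1 ≠ 0 → E.NoNew) →
    (k.2.1 = 0 → ∀ x ∈ (E.res σ ρ 0).fv, x ∈ X) → ∀ (S : Config) (T : Cfg), Rel X S T →
    (∃ U S', (E.res σ ρ 0).eval p φ S = some (U, S') ∧
      Evaluates p X r k φ (0, E.code) T (2 * E.code - 1) [U] S') ∨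
    ((E.res σ ρ 0).eval p φ S = none ∧ Fails p k φ (0, E.code) T (2 * E.code - 1))
  | .field f => by
    intro _ _ _ S T hST
    have hb : 1 ≤ 2 * (Expr.field f).code - 1 := by simp only [Expr.code]; omega
    have hstep : ∀ ts fr frs, evalStep p.fieldTable (stateCode φ) k
        ((0, (Expr.field f).code) :: ts, fr :: frs, T) =
        ((φ.lookup f).map Val.code).map fun v => (ts, (fr ++ [v]) :: frs, T) := by
      intro ts fr frs
      rw [Expr.code, evalStep_expr, ← lookup_stateCode]
      simp [evalExprStep, eqb, pushVal_cons]
    cases hf : φ.lookup f with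
    | none =>
      refine Or.inr ⟨by simp [Expr.res, Expr.eval, hf], 1, hb, fun j ts fr frs => ?_⟩
      rw [add_comm, evalSteps_succ, hstep, hf]
      rfl
    | some U =>
      have hU := h.state _ (mem_of_lookup hf)
      refine Or.inl ⟨U, S, by simp [Expr.res, Expr.eval, hf], [U.code], T, 1, hb,
        .cons (h.ren.rigid U hU) .nil, fun _ => by simpa using hU, hST, fun j ts fr frs => ?_⟩
      rw [add_comm, evalSteps_succ, hstep, hf]
      rfl
  | .ref s => by
    intro hσ _ hX S T hST
    have hb : 1 ≤ 2 * (Expr.ref s).code - 1 := by simp only [Expr.code]; omega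
    have hstep : ∀ ts fr frs, evalStep p.fieldTable (stateCode φ) k
        ((0, (Expr.ref s).code) :: ts, fr :: frs, T) =
        (refVal k s.code).map fun v => (ts, (fr ++ [v]) :: frs, T) := by
      intro ts fr frs
      rw [Expr.code, evalStep_expr]
      simp [evalExprStep, eqb, pushVal_cons]
    rcases refVal_res h s hσ with ⟨U, v, h1, h2, h3⟩ | ⟨i, h1, h2⟩
    · refine Or.inl ⟨U, S, by simp [Expr.res, Expr.eval, h1], [v], T, 1, hb, .cons h3 .nil, ?_,
        hST, fun j ts fr frs => ?_⟩
      · intro hk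
        have := hX hk
        simp only [Expr.res, h1, Expr.fv, Ref.fv] at this
        cases U <;> simp_all [Rigid, Val.fv]
      · rw [add_comm, evalSteps_succ, hstep, h2]
        rfl
    · refine Or.inr ⟨by simp [Expr.res, Expr.eval, h1], 1, hb, fun j ts fr frs => ?_⟩
      rw [add_comm, evalSteps_succ, hstep, h2]
      rfl
  | .new C args => by
    intro hσ hnew hX S T hST
    have hk : k.2.1 = 0 := by
      by_contra hk
      exact hnew hk
    have hb := code_le_of_new C (Expr.codeList args)
    have hstep : ∀ ts s T, evalStep p.fieldTable (stateCode φ) k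
        ((0, (Expr.new C args).code) :: ts, s, T) =
        some ((1, Expr.codeList args) :: (2, C) :: ts, [] :: s, T) := by
      intro ts s T
      rw [Expr.code, evalStep_expr]
      simp [evalExprStep, eqb, hk]
    rcases exprList_sim h args hσ (fun hk' => absurd hk hk') hX S T hST with
      ⟨Us, S', h1, vs, T', n, hn, hUv, hU, hST', hrun⟩ | ⟨h1, n, hn, hrun⟩
    · have hlen := hUv.length_eq
      by_cases hC : Us.length = (p.fields C).length
      · obtain ⟨hz, hz'⟩ := h.ren.zip_eq (fs := p.fields C) hUv (hU hk)
        refine Or.inl ⟨.actor (S'.freshActor C), _, by simp [Expr.res, Expr.eval, h1, hC],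
          [(Val.actor (S'.freshActor C)).code],
          put T' (S'.freshActor C).code (emptyClo, stateCode ((p.fields C).zip Us), []),
          n + 2, by rw [Expr.code]; omega, .cons (h.ren.rigid _ trivial) .nil, by simp [Rigid],
          hST'.put _ (locRel_new hz'), fun j ts fr frs => ?_⟩
        rw [show n + 2 + j = (n + (j + 1)) + 1 by omega, evalSteps_succ, hstep, Option.bind_some,
          hrun, evalSteps_succ, evalStep_build hk]
        have hC' : vs.length = (fieldsOf p.fieldTable C).length := hlen.symm.trans hC
        simp only [build, List.nil_append, List.head?_cons, Option.getD_some, List.tail_cons, eqb,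
          hC', decide_true, cond_true, Option.bind_some, pushVal_cons, hST'.freshActor C,
          Val.code, ActorName.code]
        rw [← hz]
        rfl
      · refine Or.inr ⟨by simp [Expr.res, Expr.eval, h1, hC], n + 2, by rw [Expr.code]; omega,
          fun j ts fr frs => ?_⟩
        rw [show n + 2 + j = (n + (j + 1)) + 1 by omega, evalSteps_succ, hstep, Option.bind_some,
          hrun, evalSteps_succ, evalStep_build hk]
        have hC' : ¬ vs.length = (fieldsOf p.fieldTable C).length := fun hc => hC (hlen.trans hc)
        simp [build, eqb, hC']
    · refine Or.inr ⟨by simp [Expr.res, Expr.eval, h1], n + 1, by rw [Expr.code]; omega,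
        fun j ts fr frs => ?_⟩
      rw [show n + 1 + j = (n + j) + 1 by omega, evalSteps_succ, hstep, Option.bind_some, hrun]
theorem exprList_sim (h : EvalRel X r σ ρ k φ) : ∀ (Es : List Expr),
    (∀ x ∈ Expr.fvList Es, r (σ x) (cloVar k x)) → (k.2.1 ≠ 0 → ∀ E ∈ Es, E.NoNew) →
    (k.2.1 = 0 → ∀ x ∈ Expr.fvList (Expr.resList σ ρ 0 Es), x ∈ X) →
    ∀ (S : Config) (T : Cfg), Rel X S T →
    (∃ Us S', Expr.evalList p φ S (Expr.resList σ ρ 0 Es) = some (Us, S') ∧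
      Evaluates p X r k φ (1, Expr.codeList Es) T (2 * Expr.codeList Es + 1) Us S') ∨
    (Expr.evalList p φ S (Expr.resList σ ρ 0 Es) = none ∧
      Fails p k φ (1, Expr.codeList Es) T (2 * Expr.codeList Es + 1))
  | [] => by
    intro _ _ _ S T hST
    refine Or.inl ⟨[], S, by simp [Expr.resList, Expr.evalList], [], T, 1, by omega, .nil,
      by simp, hST, fun j ts fr frs => ?_⟩
    rw [add_comm, evalSteps_succ, Expr.codeList, evalStep_list_nil, List.append_nil]
    rfl
  | E :: Es => by
    intro hσ hnew hX S T hST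
    simp only [Expr.fvList, Finset.mem_union] at hσ
    simp only [Expr.resList, Expr.fvList, Finset.mem_union] at hX
    have hb := Nat.add_le_pair E.code (Expr.codeList Es)
    have hpos : 0 < E.code := by cases E <;> simp [Expr.code]
    rcases expr_sim h E (fun x hx => hσ x (Or.inl hx)) (fun hk => hnew hk E (by simp))
      (fun hk x hx => hX hk x (Or.inl hx)) S T hST with
      ⟨U, S', h1, vs, T', n, hn, hUv, hU, hST', hrun⟩ | ⟨h1, n, hn, hrun⟩
    · rcases exprList_sim h Es (fun x hx => hσ x (Or.inr hx))
        (fun hk E hE => hnew hk E (List.mem_cons_of_mem _ hE))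
        (fun hk x hx => hX hk x (Or.inr hx)) S' T' hST' with
        ⟨Us, S'', h2, ws, T'', n', hn', hUw, hUs, hST'', hrun'⟩ | ⟨h2, n', hn', hrun'⟩
      · refine Or.inl ⟨U :: Us, S'', by simp [Expr.resList, Expr.evalList, h1, h2], vs ++ ws, T'',
          n + n' + 1, by rw [Expr.codeList]; omega, List.rel_append hUv hUw, ?_, hST'',
          fun j ts fr frs => ?_⟩
        · intro hk V hV
          rcases List.mem_cons.1 hV with rfl | hV
          · exact hU hk _ (by simp)
          · exact hUs hk _ hV
        · rw [show n + n' + 1 + j = (n + (n' + j)) + 1 by omega, evalSteps_succ, Expr.codeList,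
            evalStep_list_cons, Option.bind_some, hrun, hrun', List.append_assoc]
      · refine Or.inr ⟨by simp [Expr.resList, Expr.evalList, h1, h2], n + n' + 1,
          by rw [Expr.codeList]; omega, fun j ts fr frs => ?_⟩
        rw [show n + n' + 1 + j = (n + (n' + j)) + 1 by omega, evalSteps_succ, Expr.codeList,
          evalStep_list_cons, Option.bind_some, hrun, hrun']
    · refine Or.inr ⟨by simp [Expr.resList, Expr.evalList, h1], n + 1,
        by rw [Expr.codeList]; omega, fun j ts fr frs => ?_⟩
      rw [show n + 1 + j = (n + j) + 1 by omega, evalSteps_succ, Expr.codeList,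
        evalStep_list_cons, Option.bind_some, hrun]
end

theorem evalSteps_idle (F : Fields) (φ : List (ℕ × ℕ)) (k : Clo) (n : ℕ) (s : List (List ℕ))
    (T : Cfg) : evalSteps F φ k n ([], s, T) = some ([], s, T) := by
  induction n with
  | zero => rfl
  | succ n ih =>
    rw [evalSteps_succ, show evalStep F φ k ([], s, T) = some ([], s, T) by simp [evalStep, eqb]]
    exact ih

theorem Evaluates.eval {tag e b : ℕ} {T : Cfg} {Us : List Val} {S' : Config}
    (h : Evaluates p X r k φ (tag, e) T b Us S') (hb : b ≤ 2 * e + 1) :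
    ∃ vs T', Machine.eval p.fieldTable (stateCode φ) k T tag e = some (vs, T') ∧
      List.Forall₂ r Us vs ∧ (k.2.1 = 0 → ∀ U ∈ Us, Rigid X U) ∧ Rel X S' T' := by
  obtain ⟨vs, T', n, hn, h1, h2, h3, hrun⟩ := h
  refine ⟨vs, T', ?_, h1, h2, h3⟩
  unfold Machine.eval
  rw [show 2 * e + 1 = n + (2 * e + 1 - n) by omega, hrun, evalSteps_idle]
  simp [eqb]

theorem Fails.eval {tag e b : ℕ} {T : Cfg} (h : Fails p k φ (tag, e) T b) (hb : b ≤ 2 * e + 1) :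
    Machine.eval p.fieldTable (stateCode φ) k T tag e = none := by
  obtain ⟨n, hn, hrun⟩ := h
  unfold Machine.eval
  rw [show 2 * e + 1 = n + (2 * e + 1 - n) by omega, hrun, Option.bind_none]

end

end Machine

/-! Simulation of the steps of a process by the machine. -/

theorem put_put {α β : Type} [DecidableEq α] (l : List (α × β)) (a : α) (b b' : β) :
    put (put l a b) a b' = put l a b' := by
  induction l with
  | nil => simp [put]
  | cons e l ih => by_cases h : e.1 = a <;> simp [put, h, ih]

theorem ActorName.code_surjective : Function.Surjective ActorName.code := by
  rintro (_ | n)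
  · exact ⟨.root, rfl⟩
  · exact ⟨.of n.unpair.1 n.unpair.2, by simp [ActorName.code]⟩

theorem Expr.length_evalList {p : Program} {φ : State} {Es : List Expr} {S S' : Config}
    {Us : List Val} (h : Expr.evalList p φ S Es = some (Us, S')) : Us.length = Es.length := by
  induction Es generalizing S S' Us with
  | nil =>
    simp only [Expr.evalList, Option.some.injEq, Prod.mk.injEq] at h
    rw [← h.1]
    rfl
  | cons E Es ih =>
    rw [Expr.evalList] at h
    split at h
    · cases h
    · split at h
      · cases h
      · next h' =>
        simp only [Option.some.injEq, Prod.mk.injEq] at h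
        rw [← h.1, List.length_cons, List.length_cons, ih h']

namespace Machine

section

variable {p : Program} {X : Set Variable} {r : Val → ℕ → Prop} {σ : Variable → Val}
  {ρ : List Val} {k : Clo} {φ : State} {q : List Message} {q' : List Msg} {S : Config} {T : Cfg}

theorem eval_expr_cases (h : EvalRel X r σ ρ k φ) (E : Expr)
    (hσ : ∀ x ∈ E.fv, r (σ x) (cloVar k x)) (hn : k.2.1 ≠ 0 → E.NoNew)
    (hX : k.2.1 = 0 → ∀ x ∈ (E.res σ ρ 0).fv, x ∈ X) (hST : Rel X S T) :
    (∃ U S' v T', (E.res σ ρ 0).eval p φ S = some (U, S') ∧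
      eval p.fieldTable (stateCode φ) k T 0 E.code = some ([v], T') ∧ r U v ∧
      (k.2.1 = 0 → Rigid X U) ∧ Rel X S' T') ∨
    ((E.res σ ρ 0).eval p φ S = none ∧
      eval p.fieldTable (stateCode φ) k T 0 E.code = none) := by
  rcases expr_sim (p := p) h E hσ hn hX S T hST with ⟨U, S', h1, h2⟩ | ⟨h1, h2⟩
  · obtain ⟨vs, T', h3, h4, h5, h6⟩ := h2.eval (by omega)
    obtain ⟨v, _, hv, hnil, rfl⟩ := List.forall₂_cons_left_iff.1 h4
    obtain rfl := List.forall₂_nil_left_iff.1 hnil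
    exact Or.inl ⟨U, S', v, T', h1, h3, hv, fun hk => h5 hk U (by simp), h6⟩
  · exact Or.inr ⟨h1, h2.eval (by omega)⟩

theorem eval_list_cases (h : EvalRel X r σ ρ k φ) (Es : List Expr)
    (hσ : ∀ x ∈ Expr.fvList Es, r (σ x) (cloVar k x)) (hn : k.2.1 ≠ 0 → ∀ E ∈ Es, E.NoNew)
    (hX : k.2.1 = 0 → ∀ x ∈ Expr.fvList (Expr.resList σ ρ 0 Es), x ∈ X) (hST : Rel X S T) :
    (∃ Us S' vs T', Expr.evalList p φ S (Expr.resList σ ρ 0 Es) = some (Us, S') ∧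
      eval p.fieldTable (stateCode φ) k T 1 (Expr.codeList Es) = some (vs, T') ∧
      List.Forall₂ r Us vs ∧ Rel X S' T') ∨
    (Expr.evalList p φ S (Expr.resList σ ρ 0 Es) = none ∧
      eval p.fieldTable (stateCode φ) k T 1 (Expr.codeList Es) = none) := by
  rcases exprList_sim (p := p) h Es hσ hn hX S T hST with ⟨Us, S', h1, h2⟩ | ⟨h1, h2⟩
  · obtain ⟨vs, T', h3, h4, h5, h6⟩ := h2.eval le_rfl
    exact Or.inl ⟨Us, S', vs, T', h1, h3, h4, h6⟩
  · exact Or.inr ⟨h1, h2.eval le_rfl⟩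

theorem CloRel.evalRel {P₀ : Proc} (h : CloRel X r σ ρ P₀ k) (hφ : ∀ e ∈ φ, Rigid X e.2) :
    EvalRel X r σ ρ k φ := ⟨h.ren, h.env, hφ⟩

theorem let_sim {E : Expr} {P : Proc} (h : CloRel X r σ ρ (.letIn E P) k)
    (hφ : ∀ e ∈ φ, Rigid X e.2) (hq : List.Forall₂ (MsgRel X) q q') (hST : Rel X S T)
    (A : ActorName) :
    (∃ U S' k' T', (E.res σ ρ 0).eval p φ S = some (U, S') ∧
      (∀ c, core p.fieldTable (stateCode φ) T k c = some (k', T', [])) ∧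
      Rel X (put S' A ⟨(P.res σ ρ 1).inst U 0, φ, q⟩) (put T' A.code (k', stateCode φ, q'))) ∨
    ((E.res σ ρ 0).eval p φ S = none ∧ ∀ c, core p.fieldTable (stateCode φ) T k c = none) := by
  have hcode := h.code
  have hvars := h.vars
  have hfv := h.fv
  simp only [Proc.fv, Finset.mem_union] at hvars
  simp only [Proc.res, Proc.fv, Finset.mem_union] at hfv
  have hcore : ∀ c, core p.fieldTable (stateCode φ) T k c =
      (eval p.fieldTable (stateCode φ) k T 0 E.code).map fun r =>
        ((P.code, k.2.1, k.2.2.1, r.1.head?.getD 0 :: k.2.2.2), r.2, []) := by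
    intro c
    simp [core, hcode, Proc.code, eqb, letStep]
  rcases eval_expr_cases (p := p) (h.evalRel hφ) E (fun x hx => hvars x (Or.inl hx))
    (fun hk => (h.noNew hk).1) (fun hk x hx => hfv hk x (Or.inl hx)) hST with
    ⟨U, S', v, T', h1, h2, h3, h4, h5⟩ | ⟨h1, h2⟩
  · refine Or.inl ⟨U, S', _, T', h1, fun c => by rw [hcore, h2]; rfl, h5.put A ⟨?_, rfl, hφ, hq⟩⟩
    refine ⟨r, σ, U :: ρ, P, ⟨h.ren, rfl, fun x hx => hvars x (Or.inr hx), .cons h3 h.env,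
      h.noUpdate, fun hk => (h.noNew hk).2, fun hk x hx => ?_⟩, Proc.inst_res _ _ _ _ _⟩
    rw [← Proc.inst_res] at hx
    rcases Finset.mem_union.1 (Proc.fv_inst _ _ _ hx) with hx | hx
    · exact hfv hk x (Or.inr hx)
    · have := h4 hk
      cases U <;> simp_all [Rigid, Val.fv]
  · exact Or.inr ⟨h1, fun c => by rw [hcore, h2]; rfl⟩

theorem cond_sim {E E' : Expr} {P Q : Proc} (h : CloRel X r σ ρ (.cond E E' P Q) k)
    (hφ : ∀ e ∈ φ, Rigid X e.2) (hq : List.Forall₂ (MsgRel X) q q') (hST : Rel X S T)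
    (A : ActorName) :
    (∃ U V S' k' T', Expr.evalList p φ S [E.res σ ρ 0, E'.res σ ρ 0] = some ([U, V], S') ∧
      (∀ c, core p.fieldTable (stateCode φ) T k c = some (k', T', [])) ∧
      Rel X (put S' A ⟨if U = V then P.res σ ρ 0 else Q.res σ ρ 0, φ, q⟩)
        (put T' A.code (k', stateCode φ, q'))) ∨
    (Expr.evalList p φ S [E.res σ ρ 0, E'.res σ ρ 0] = none ∧
      ∀ c, core p.fieldTable (stateCode φ) T k c = none) := by
  have hcode := h.code
  have hvars := h.vars
  have hfv := h.fv
  simp only [Proc.fv, Finset.mem_union] at hvars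
  simp only [Proc.res, Proc.fv, Finset.mem_union] at hfv
  have hcore : ∀ c, core p.fieldTable (stateCode φ) T k c =
      (eval p.fieldTable (stateCode φ) k T 1 (Expr.codeList [E, E'])).map fun r =>
        ((bif eqb r.1[0]? r.1[1]? then P.code else Q.code, k.2), r.2, []) := by
    intro c
    simp [core, hcode, Proc.code, eqb, condStep, Expr.codeList]
  rcases eval_list_cases (p := p) (h.evalRel hφ) [E, E']
    (fun x hx => hvars x (by simp [Expr.fvList] at hx; tauto))
    (fun hk => by simpa using ⟨(h.noNew hk).1, (h.noNew hk).2.1⟩)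
    (fun hk x hx => hfv hk x (by simp [Expr.resList, Expr.fvList] at hx; tauto)) hST with
    ⟨Us, S', vs, T', h1, h2, h3, h4⟩ | ⟨h1, h2⟩
  · have hlen : Us.length = 2 := Expr.length_evalList h1
    obtain ⟨U, V, rfl⟩ := List.length_eq_two.1 hlen
    obtain ⟨u, _, hu, htl, rfl⟩ := List.forall₂_cons_left_iff.1 h3
    obtain ⟨v, _, hv, hnil, rfl⟩ := List.forall₂_cons_left_iff.1 htl
    obtain rfl := List.forall₂_nil_left_iff.1 hnil
    have hiff := h.ren.oneOne _ _ _ _ hu hv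
    refine Or.inl ⟨U, V, S', _, T', h1, fun c => by rw [hcore, h2]; rfl,
      h4.put A ⟨?_, rfl, hφ, hq⟩⟩
    by_cases hUV : U = V
    · have huv := hiff.1 hUV
      refine ⟨r, σ, ρ, P, ⟨h.ren, by simp [eqb, huv], fun x hx => hvars x (by tauto), h.env,
        h.noUpdate.1, fun hk => (h.noNew hk).2.2.1, fun hk x hx => hfv hk x (by tauto)⟩,
        by simp [hUV]⟩
    · have huv : ¬ u = v := fun hc => hUV (hiff.2 hc)
      refine ⟨r, σ, ρ, Q, ⟨h.ren, by simp [eqb, huv], fun x hx => hvars x (by tauto), h.env,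
        h.noUpdate.2, fun hk => (h.noNew hk).2.2.2, fun hk x hx => hfv hk x (by tauto)⟩,
        by simp [hUV]⟩
  · exact Or.inr ⟨h1, fun c => by rw [hcore, h2]; rfl⟩

theorem plus_sim {P Q : Proc} (h : CloRel X r σ ρ (.plus P Q) k)
    (hφ : ∀ e ∈ φ, Rigid X e.2) (hq : List.Forall₂ (MsgRel X) q q') (hST : Rel X S T)
    (A : ActorName) (c : ℕ) :
    ∃ k', core p.fieldTable (stateCode φ) T k c = some (k', T, []) ∧
      Rel X (put S A ⟨if c = 0 then P.res σ ρ 0 else Q.res σ ρ 0, φ, q⟩)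
        (put T A.code (k', stateCode φ, q')) := by
  have hcode := h.code
  have hvars := h.vars
  have hfv := h.fv
  simp only [Proc.fv, Finset.mem_union] at hvars
  simp only [Proc.res, Proc.fv, Finset.mem_union] at hfv
  refine ⟨(if c = 0 then P.code else Q.code, k.2), ?_, hST.put A ⟨?_, rfl, hφ, hq⟩⟩
  · by_cases hc : c = 0 <;> simp [core, hcode, Proc.code, eqb, hc]
  · by_cases hc : c = 0
    · exact ⟨r, σ, ρ, P, ⟨h.ren, by simp [hc], fun x hx => hvars x (by tauto), h.env,
        h.noUpdate.1, fun hk => (h.noNew hk).1, fun hk x hx => hfv hk x (by tauto)⟩,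
        by simp [hc]⟩
    · exact ⟨r, σ, ρ, Q, ⟨h.ren, by simp [hc], fun x hx => hvars x (by tauto), h.env,
        h.noUpdate.2, fun hk => (h.noNew hk).2, fun hk x hx => hfv hk x (by tauto)⟩,
        by simp [hc]⟩

theorem call_sim {s : Ref} {m : MethodName} {Es : List Expr} {P : Proc}
    (h : CloRel X r σ ρ (.call s m Es P) k) (hφ : ∀ e ∈ φ, Rigid X e.2) (hST : Rel X S T) :
    (∃ B Us S' k' T' vs, s.res σ ρ 0 = .val (.actor B) ∧
      Expr.evalList p φ S (Expr.resList σ ρ 0 Es) = some (Us, S') ∧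
      (∀ c, core p.fieldTable (stateCode φ) T k c = some (k', T', [(B.code, (m, vs))])) ∧
      Rel X S' T' ∧ Extends T T' ∧ ProcRel X (P.res σ ρ 0) k' ∧ MsgRel X ⟨m, Us⟩ (m, vs)) ∨
    ((∀ B Us S', s.res σ ρ 0 = .val (.actor B) →
      Expr.evalList p φ S (Expr.resList σ ρ 0 Es) ≠ some (Us, S')) ∧
      ∀ c, core p.fieldTable (stateCode φ) T k c = none) := by
  have hcode := h.code
  have hvars := h.vars
  have hfv := h.fv
  simp only [Proc.fv, Finset.mem_union] at hvars
  simp only [Proc.res, Proc.fv, Finset.mem_union] at hfv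
  have hcore : ∀ c, core p.fieldTable (stateCode φ) T k c =
      (refVal k s.code).bind fun v =>
        bif eqb v.unpair.1 1 then
          (eval p.fieldTable (stateCode φ) k T 1 (Expr.codeList Es)).map fun r =>
            ((P.code, k.2), r.2, [(v.unpair.2, m, r.1)])
        else none := by
    intro c
    simp [core, hcode, Proc.code, eqb, callStep]
  rcases refVal_res (h.evalRel hφ) s (fun x hx => hvars x (by tauto)) with
    ⟨U, v, h1, h2, h3⟩ | ⟨i, h1, h2⟩
  swap
  · exact Or.inr ⟨fun B Us S' hB => by simp [h1] at hB, fun c => by rw [hcore, h2]; rfl⟩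
  cases U with
  | var x =>
    refine Or.inr ⟨fun B Us S' hB => by simp [h1] at hB, fun c => ?_⟩
    -- A variable is never represented by the code of an actor name: names are rigid and the
    -- renaming is one-to-one.
    have hv : v.unpair.1 ≠ 1 := by
      intro hv
      obtain ⟨B, hB⟩ := ActorName.code_surjective v.unpair.2
      have hvB : v = (Val.actor B).code := by
        rw [Val.code, hB, ← hv, Nat.pair_unpair]
      simpa using (h.ren.oneOne _ _ _ _ h3 (h.ren.rigid (.actor B) trivial)).2 hvB
    simp [hcore, h2, eqb, hv]
  | actor B =>
    have hv : v = Nat.pair 1 B.code := h.ren.eq_code h3 trivial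
    rcases eval_list_cases (p := p) (h.evalRel hφ) Es (fun x hx => hvars x (by tauto))
      (fun hk => (h.noNew hk).1) (fun hk x hx => hfv hk x (by tauto)) hST with
      ⟨Us, S', vs, T', h4, h5, h6, h7⟩ | ⟨h4, h5⟩
    · refine Or.inl ⟨B, Us, S', (P.code, k.2), T', vs, h1, h4, fun c => ?_, h7, eval_extends h5,
        ⟨r, σ, ρ, P, ⟨h.ren, rfl, fun x hx => hvars x (by tauto), h.env, h.noUpdate,
          fun hk => (h.noNew hk).2, fun hk x hx => hfv hk x (by tauto)⟩, rfl⟩,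
        rfl, r, h.ren, h6⟩
      simp [hcore, h2, hv, eqb, h5]
    · refine Or.inr ⟨fun B Us S' _ => by simp [h4], fun c => ?_⟩
      simp [hcore, h2, hv, eqb, h5]

theorem send_self {A : ActorName} {P : Proc} {M : Message} {m : Msg} (hST : Rel X S T)
    (hP : ProcRel X P k) (hφ : ∀ e ∈ φ, Rigid X e.2) (hq : List.Forall₂ (MsgRel X) q q')
    (hM : MsgRel X M m) :
    Rel X (put S A ⟨P, φ, q ++ [M]⟩)
      (send (put T A.code (k, stateCode φ, q')) (A.code, m)) := by
  have : send (put T A.code (k, stateCode φ, q')) (A.code, m) =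
      put T A.code (k, stateCode φ, q' ++ [m]) := by
    simp [send, lookup_put, put_put]
  rw [this]
  exact hST.put A ⟨hP, rfl, hφ, List.rel_append hq (.cons hM .nil)⟩

theorem send_other {A B : ActorName} {P : Proc} {M : Message} {m : Msg} {l : Local} {t : Ent}
    (hAB : A ≠ B) (hST : Rel X S T) (hP : ProcRel X P k) (hφ : ∀ e ∈ φ, Rigid X e.2)
    (hq : List.Forall₂ (MsgRel X) q q') (hB : T.lookup B.code = some t) (hl : LocRel X l t)
    (hM : MsgRel X M m) :
    Rel X (put (put S A ⟨P, φ, q⟩) B ⟨l.proc, l.state, l.queue ++ [M]⟩)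
      (send (put T A.code (k, stateCode φ, q')) (B.code, m)) := by
  have hne : B.code ≠ A.code := fun hc => hAB (ActorName.code_injective hc).symm
  have : send (put T A.code (k, stateCode φ, q')) (B.code, m) =
      put (put T A.code (k, stateCode φ, q')) B.code (t.1, t.2.1, t.2.2 ++ [m]) := by
    simp [send, lookup_put, hne, hB]
  rw [this]
  exact (hST.put A ⟨hP, rfl, hφ, hq⟩).put B
    ⟨hl.proc, hl.state, hl.rigid, List.rel_append hl.queue (.cons hM .nil)⟩

end

end Machine

/-! Simulation of the start of a method by the machine. -/

theorem Config.uses_of_lookup {S : Config} {A : ActorName} {l : Local} (h : S.lookup A = some l)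
    {x : Variable} (hx : x ∈ l.proc.fv ∨ (∃ e ∈ l.state, e.2 = .var x) ∨
      ∃ M ∈ l.queue, .var x ∈ M.args) : S.Uses x :=
  ⟨(A, l), Machine.mem_of_lookup h, hx⟩

theorem Config.infinite_fresh (S : Config) :
    {x : Variable | x ≠ thisVar ∧ ¬ S.Uses x}.Infinite := by
  refine Set.infinite_of_forall_exists_gt fun (a : ℕ) => ?_
  have hlt : a < a + Encodable.encode S.code + 1 := by omega
  refine ⟨a + Encodable.encode S.code + 1, ⟨by simp [thisVar], fun h => ?_⟩, hlt⟩
  have : a + Encodable.encode S.code + 1 ≤ Encodable.encode S.code := h.le_encode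
  omega

theorem Config.freshVars_spec (S : Config) (n : ℕ) :
    (S.freshVars n).length = n ∧ (S.freshVars n).Nodup ∧ ∀ y ∈ S.freshVars n, ¬ S.Uses y := by
  refine ⟨by simp [Config.freshVars], ?_, ?_⟩
  · exact (List.nodup_range).map (Nat.nth_injective S.infinite_fresh)
  · intro y hy
    obtain ⟨i, -, rfl⟩ := List.mem_map.1 hy
    exact (Nat.nth_mem_of_infinite S.infinite_fresh i).2

theorem fst_eq_iff_snd_eq_of_mem_zip {α β : Type} {l : List α} {l' : List β} (h : l.Nodup)
    (h' : l'.Nodup) {a c : α} {b d : β} (hab : (a, b) ∈ l.zip l') (hcd : (c, d) ∈ l.zip l') :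
    a = c ↔ b = d := by
  obtain ⟨i, hi, hab⟩ := List.mem_iff_getElem.1 hab
  obtain ⟨j, hj, hcd⟩ := List.mem_iff_getElem.1 hcd
  simp only [List.getElem_zip, Prod.mk.injEq] at hab hcd
  rw [← hab.1, ← hab.2, ← hcd.1, ← hcd.2, h.getElem_inj_iff, h'.getElem_inj_iff]

theorem lookup_zip_isSome {α β : Type} [DecidableEq α] {l : List α} {l' : List β}
    (h : l.length = l'.length) {a : α} (ha : a ∈ l) : ∃ b, (l.zip l').lookup a = some b := by
  refine Option.isSome_iff_exists.1 ((isSome_lookup_iff _ _).2 ?_)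
  rwa [show ((l.zip l').map fun e => e.1) = l from List.map_fst_zip h.le]

namespace Machine

def canonVal (N : ℕ) (vs : List ℕ) (v : ℕ) : ℕ :=
  bif eqb v.unpair.1 0 && decide (N ≤ v.unpair.2) then Nat.pair 0 (N + vs.idxOf v) else v

theorem canon_eq (N : ℕ) (vs : List ℕ) : canon N vs = vs.map (canonVal N vs) := rfl

theorem canonVal_cases {N : ℕ} {vs : List ℕ} {v : ℕ} (h : v ∈ vs) :
    ((v.unpair.1 = 0 → v.unpair.2 < N) ∧ canonVal N vs v = v) ∨
      ∃ i, i < vs.length ∧ vs[i]? = some v ∧ v.unpair.1 = 0 ∧ N ≤ v.unpair.2 ∧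
        canonVal N vs v = Nat.pair 0 (N + i) := by
  by_cases hv : v.unpair.1 = 0 ∧ N ≤ v.unpair.2
  · refine Or.inr ⟨vs.idxOf v, List.idxOf_lt_length_iff.2 h, ?_, hv.1, hv.2, ?_⟩
    · rw [List.getElem?_eq_getElem (List.idxOf_lt_length_iff.2 h), List.getElem_idxOf]
    · simp [canonVal, eqb, hv.1, hv.2]
  · refine Or.inl ⟨fun h0 => by_contra fun hc => hv ⟨h0, not_lt.1 hc⟩, ?_⟩
    have : (eqb v.unpair.1 0 && decide (N ≤ v.unpair.2)) = false := by
      simp only [eqb, ← Bool.decide_and, decide_eq_false_iff_not]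
      exact hv
    simp [canonVal, this]

/-- Unchanged codes are actor names or variables below `N`, while new numbers are variables from `N`
on; two equal new numbers mean the same first index. -/
theorem canonVal_inj {N : ℕ} {vs : List ℕ} {v w : ℕ} (hv : v ∈ vs) (hw : w ∈ vs) :
    v = w ↔ canonVal N vs v = canonVal N vs w := by
  refine ⟨fun h => h ▸ rfl, fun h => ?_⟩
  rcases canonVal_cases (N := N) hv with ⟨h1, h2⟩ | ⟨i, hi, h1, h2, h3, h4⟩ <;>
    rcases canonVal_cases (N := N) hw with ⟨h1', h2'⟩ | ⟨j, hj, h1', h2', h3', h4'⟩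
  · rw [← h2, h, h2']
  · have : v = Nat.pair 0 (N + j) := by rw [← h2, h, h4']
    have := h1 (by simp [this])
    simp only [‹v = _›, Nat.unpair_pair] at this
    omega
  · have : w = Nat.pair 0 (N + i) := by rw [← h2', ← h, h4]
    have := h1' (by simp [this])
    simp only [‹w = _›, Nat.unpair_pair] at this
    omega
  · rw [h4, h4', Nat.pair_eq_pair] at h
    obtain rfl : i = j := by omega
    exact Option.some.inj (h1.symm.trans h1')

theorem forall₂_zip_of_mem {r : Val → ℕ → Prop} {Us : List Val} {vs : List ℕ}
    (h : List.Forall₂ r Us vs) {U : Val} {v : ℕ} (hUv : (U, v) ∈ Us.zip vs) :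
    r U v ∧ U ∈ Us ∧ v ∈ vs :=
  ⟨(List.forall₂_iff_zip.1 h).2 hUv, List.of_mem_zip hUv⟩

theorem lookup_zip_sim (f : ℕ → ℕ) (xs : List Variable) {Us : List Val} {vs : List ℕ}
    (h : Us.length = vs.length) (x : Variable) :
    ((xs.zip Us).lookup x = none ∧ (xs.zip (vs.map f)).lookup x = none) ∨
      ∃ U v, (xs.zip Us).lookup x = some U ∧ (xs.zip (vs.map f)).lookup x = some (f v) ∧
        (U, v) ∈ Us.zip vs := by
  induction xs generalizing Us vs with
  | nil => simp
  | cons y xs ih =>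
    match Us, vs, h with
    | [], [], _ => simp
    | U :: Us, v :: vs, h =>
      simp only [List.zip_cons_cons, List.map_cons, List.lookup_cons]
      cases x == y with
      | true => exact Or.inr ⟨U, v, rfl, rfl, by simp⟩
      | false =>
        rcases ih (Nat.succ_injective h) with h | ⟨U', v', h1, h2, h3⟩
        · exact Or.inl h
        · exact Or.inr ⟨U', v', h1, h2, List.mem_cons_of_mem _ h3⟩

/-- The tables of a program, as a program of the machine. -/
def progOf (p : Program) (N : ℕ) : Prog :=
  (p.fieldTable, p.defs.map fun d => (d.cls, d.name, d.params, d.body.code), N)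

def startClo (N : ℕ) (d : MethodDef) (A : ActorName) (vs : List ℕ) : Clo :=
  (d.body.code, N + vs.length + 1, (0, Nat.pair 1 A.code) :: d.params.zip (canon N vs), [])

theorem start_eq_some_iff {p : Program} {N : ℕ} {A : ActorName} {m : Msg} {c : ℕ} {k : Clo} :
    start (progOf p N) A.code m c = some k ↔ ∃ C i d, A = .of C i ∧ p.defs[c]? = some d ∧
      d.cls = C ∧ d.name = m.1 ∧ d.params.length = m.2.length ∧ k = startClo N d A m.2 := by
  cases hd : p.defs[c]? with
  | none => simp [start, progOf, hd]
  | some d =>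
    cases A with
    | root => simp [start, progOf, hd, eqb, ActorName.code]
    | of C i =>
      by_cases h : d.cls = C ∧ d.name = m.1 ∧ d.params.length = m.2.length
      · obtain ⟨h1, h2, h3⟩ := h
        subst h1
        simp [start, progOf, hd, eqb, ActorName.code, h2, h3, startClo, eq_comm]
      · have hf : (eqb d.cls C && (eqb d.name m.1 && eqb d.params.length m.2.length)) = false := by
          simpa [eqb] using h
        simp only [start, progOf, List.getElem?_map, hd, Option.map_some, Option.bind_some,
          ActorName.code, Nat.add_sub_cancel, Nat.unpair_pair, hf, Bool.and_false, cond_false]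
        constructor
        · rintro ⟨⟩
        · rintro ⟨C', i', d', hA, hd', h1, h2, h3, -⟩
          simp only [Option.some.injEq, ActorName.of.injEq] at hd' hA
          subst hd'
          exact absurd ⟨h1.trans hA.1.symm, h2, h3⟩ h

/-- The renaming of the values that occur when a message is executed: rigid values, arguments, and
fresh variables. -/
def startRel (X : Set Variable) (N : ℕ) (Us : List Val) (vs : List ℕ)
    (fresh : List (Variable × Variable)) (u : Val) (v : ℕ) : Prop :=
  (Rigid X u ∧ v = u.code) ∨ (∃ w, (u, w) ∈ Us.zip vs ∧ v = canonVal N vs w) ∨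
    ∃ x y, (x, y) ∈ fresh ∧ u = .var y ∧ v = Nat.pair 0 (N + vs.length + 1 + x)

/-- On the machine's side, rigid values, renumbered arguments and fresh variables occupy separate
ranges. On the other side, fresh variables differ from arguments and rigid variables because they
are unused. Overlaps between rigid values and arguments are settled by the message's own renaming
`r`. -/
theorem renaming_startRel {X : Set Variable} {N : ℕ} {Us : List Val} {vs : List ℕ}
    {r : Val → ℕ → Prop} {xs ys : List Variable} (hX : ∀ x : ℕ, x ∈ X → x < N) (hr : Renaming X r)
    (hUv : List.Forall₂ r Us vs) (hxs : xs.Nodup) (hys : ys.Nodup)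
    (hy : ∀ y ∈ ys, y ∉ X ∧ .var y ∉ Us) : Renaming X (startRel X N Us vs (xs.zip ys)) := by
  have rigidMsg : ∀ u u' w, Rigid X u → (u', w) ∈ Us.zip vs →
      (u = u' ↔ u.code = canonVal N vs w) := by
    intro u u' w hu hw
    obtain ⟨h1, -, h2⟩ := forall₂_zip_of_mem hUv hw
    rw [hr.oneOne _ _ _ _ (hr.rigid u hu) h1]
    rcases canonVal_cases (N := N) h2 with ⟨-, h⟩ | ⟨i, -, -, h3, h4, h⟩
    · rw [h]
    · rw [h]
      cases u with
      | actor A =>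
        refine iff_of_false (fun hc => ?_) (by simp [Val.code])
        simp [← hc, Val.code] at h3
      | var x =>
        have := hX x hu
        refine iff_of_false (fun hc => ?_) (fun hc => ?_)
        · simp only [← hc, Val.code, Nat.unpair_pair] at h4
          omega
        · simp only [Val.code, Nat.pair_eq_pair, true_and] at hc
          omega
  have rigidFresh : ∀ u x y, Rigid X u → (x, y) ∈ xs.zip ys →
      (u = .var y ↔ u.code = Nat.pair 0 (N + vs.length + 1 + x)) := by
    intro u x y hu hxy
    have hy' := (hy y (List.of_mem_zip hxy).2).1
    refine iff_of_false ?_ ?_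
    · rintro rfl
      exact hy' hu
    · intro hc
      cases u with
      | actor A => simp [Val.code] at hc
      | var z =>
        have := hX z hu
        simp only [Val.code, Nat.pair_eq_pair, true_and] at hc
        omega
  have msgFresh : ∀ u w x y, (u, w) ∈ Us.zip vs → (x, y) ∈ xs.zip ys →
      (u = .var y ↔ canonVal N vs w = Nat.pair 0 (N + vs.length + 1 + x)) := by
    intro u w x y hw hxy
    have hy' := (hy y (List.of_mem_zip hxy).2).2
    obtain ⟨-, hu, h2⟩ := forall₂_zip_of_mem hUv hw
    refine iff_of_false (fun hc => hy' (hc ▸ hu)) (fun hc => ?_)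
    rcases canonVal_cases (N := N) h2 with ⟨h3, h⟩ | ⟨i, hi, -, -, -, h⟩
    · rw [h] at hc
      have := h3 (by simp [hc])
      simp only [hc, Nat.unpair_pair] at this
      omega
    · rw [h, Nat.pair_eq_pair] at hc
      omega
  refine ⟨?_, fun u hu => Or.inl ⟨hu, rfl⟩⟩
  rintro u v u' v' (⟨hu, rfl⟩ | ⟨w, hw, rfl⟩ | ⟨x, y, hxy, rfl, rfl⟩)
    (⟨hu', rfl⟩ | ⟨w', hw', rfl⟩ | ⟨x', y', hxy', rfl, rfl⟩)
  · exact Val.code_injective.eq_iff.symm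
  · exact rigidMsg u u' w' hu hw'
  · exact rigidFresh u x' y' hu hxy'
  · rw [eq_comm, rigidMsg u' u w hu' hw, eq_comm]
  · obtain ⟨h1, -, h2⟩ := forall₂_zip_of_mem hUv hw
    obtain ⟨h1', -, h2'⟩ := forall₂_zip_of_mem hUv hw'
    rw [hr.oneOne _ _ _ _ h1 h1', canonVal_inj h2 h2']
  · exact msgFresh u w x' y' hw hxy'
  · rw [eq_comm, rigidFresh u' x y hu' hxy, eq_comm]
  · rw [eq_comm, msgFresh u' w' x y hw' hxy, eq_comm]
  · simp [← fst_eq_iff_snd_eq_of_mem_zip hxs hys hxy hxy']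

/-- The new process gets the renaming `startRel`. That every variable in `X` is still used in `S`
guarantees that no fresh variable is rigid. -/
theorem procRel_start {p : Program} {X : Set Variable} {N : ℕ} {S : Config} {A : ActorName}
    {l : Local} {d : MethodDef} {M : Message} {q : List Message} {m : Msg}
    (hX : ∀ x ∈ X, S.Uses x ∧ x < N) (hd : d ∈ p.defs) (hp : p.IsRoBa)
    (hl : S.lookup A = some l) (hq : l.queue = M :: q) (hM : MsgRel X M m)
    (hlen : M.args.length = d.params.length) :
    ProcRel X (d.body.subst (d.binding S A M.args)) (startClo N d A m.2) := by
  obtain ⟨-, r, hr, hUv⟩ := hM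
  let xs := (d.body.fv \ insert thisVar d.params.toFinset).sort
  obtain ⟨hflen, hfnodup, hfresh⟩ := S.freshVars_spec xs.length
  refine ⟨startRel X N M.args m.2 (xs.zip (S.freshVars xs.length)), d.binding S A M.args, [],
    d.body, ⟨?_, rfl, ?_, .nil, hp.readOnly.2 d hd, fun _ => hp.boundedActors d hd, ?_⟩,
    (Proc.res_eq_subst _ _ _).symm⟩
  · refine renaming_startRel (fun x hx => (hX x hx).2) hr hUv (Finset.sort_nodup _ _) hfnodup ?_
    intro y hy
    refine ⟨fun hyX => hfresh y hy (hX y hyX).1, fun hyM => hfresh y hy ?_⟩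
    exact S.uses_of_lookup hl (Or.inr (Or.inr ⟨M, by simp [hq], hyM⟩))
  · intro x hx
    by_cases hx0 : x = thisVar
    · subst hx0
      refine Or.inl ?_
      simp [MethodDef.binding, Rigid, cloVar, startClo, thisVar, Val.code]
    · have hx0' : (x == 0) = false := beq_eq_false_iff_ne.2 hx0
      have hclo : cloVar (startClo N d A m.2) x =
          ((d.params.zip (m.2.map (canonVal N m.2))).lookup x).getD
            (Nat.pair 0 (N + m.2.length + 1 + x)) := by
        simp [cloVar, startClo, List.lookup_cons, hx0', canon_eq]
      rw [hclo]
      rcases lookup_zip_sim (canonVal N m.2) d.params hUv.length_eq x with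
        ⟨h1, h2⟩ | ⟨U, v, h1, h2, h3⟩
      · have hxp : x ∉ d.params := by
          intro hxp
          obtain ⟨U, hU⟩ := lookup_zip_isSome hlen.symm hxp
          simp [h1] at hU
        have hxs : x ∈ xs := by simp [xs, hx, hx0, hxp]
        obtain ⟨y, hy⟩ := lookup_zip_isSome hflen.symm hxs
        refine Or.inr (Or.inr ⟨x, y, mem_of_lookup hy, ?_, by rw [h2]; rfl⟩)
        simp only [MethodDef.binding, if_neg hx0, h1]
        exact congrArg Val.var (by rw [hy]; rfl)
      · refine Or.inr (Or.inl ⟨v, ?_, by rw [h2]; rfl⟩)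
        simpa only [MethodDef.binding, if_neg hx0, h1] using h3
  · simp [startClo]

end Machine

/-! The machine simulates the transition system, and conversely. -/

namespace Machine

/-- The machine configuration `T` represents `S`, up to renamings that fix some variables which
occur in `S` and are below `N`. -/
def CfgRel (N : ℕ) (S : Config) (T : Cfg) : Prop :=
  ∃ X : Set Variable, (∀ x : ℕ, x ∈ X → S.Uses x ∧ x < N) ∧ Rel X S T

theorem MsgRel.anti {X Y : Set Variable} (hY : Y ⊆ X) {M : Message} {m : Msg}
    (h : MsgRel X M m) : MsgRel Y M m := by
  obtain ⟨h1, r, h2, h3⟩ := h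
  exact ⟨h1, r, h2.anti hY, h3⟩

theorem LocRel.anti {X Y : Set Variable} (hY : Y ⊆ X) {l : Local} {t : Ent} (h : LocRel X l t)
    (hfv : ∀ x ∈ X, x ∈ l.proc.fv → x ∈ Y)
    (hst : ∀ x ∈ X, (∃ e ∈ l.state, e.2 = .var x) → x ∈ Y) : LocRel Y l t := by
  obtain ⟨r, σ, ρ, P₀, hclo, hP⟩ := h.proc
  refine ⟨⟨r, σ, ρ, P₀, ⟨hclo.ren.anti hY, hclo.code, hclo.vars, hclo.env, hclo.noUpdate,
    hclo.noNew, fun hk x hx => ?_⟩, hP⟩, h.state, fun e he => ?_, h.queue.imp fun _ _ => .anti hY⟩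
  · exact hfv x (hclo.fv hk x hx) (hP ▸ hx)
  · have := h.rigid e he
    rcases hv : e.2 with x | A
    · rw [hv] at this
      exact hst x this ⟨e, he, hv⟩
    · trivial

/-- A rigid variable that has disappeared may be chosen again as a fresh one, so after each step `X`
is cut down to the variables still in use. Renamings survive, as fewer values have to be fixed. -/
theorem Rel.cfgRel {X : Set Variable} {N : ℕ} {S : Config} {T : Cfg} (h : Rel X S T)
    (hX : ∀ x : ℕ, x ∈ X → x < N) : CfgRel N S T := by
  refine ⟨{x | x ∈ X ∧ S.Uses x}, fun x hx => ⟨hx.2, hX x hx.1⟩, ?_⟩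
  have key : ∀ S' T', S' ⊆ S → Rel X S' T' → Rel {x | x ∈ X ∧ S.Uses x} S' T' := by
    intro S' T' hS' h
    induction h with
    | nil => exact .nil
    | @cons e f S' T' hef _ ih =>
      have he : e ∈ S := hS' (by simp)
      refine .cons ⟨hef.1, hef.2.anti (fun x hx => hx.1) ?_ ?_⟩
        (ih fun e he => hS' (List.mem_cons_of_mem _ he))
      · exact fun x hx hx' => ⟨hx, e, he, Or.inl hx'⟩
      · exact fun x hx hx' => ⟨hx, e, he, Or.inr (Or.inl hx')⟩
  exact key S T (fun _ h => h) h

section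

variable {X : Set Variable} {k : Clo}

theorem ProcRel.zero_inv (h : ProcRel X .zero k) : k.1 = 0 := by
  obtain ⟨r, σ, ρ, P₀, hclo, hP⟩ := h
  cases P₀ with
  | zero => exact hclo.code
  | _ => simp [Proc.res] at hP

theorem ProcRel.upd_inv {f : FieldName} {E : Expr} {P : Proc} : ¬ ProcRel X (.upd f E P) k := by
  rintro ⟨r, σ, ρ, P₀, hclo, hP⟩
  cases P₀ with
  | upd => exact hclo.noUpdate
  | _ => simp [Proc.res] at hP

theorem ProcRel.letIn_inv {E : Expr} {P : Proc} (h : ProcRel X (.letIn E P) k) :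
    ∃ r σ ρ E₀ P₀, CloRel X r σ ρ (.letIn E₀ P₀) k ∧ E = E₀.res σ ρ 0 ∧ P = P₀.res σ ρ 1 := by
  obtain ⟨r, σ, ρ, P₀, hclo, hP⟩ := h
  cases P₀ with
  | letIn E₀ P₀ =>
    simp only [Proc.res, Proc.letIn.injEq] at hP
    exact ⟨r, σ, ρ, E₀, P₀, hclo, hP.1, hP.2⟩
  | _ => simp [Proc.res] at hP

theorem ProcRel.call_inv {s : Ref} {m : MethodName} {Es : List Expr} {P : Proc}
    (h : ProcRel X (.call s m Es P) k) :
    ∃ r σ ρ s₀ Es₀ P₀, CloRel X r σ ρ (.call s₀ m Es₀ P₀) k ∧ s = s₀.res σ ρ 0 ∧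
      Es = Expr.resList σ ρ 0 Es₀ ∧ P = P₀.res σ ρ 0 := by
  obtain ⟨r, σ, ρ, P₀, hclo, hP⟩ := h
  cases P₀ with
  | call s₀ m₀ Es₀ P₀ =>
    simp only [Proc.res, Proc.call.injEq] at hP
    obtain ⟨h1, rfl, h2, h3⟩ := hP
    exact ⟨r, σ, ρ, s₀, Es₀, P₀, hclo, h1, h2, h3⟩
  | _ => simp [Proc.res] at hP

theorem ProcRel.cond_inv {E E' : Expr} {P Q : Proc} (h : ProcRel X (.cond E E' P Q) k) :
    ∃ r σ ρ E₀ E₀' P₀ Q₀, CloRel X r σ ρ (.cond E₀ E₀' P₀ Q₀) k ∧ E = E₀.res σ ρ 0 ∧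
      E' = E₀'.res σ ρ 0 ∧ P = P₀.res σ ρ 0 ∧ Q = Q₀.res σ ρ 0 := by
  obtain ⟨r, σ, ρ, P₀, hclo, hP⟩ := h
  cases P₀ with
  | cond E₀ E₀' P₀ Q₀ =>
    simp only [Proc.res, Proc.cond.injEq] at hP
    exact ⟨r, σ, ρ, E₀, E₀', P₀, Q₀, hclo, hP⟩
  | _ => simp [Proc.res] at hP

theorem ProcRel.plus_inv {P Q : Proc} (h : ProcRel X (.plus P Q) k) :
    ∃ r σ ρ P₀ Q₀, CloRel X r σ ρ (.plus P₀ Q₀) k ∧ P = P₀.res σ ρ 0 ∧ Q = Q₀.res σ ρ 0 := by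
  obtain ⟨r, σ, ρ, P₀, hclo, hP⟩ := h
  cases P₀ with
  | plus P₀ Q₀ =>
    simp only [Proc.res, Proc.plus.injEq] at hP
    exact ⟨r, σ, ρ, P₀, Q₀, hclo, hP⟩
  | _ => simp [Proc.res] at hP

theorem CloRel.ne_zero {r : Val → ℕ → Prop} {σ : Variable → Val} {ρ : List Val} {P : Proc}
    (h : CloRel X r σ ρ P k) (hP : P ≠ .zero) : k.1 ≠ 0 := by
  rw [h.code]
  cases P <;> simp_all [Proc.code]

end

section

variable {p : Program} {N : ℕ} {S S' : Config} {T T' : Cfg}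

theorem CfgRel.step (hp : p.IsRoBa) (h : CfgRel N S T) (hs : Step p S S') :
    ∃ T', Move (progOf p N) T T' ∧ CfgRel N S' T' := by
  obtain ⟨X, hX, hST⟩ := h
  have hXN : ∀ x : ℕ, x ∈ X → x < N := fun x hx => (hX x hx).2
  cases hs with
  | upd hA =>
    obtain ⟨⟨k, φ', q'⟩, -, hl⟩ := hST.lookup_some hA
    exact absurd hl.proc ProcRel.upd_inv
  | @letIn S' A E P φ q U hA hE =>
    obtain ⟨⟨k, φ', q'⟩, hT, hl⟩ := hST.lookup_some hA
    obtain ⟨r, σ, ρ, E, P, hclo, rfl, rfl⟩ := hl.proc.letIn_inv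
    obtain rfl : φ' = stateCode φ := hl.state
    rcases let_sim (p := p) hclo hl.rigid hl.queue hST A with
      ⟨V, S'', k', T', h1, h2, h3⟩ | ⟨h1, -⟩
    · obtain ⟨rfl, rfl⟩ : V = U ∧ S'' = S' := by simpa [h1] using hE
      exact ⟨_, ⟨_, 0, step_proc hT (hclo.ne_zero (by simp)) (h2 0) (by simp)⟩, h3.cfgRel hXN⟩
    · simp [h1] at hE
  | @invkSelf S' A m Es P φ q Us hA hE =>
    obtain ⟨⟨k, φ', q'⟩, hT, hl⟩ := hST.lookup_some hA
    obtain ⟨r, σ, ρ, s, Es, P, hclo, hs, rfl, rfl⟩ := hl.proc.call_inv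
    obtain rfl : φ' = stateCode φ := hl.state
    rcases call_sim (p := p) hclo hl.rigid hST with
      ⟨B, Vs, S'', k', T', vs, h1, h2, h3, h4, h5, h6, h7⟩ | ⟨h1, -⟩
    · obtain rfl : A = B := by simpa [← hs] using h1
      obtain ⟨rfl, rfl⟩ : Vs = Us ∧ S'' = S' := by simpa [h2] using hE
      exact ⟨_, ⟨_, 0, step_proc hT (hclo.ne_zero (by simp)) (h3 0)
        (List.forall_mem_singleton.2 (Option.isSome_iff_exists.2 ⟨_, hT⟩))⟩,
        (send_self h4 h6 hl.rigid hl.queue h7).cfgRel hXN⟩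
    · exact absurd hE (h1 _ _ _ hs.symm)
  | @invk S' A B m Es P P' φ φ₂ q q₂ Us hAB hA hB hE =>
    obtain ⟨⟨k, φ', q'⟩, hT, hl⟩ := hST.lookup_some hA
    obtain ⟨tB, hTB, hlB⟩ := hST.lookup_some hB
    obtain ⟨r, σ, ρ, s, Es, P, hclo, hs, rfl, rfl⟩ := hl.proc.call_inv
    obtain rfl : φ' = stateCode φ := hl.state
    rcases call_sim (p := p) hclo hl.rigid hST with
      ⟨B', Vs, S'', k', T', vs, h1, h2, h3, h4, h5, h6, h7⟩ | ⟨h1, -⟩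
    · obtain rfl : B = B' := by simpa [← hs] using h1
      obtain ⟨rfl, rfl⟩ : Vs = Us ∧ S'' = S' := by simpa [h2] using hE
      exact ⟨_, ⟨_, 0, step_proc hT (hclo.ne_zero (by simp)) (h3 0)
        (List.forall_mem_singleton.2 (Option.isSome_iff_exists.2 ⟨_, hTB⟩))⟩,
        (send_other hAB h4 h6 hl.rigid hl.queue (h5.lookup _ _ hTB) hlB h7).cfgRel hXN⟩
    · exact absurd hE (h1 _ _ _ hs.symm)
  | @inst C i d φ q Us hd hC hlen hA =>
    obtain ⟨⟨k, φ', q'⟩, hT, hl⟩ := hST.lookup_some hA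
    obtain rfl : φ' = stateCode φ := hl.state
    obtain ⟨m, q', hm, hq, rfl⟩ := List.forall₂_cons_left_iff.1 hl.queue
    obtain ⟨c, hc, rfl⟩ := List.mem_iff_getElem.1 hd
    have hstart : start (progOf p N) (ActorName.of C i).code m c =
        some (startClo N p.defs[c] (.of C i) m.2) := by
      obtain ⟨hname, r, -, hUv⟩ := hm
      exact start_eq_some_iff.2 ⟨C, i, _, rfl, List.getElem?_eq_getElem hc, hC, hname.symm,
        hlen.symm.trans hUv.length_eq, rfl⟩
    refine ⟨_, ⟨_, c, step_pop hT hl.proc.zero_inv hstart⟩, (hST.put (l := ⟨_, φ, q⟩) _ ⟨?_, rfl, hl.rigid, hq⟩).cfgRel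
      hXN⟩
    exact procRel_start (M := ⟨p.defs[c].name, Us⟩) hX hd hp hA rfl hm hlen
  | @isEq S' A E E' P Q φ q U hA hE =>
    obtain ⟨⟨k, φ', q'⟩, hT, hl⟩ := hST.lookup_some hA
    obtain ⟨r, σ, ρ, E, E', P, Q, hclo, rfl, rfl, rfl, rfl⟩ := hl.proc.cond_inv
    obtain rfl : φ' = stateCode φ := hl.state
    rcases cond_sim (p := p) hclo hl.rigid hl.queue hST A with
      ⟨V, W, S'', k', T', h1, h2, h3⟩ | ⟨h1, -⟩
    · obtain ⟨⟨rfl, rfl⟩, rfl⟩ : (V = U ∧ W = U) ∧ S'' = S' := by simpa [h1] using hE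
      rw [if_pos rfl] at h3
      exact ⟨_, ⟨_, 0, step_proc hT (hclo.ne_zero (by simp)) (h2 0) (by simp)⟩, h3.cfgRel hXN⟩
    · simp [h1] at hE
  | @isNe S' A E E' P Q φ q U U' hA hE hne =>
    obtain ⟨⟨k, φ', q'⟩, hT, hl⟩ := hST.lookup_some hA
    obtain ⟨r, σ, ρ, E, E', P, Q, hclo, rfl, rfl, rfl, rfl⟩ := hl.proc.cond_inv
    obtain rfl : φ' = stateCode φ := hl.state
    rcases cond_sim (p := p) hclo hl.rigid hl.queue hST A with
      ⟨V, W, S'', k', T', h1, h2, h3⟩ | ⟨h1, -⟩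
    · obtain ⟨⟨rfl, rfl⟩, rfl⟩ : (V = U ∧ W = U') ∧ S'' = S' := by simpa [h1] using hE
      rw [if_neg hne] at h3
      exact ⟨_, ⟨_, 0, step_proc hT (hclo.ne_zero (by simp)) (h2 0) (by simp)⟩, h3.cfgRel hXN⟩
    · simp [h1] at hE
  | @plusL A P Q φ q hA =>
    obtain ⟨⟨k, φ', q'⟩, hT, hl⟩ := hST.lookup_some hA
    obtain ⟨r, σ, ρ, P, Q, hclo, rfl, rfl⟩ := hl.proc.plus_inv
    obtain rfl : φ' = stateCode φ := hl.state
    obtain ⟨k', h1, h2⟩ := plus_sim (p := p) hclo hl.rigid hl.queue hST A 0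
    exact ⟨_, ⟨_, 0, step_proc hT (hclo.ne_zero (by simp)) h1 (by simp)⟩, h2.cfgRel hXN⟩
  | @plusR A P Q φ q hA =>
    obtain ⟨⟨k, φ', q'⟩, hT, hl⟩ := hST.lookup_some hA
    obtain ⟨r, σ, ρ, P, Q, hclo, rfl, rfl⟩ := hl.proc.plus_inv
    obtain rfl : φ' = stateCode φ := hl.state
    obtain ⟨k', h1, h2⟩ := plus_sim (p := p) hclo hl.rigid hl.queue hST A 1
    exact ⟨_, ⟨_, 1, step_proc hT (hclo.ne_zero (by simp)) h1 (by simp)⟩, h2.cfgRel hXN⟩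

/-- Together with `CfgRel.step` this makes the relation a bisimulation, so infinite computations
transfer both ways. -/
theorem CfgRel.move (hp : p.IsRoBa) (h : CfgRel N S T) (hs : Move (progOf p N) T T') :
    ∃ S', Step p S S' ∧ CfgRel N S' T' := by
  obtain ⟨X, hX, hST⟩ := h
  have hXN : ∀ x : ℕ, x ∈ X → x < N := fun x hx => (hX x hx).2
  obtain ⟨a, c, hs⟩ := hs
  obtain ⟨A, rfl⟩ := ActorName.code_surjective a
  obtain ⟨k, φ', q', hT, hcases⟩ := step_cases hs
  rcases hST.lookup A with ⟨-, hnone⟩ | ⟨⟨P, φ, q⟩, t, hA, ht, hl⟩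
  · simp [hnone] at hT
  obtain rfl : t = (k, φ', q') := by simpa [ht] using hT
  obtain rfl : φ' = stateCode φ := hl.state
  obtain ⟨r, σ, ρ, P₀, hclo, rfl : P = _⟩ := hl.proc
  have hnz : P₀ ≠ .zero → ∃ o, core p.fieldTable (stateCode φ) T k c = some o ∧
      (∀ e ∈ o.2.2, (T.lookup e.1).isSome) ∧
      T' = o.2.2.foldl send (put o.2.1 A.code (o.1, stateCode φ, q')) := by
    intro hP
    rcases hcases with ⟨hk, -⟩ | ⟨-, h⟩
    · exact absurd hk (hclo.ne_zero hP)
    · exact h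
  cases P₀ with
  | zero =>
    rcases hcases with ⟨-, m, q₁, k', rfl, hstart, rfl⟩ | ⟨hk, -⟩
    · obtain ⟨C, i, d, rfl, hd, hC, hname, hlen, rfl⟩ := start_eq_some_iff.1 hstart
      obtain ⟨M, q, hm, hq, rfl : _ = _⟩ := List.forall₂_cons_right_iff.1 hl.queue
      have hd' := List.mem_of_getElem? hd
      have hlen' : M.args.length = d.params.length := by
        obtain ⟨-, r, -, hUv⟩ := hm
        exact hUv.length_eq.trans hlen.symm
      obtain ⟨n, Us⟩ := M
      obtain rfl : d.name = n := hname.trans hm.1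
      refine ⟨_, .inst hd' hC hlen' hA, (hST.put (l := ⟨_, φ, q⟩) _ ⟨?_, rfl, hl.rigid, hq⟩).cfgRel hXN⟩
      exact procRel_start (M := ⟨d.name, Us⟩) hX hd' hp hA rfl hm hlen'
    · exact absurd hclo.code hk
  | upd f E P => exact absurd hclo.noUpdate id
  | letIn E P =>
    obtain ⟨o, ho, -, rfl⟩ := hnz (by simp)
    rcases let_sim (p := p) hclo hl.rigid hl.queue hST A with
      ⟨U, S', k', T', h1, h2, h3⟩ | ⟨-, h1⟩
    · obtain rfl : (k', T', []) = o := by simpa [h2] using ho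
      exact ⟨_, .letIn hA h1, h3.cfgRel hXN⟩
    · simp [h1] at ho
  | call s m Es P =>
    obtain ⟨o, ho, hkeys, rfl⟩ := hnz (by simp)
    rcases call_sim (p := p) hclo hl.rigid hST with
      ⟨B, Us, S', k', T', vs, h1, h2, h3, h4, h5, h6, h7⟩ | ⟨-, h1⟩
    · obtain rfl : (k', T', [(B.code, (m, vs))]) = o := by simpa [h3] using ho
      simp only [Proc.res, h1] at hA
      by_cases hAB : A = B
      · subst hAB
        exact ⟨_, .invkSelf hA h2, (send_self h4 h6 hl.rigid hl.queue h7).cfgRel hXN⟩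
      · rcases hST.lookup B with ⟨-, hnone⟩ | ⟨⟨P', φ₂, q₂⟩, tB, hB, hTB, hlB⟩
        · obtain ⟨t, ht⟩ := Option.isSome_iff_exists.1 (hkeys _ (List.mem_singleton.2 rfl))
          exact absurd (ht.symm.trans hnone) (by simp)
        · exact ⟨_, .invk hAB hA hB h2,
            (send_other hAB h4 h6 hl.rigid hl.queue (h5.lookup _ _ hTB) hlB h7).cfgRel hXN⟩
    · simp [h1] at ho
  | cond E E' P Q =>
    obtain ⟨o, ho, -, rfl⟩ := hnz (by simp)
    rcases cond_sim (p := p) hclo hl.rigid hl.queue hST A with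
      ⟨U, V, S', k', T', h1, h2, h3⟩ | ⟨-, h1⟩
    · obtain rfl : (k', T', []) = o := by simpa [h2] using ho
      by_cases hUV : U = V
      · subst hUV
        rw [if_pos rfl] at h3
        exact ⟨_, .isEq hA h1, h3.cfgRel hXN⟩
      · rw [if_neg hUV] at h3
        exact ⟨_, .isNe hA h1 hUV, h3.cfgRel hXN⟩
    · simp [h1] at ho
  | plus P Q =>
    obtain ⟨o, ho, -, rfl⟩ := hnz (by simp)
    obtain ⟨k', h1, h2⟩ := plus_sim (p := p) hclo hl.rigid hl.queue hST A c
    obtain rfl : (k', T, []) = o := by simpa [h1] using ho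
    by_cases hc : c = 0
    · rw [if_pos hc] at h2
      exact ⟨_, .plusL hA, h2.cfgRel hXN⟩
    · rw [if_neg hc] at h2
      exact ⟨_, .plusR hA, h2.cfgRel hXN⟩

end

/-- The start configuration of the machine. -/
def cfgOf (a : ConfigCode) : Cfg := a.map fun t => (t.1, ((t.2.1, 0, [], []), t.2.2.1, t.2.2.2))

/-- Everything in `S` counts as rigid and is represented by its own code. All processes get offset
zero, so `new` may still occur in any of them. -/
theorem cfgRel_code {S : Config} (hS : ∀ e ∈ S, e.2.proc.NoUpdate) :
    CfgRel (Encodable.encode S.code + 1) S (cfgOf S.code) := by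
  refine ⟨{x | S.Uses x}, fun x hx => ⟨hx, Nat.lt_succ_of_le hx.le_encode⟩, ?_⟩
  have hren : Renaming {x | S.Uses x} fun u v => v = u.code := by
    refine ⟨?_, fun _ _ => rfl⟩
    rintro u _ u' _ rfl rfl
    exact Val.code_injective.eq_iff.symm
  unfold Rel cfgOf Config.code
  rw [List.map_map, List.forall₂_map_right_iff, List.forall₂_same]
  rintro ⟨A, P, φ, q⟩ he
  refine ⟨rfl, ⟨_, .var, [], P, ⟨hren, rfl, ?_, .nil, hS _ he, fun h => absurd rfl h, ?_⟩, ?_⟩,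
    rfl, ?_, ?_⟩
  · intro x _
    simp [cloVar, Val.code]
  · intro _ x hx
    rw [Proc.res_eq_subst, Proc.subst_var] at hx
    exact ⟨_, he, Or.inl hx⟩
  · rw [Proc.res_eq_subst, Proc.subst_var]
  · intro e he'
    rcases hv : e.2 with x | B
    · exact ⟨_, he, Or.inr (Or.inl ⟨e, he', hv⟩)⟩
    · trivial
  · simp only [Function.comp, List.forall₂_map_right_iff]
    rw [List.forall₂_same]
    refine fun M _ => ⟨rfl, _, hren, ?_⟩
    simp only [List.forall₂_map_right_iff]
    exact List.forall₂_same.2 fun _ _ => rfl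

theorem CfgRel.noUpdate {N : ℕ} {S : Config} {T : Cfg} (h : CfgRel N S T) :
    ∀ e ∈ S, e.2.proc.NoUpdate := by
  obtain ⟨X, -, h⟩ := h
  intro e he
  obtain ⟨hlen, hget⟩ := List.forall₂_iff_get.1 h
  obtain ⟨i, hi, rfl⟩ := List.mem_iff_getElem.1 he
  have hf := (hget i hi (hlen ▸ hi)).2
  obtain ⟨r, σ, ρ, P₀, hclo, hP⟩ := hf.proc
  exact hP ▸ Proc.noUpdate_res hclo.noUpdate

theorem diverges_iff {p : Program} {S : Config} (hp : p.IsRoBa) (hS : p.Reachable S) :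
    Diverges (Step p) S ↔
      Diverges (Move (progOf p (Encodable.encode S.code + 1))) (cfgOf S.code) := by
  -- Reachability serves only to show that `S` contains no field update; the simulation is then
  -- restarted from the code of `S` itself.
  have hrel : ∃ N T, CfgRel N S T := by
    induction hS with
    | refl =>
      refine ⟨_, _, cfgRel_code ?_⟩
      simpa [Program.initial] using hp.readOnly.1
    | tail _ hs ih =>
      obtain ⟨N, T, h⟩ := ih
      obtain ⟨T', -, h'⟩ := h.step hp hs
      exact ⟨N, T', h'⟩
  obtain ⟨N, T, h⟩ := hrel
  have h := cfgRel_code h.noUpdate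
  exact ⟨Diverges.simulation (CfgRel _) (fun S T S' h hs => h.step hp hs) h,
    Diverges.simulation (fun T S => CfgRel _ S T) (fun T S T' h hs => h.move hp hs) h⟩

end Machine

/-! The decision procedure: search for a bound on the lengths of computations, or for a certificate
for an infinite computation. -/

namespace Machine

def inputProg (a : ProgramCode × ConfigCode) : Prog :=
  (a.1.2.1, a.1.2.2, Encodable.encode a.2 + 1)

def haltsWithin (a : ProgramCode × ConfigCode) (n : ℕ) : Bool :=
  decide ((level (inputProg a) (cfgOf a.2) n).length = 0)

def certifies (a : ProgramCode × ConfigCode) (n : ℕ) : Bool :=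
  ((Encodable.decode (α := List (ℕ × ℕ) × Cert) n).map fun w =>
    checkRun (inputProg a) (cfgOf a.2) w).getD false

theorem haltsWithin_iff (a : ProgramCode × ConfigCode) :
    (∃ n, haltsWithin a n = true) ↔ ¬ Diverges (Move (inputProg a)) (cfgOf a.2) := by
  simp [not_diverges_iff, haltsWithin]

theorem certifies_iff (a : ProgramCode × ConfigCode) :
    (∃ n, certifies a n = true) ↔ Diverges (Move (inputProg a)) (cfgOf a.2) := by
  rw [diverges_iff_exists_checkRun]
  constructor
  · rintro ⟨n, hn⟩
    unfold certifies at hn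
    cases hw : Encodable.decode (α := List (ℕ × ℕ) × Cert) n with
    | none => rw [hw] at hn; cases hn
    | some w => rw [hw] at hn; exact ⟨w, hn⟩
  · rintro ⟨w, hw⟩
    exact ⟨Encodable.encode w, by rw [certifies, Encodable.encodek]; exact hw⟩

theorem exists_verdict (a : ProgramCode × ConfigCode) :
    ∃ n, (haltsWithin a n || certifies a n) = true := by
  by_cases h : Diverges (Move (inputProg a)) (cfgOf a.2)
  · obtain ⟨n, hn⟩ := (certifies_iff a).2 h
    exact ⟨n, by simp [hn]⟩
  · obtain ⟨n, hn⟩ := (haltsWithin_iff a).2 h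
    exact ⟨n, by simp [hn]⟩

/-- Searches for the first evidence of either kind and reports which kind it is. The search ends on
every input, coming from a program or not, because the dichotomy holds for the machine itself. -/
def decideTermination (a : ProgramCode × ConfigCode) : Bool :=
  haltsWithin a (Nat.find (exists_verdict a))

theorem decideTermination_iff (a : ProgramCode × ConfigCode) :
    decideTermination a = true ↔ ¬ Diverges (Move (inputProg a)) (cfgOf a.2) := by
  refine ⟨fun h => (haltsWithin_iff a).1 ⟨_, h⟩, fun h => ?_⟩
  have := Nat.find_spec (exists_verdict a)
  rw [Bool.or_eq_true] at this
  exact this.resolve_right fun hc => h ((certifies_iff a).1 ⟨_, hc⟩)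

theorem inputProg_primrec : Primrec inputProg := by
  have : Primrec fun a : ProgramCode × ConfigCode => Encodable.encode a.2 :=
    Primrec.encode.comp Primrec.snd
  unfold inputProg
  fun_prop

theorem cfgOf_primrec : Primrec cfgOf := by
  unfold cfgOf
  fun_prop

theorem haltsWithin_primrec :
    Primrec fun q : (ProgramCode × ConfigCode) × ℕ => haltsWithin q.1 q.2 := by
  have h1 : Primrec fun q : (ProgramCode × ConfigCode) × ℕ => inputProg q.1 :=
    inputProg_primrec.comp Primrec.fst
  have h2 : Primrec fun q : (ProgramCode × ConfigCode) × ℕ => cfgOf q.1.2 :=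
    cfgOf_primrec.comp (Primrec.snd.comp Primrec.fst)
  have h3 := level_primrec h1 h2 Primrec.snd
  unfold haltsWithin
  fun_prop

theorem certifies_primrec :
    Primrec fun q : (ProgramCode × ConfigCode) × ℕ => certifies q.1 q.2 := by
  have h1 : Primrec fun q : ((ProgramCode × ConfigCode) × ℕ) × List (ℕ × ℕ) × Cert =>
      inputProg q.1.1 := inputProg_primrec.comp (Primrec.fst.comp Primrec.fst)
  have h2 : Primrec fun q : ((ProgramCode × ConfigCode) × ℕ) × List (ℕ × ℕ) × Cert =>
      cfgOf q.1.1.2 := cfgOf_primrec.comp (Primrec.snd.comp (Primrec.fst.comp Primrec.fst))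
  have h3 := checkRun_primrec.comp (h1.pair (h2.pair Primrec.snd))
  exact Primrec.option_getD.comp
    (Primrec.option_map (Primrec.decode.comp Primrec.snd) h3.to₂) (Primrec.const false)

theorem verdict_computable : Computable fun a => Nat.find (exists_verdict a) := by
  have hv : Primrec fun q : (ProgramCode × ConfigCode) × ℕ =>
      haltsWithin q.1 q.2 || certifies q.1 q.2 :=
    Primrec.or.comp haltsWithin_primrec certifies_primrec
  have hp : PrimrecPred fun q : (ProgramCode × ConfigCode) × ℕ =>
      (haltsWithin q.1 q.2 || certifies q.1 q.2) = true :=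
    ⟨fun q => inferInstance, hv.of_eq fun q => by rw [Bool.decide_eq_true]⟩
  exact Computable.find (P := fun a n => (haltsWithin a n || certifies a n) = true)
    hp.computablePred exists_verdict

theorem decideTermination_computable : Computable decideTermination := by
  exact (haltsWithin_primrec.to_comp.comp (Computable.id.pair verdict_computable) :)

theorem decideTermination_code {p : Program} {S : Config} (hp : p.IsRoBa) (hS : p.Reachable S) :
    decideTermination (p.code, S.code) = true ↔ p.TerminatesFrom S :=
  (decideTermination_iff _).trans (not_congr (diverges_iff hp hS).symm)

end Machine

theorem mainTheorem4 :
    (∃ f : ProgramCode → Bool, Computable f ∧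
      ∀ p : Program, p.IsRoBa → (f p.code = true ↔ p.Terminates)) ∧
    (∃ g : ProgramCode × ConfigCode → Bool, Computable g ∧
      ∀ (p : Program) (S : Config), p.IsRoBa → p.Reachable S →
        (g (p.code, S.code) = true ↔ p.TerminatesFrom S)) := by
  -- The list is the code of the initial configuration: the root has code `0`, and `a.1` is the code
  -- of the main process.
  refine ⟨⟨fun a => Machine.decideTermination (a, [(0, a.1, [], [])]), ?_, fun p hp =>
    Machine.decideTermination_code (S := p.initial) hp .refl⟩,
    Machine.decideTermination, Machine.decideTermination_computable,
    fun p S hp hS => Machine.decideTermination_code hp hS⟩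
  have : Primrec fun a : ProgramCode => (a, [(0, a.1, ([] : List (ℕ × ℕ)),
      ([] : List (ℕ × List ℕ)))]) := by fun_prop
  exact Machine.decideTermination_computable.comp this.to_comp
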